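/- Let $(\Sigma,g)$ be a closed connected oriented hyperbolic surface, i.e. a smooth compact connected surface without boundary with an orientation and a Riemannian metric $g$ of constant curvature $\kappa=-1$. Let $\sigma$ be its Riemannian area form, $\iota$ the complex structure with $\sigma(\cdot,\cdot)=g(\iota\,\cdot,\cdot)$, $\pi:T\Sigma\to\Sigma$ the projection, $\alpha_{(x,v)}(\xi)=g_x(v,d\pi\,\xi)$ the canonical one-form on $T\Sigma$, and $\omega_s=d\alpha-s\,\pi^*\sigma$ for $s\in\mathbb R$. For $0\le a<b$ put $D_a^b\Sigma=\{(x,v)\in T\Sigma : a<|v|<b\}$; thus $D_0^b\Sigma$ is the open disc bundle of radius $b$ with the zero section removed. Let $H_{(x,v)}$ be the horizontal lift of $\iota_x v$ to $T_{(x,v)}T\Sigma$ with respect to the Levi-Civita connection, and for $c\in\mathbb R$ let $m_c(x,v)=(x,cv)$. Let $0\le s<\lambda$. Then the vector field $-H$ has a globally defined flow $(\phi_t)_{t\in\mathbb R}$ on $T\Sigma$, and the map $$F(x,v)=m_{a_s(r)}\bigl(\phi_{b_s(r)}(x,v)\bigr),\qquad r=|v|,\qquad a_s(r)=\frac{\sqrt{r^2-s^2}}{r},\qquad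 b_s(r)=\frac1{2r}\ln\frac{r-s}{r+s},$$ is a symplectomorphism $$F:(D_s^\lambda\Sigma,\ \omega_s)\longrightarrow\bigl(D_0^{\sqrt{\lambda^2-s^2}}\Sigma,\ \omega_0=d\alpha\bigr),$$ that is, a smooth diffeomorphism of $D_s^\lambda\Sigma$ onto $D_0^{\sqrt{\lambda^2-s^2}}\Sigma$ with $F^*\omega_0=\omega_s$. -/

import Mathlib

open Bundle
open scoped Manifold ContDiff Topology

noncomputable section

namespace TwistedBundle

/-! ### Differential forms, exterior derivative and flows on a manifold -/

section General

variable {E : Type*} [NormedAddCommGroup E] [NormedSpace ℝ E]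
  {H : Type*} [TopologicalSpace H] (J : ModelWithCorners ℝ E H)
  {N : Type*} [TopologicalSpace N] [ChartedSpace H N]

/-- The exterior derivative of a differential `k`-form `η` on a manifold without boundary, at the
point `p`: pull `η` back to the model space by the inverse of the chart at `p`, take the exterior
derivative there, and read the result as a form on the tangent space at `p` (Mathlib identifies
`TangentSpace J p` with the model vector space through this same chart). -/
def mextDeriv [J.Boundaryless] {k : ℕ} (η : ∀ p : N, TangentSpace J p [⋀^Fin k]→L[ℝ] ℝ) (p : N) :
    TangentSpace J p [⋀^Fin (k + 1)]→L[ℝ] ℝ :=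
  extDeriv (E := E)
    (fun y : E ↦ (η ((extChartAt J p).symm y)).compContinuousLinearMap
      (mfderiv 𝓘(ℝ, E) J (extChartAt J p).symm y))
    (extChartAt J p p)

/-- `φ` is the (globally defined) flow of the vector field `X`. -/
structure IsGlobalFlow (X : ∀ p : N, TangentSpace J p) (φ : ℝ → N → N) : Prop where
  zero : ∀ p, φ 0 p = p
  integralCurve : ∀ p, IsMIntegralCurve (I := J) (fun t ↦ φ t p) X

end General

/-! ### Levi-Civita connection and Gauss curvature, in charts -/

section Riemannian

variable {n : ℕ} {M : Type*} [TopologicalSpace M] [ChartedSpace (EuclideanSpace ℝ (Fin n)) M]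
  [IsManifold (𝓡 n) ∞ M] [RiemannianBundle (fun x : M ↦ TangentSpace (𝓡 n) x)]

/-- The partial derivative `∂ᵢ f` at `y`. -/
def partialDeriv (i : Fin n) (f : EuclideanSpace ℝ (Fin n) → ℝ) (y : EuclideanSpace ℝ (Fin n)) :
    ℝ :=
  fderiv ℝ f y (EuclideanSpace.single i 1)

/-- The coordinate vector field `∂ᵢ` of the chart at `x₀`, at the point with coordinates `y`. -/
def coordVector (x₀ : M) (i : Fin n) (y : EuclideanSpace ℝ (Fin n)) :
    TangentSpace (𝓡 n) ((extChartAt (𝓡 n) x₀).symm y) :=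
  mfderiv 𝓘(ℝ, EuclideanSpace ℝ (Fin n)) (𝓡 n) (extChartAt (𝓡 n) x₀).symm y
    (EuclideanSpace.single i (1 : ℝ) : EuclideanSpace ℝ (Fin n))

/-- The matrix `g i j` of the Riemannian metric in the chart at `x₀`. -/
def metricMatrix (x₀ : M) (y : EuclideanSpace ℝ (Fin n)) : Matrix (Fin n) (Fin n) ℝ :=
  Matrix.of fun i j ↦ inner ℝ (coordVector x₀ i y) (coordVector x₀ j y)

/-- The Christoffel symbol `Γᵏᵢⱼ` of the Levi-Civita connection in the chart at `x₀`. -/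
def christoffel (x₀ : M) (k i j : Fin n) (y : EuclideanSpace ℝ (Fin n)) : ℝ :=
  (1 / 2) * ∑ l, (metricMatrix x₀ y)⁻¹ k l *
    (partialDeriv i (fun z ↦ metricMatrix x₀ z j l) y
      + partialDeriv j (fun z ↦ metricMatrix x₀ z i l) y
      - partialDeriv l (fun z ↦ metricMatrix x₀ z i j) y)

/-- The component `Rˡ` of `R(∂ᵢ, ∂ⱼ) ∂ₖ = ∇ᵢ ∇ⱼ ∂ₖ - ∇ⱼ ∇ᵢ ∂ₖ` in the chart at `x₀`. -/
def curvatureTensor (x₀ : M) (l i j k : Fin n) (y : EuclideanSpace ℝ (Fin n)) : ℝ :=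
  partialDeriv i (christoffel x₀ l j k) y - partialDeriv j (christoffel x₀ l i k) y
    + ∑ m, (christoffel x₀ l i m y * christoffel x₀ m j k y
      - christoffel x₀ l j m y * christoffel x₀ m i k y)

/-- The vector `Γ(w, v)` with components `Γᵏᵢⱼ wⁱ vʲ` at `x`, in the chart at `x`. -/
def christoffelVector (x : M) (w v : TangentSpace (𝓡 n) x) : EuclideanSpace ℝ (Fin n) :=
  let w' : EuclideanSpace ℝ (Fin n) := w
  let v' : EuclideanSpace ℝ (Fin n) := v
  WithLp.toLp 2 fun k ↦
    ∑ i, ∑ j, christoffel x k i j (extChartAt (𝓡 n) x x) * w' i * v' j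

/-- The horizontal lift of `w` to `T_{(x,v)} TM` defined by the Levi-Civita connection. In the chart
of `TM` induced by the chart at `x`, which Mathlib uses to identify `T_{(x,v)} TM` with a product
of two copies of the model space, it is `(w, -Γ(w, v))`. -/
def horizontalLift (p : TangentBundle (𝓡 n) M) (w : TangentSpace (𝓡 n) p.proj) :
    TangentSpace (𝓡 n).tangent p :=
  ((w, -christoffelVector p.proj w p.snd) : EuclideanSpace ℝ (Fin n) × EuclideanSpace ℝ (Fin n))

/-- The differential of the projection `π : TM → M`. -/
def dproj (p : TangentBundle (𝓡 n) M) :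
    TangentSpace (𝓡 n).tangent p →L[ℝ] TangentSpace (𝓡 n) p.proj :=
  mfderiv (𝓡 n).tangent (𝓡 n) (fun q : TangentBundle (𝓡 n) M ↦ q.proj) p

/-- The canonical one-form `α_{(x,v)}(ξ) = g_x(v, dπ ξ)` on `TM`. -/
def canonicalForm (p : TangentBundle (𝓡 n) M) : TangentSpace (𝓡 n).tangent p [⋀^Fin 1]→L[ℝ] ℝ :=
  ContinuousAlternatingMap.ofSubsingleton ℝ (TangentSpace (𝓡 n).tangent p) ℝ (0 : Fin 1)
    ((innerSL ℝ p.snd).comp (dproj p))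

/-- The fibre scaling `m_a (x, v) = (x, a v)`. -/
def fiberScale (a : ℝ) (p : TangentBundle (𝓡 n) M) : TangentBundle (𝓡 n) M :=
  ⟨p.proj, a • p.snd⟩

/-- The annulus bundle `{(x, v) : a < |v| < b}`; for `a = 0` it is the open disc bundle of
radius `b` without the zero section. -/
def annulusBundle (M : Type*) [TopologicalSpace M] [ChartedSpace (EuclideanSpace ℝ (Fin n)) M]
    [IsManifold (𝓡 n) ∞ M] [RiemannianBundle (fun x : M ↦ TangentSpace (𝓡 n) x)] (a b : ℝ) :
    Set (TangentBundle (𝓡 n) M) :=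
  {p | a < ‖p.snd‖ ∧ ‖p.snd‖ < b}

end Riemannian

/-! ### Oriented Riemannian surfaces -/

section Surface

variable {M : Type*} [TopologicalSpace M] [ChartedSpace (EuclideanSpace ℝ (Fin 2)) M]
  [IsManifold (𝓡 2) ∞ M] [RiemannianBundle (fun x : M ↦ TangentSpace (𝓡 2) x)]

instance finrank_tangentSpace (x : M) :
    Fact (Module.finrank ℝ (TangentSpace (𝓡 2) x) = 2) :=
  ⟨finrank_euclideanSpace_fin (𝕜 := ℝ) (n := 2)⟩

/-- The Gauss curvature `g(R(∂₀, ∂₁) ∂₁, ∂₀) / det g` at `x`, computed in the chart at `x`. -/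
def gaussCurvature (x : M) : ℝ :=
  (∑ l, metricMatrix x (extChartAt (𝓡 2) x x) 0 l *
      curvatureTensor x l 0 1 1 (extChartAt (𝓡 2) x x))
    / (metricMatrix x (extChartAt (𝓡 2) x x)).det

/-- A family of orientations of the tangent spaces is an orientation of the surface if it is locally
constant in the local trivializations of the tangent bundle. -/
def IsOrientationOfSurface (o : ∀ x : M, Orientation ℝ (TangentSpace (𝓡 2) x) (Fin 2)) : Prop :=
  ∀ x₀ : M, ∃ o₀ : Orientation ℝ (EuclideanSpace ℝ (Fin 2)) (Fin 2), ∀ᶠ x in 𝓝 x₀,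
    ∀ hx : x ∈ (trivializationAt (EuclideanSpace ℝ (Fin 2))
        (TangentSpace (𝓡 2) : M → Type) x₀).baseSet,
      Orientation.map (Fin 2)
        ((trivializationAt (EuclideanSpace ℝ (Fin 2))
          (TangentSpace (𝓡 2) : M → Type) x₀).continuousLinearEquivAt ℝ x hx).toLinearEquiv
        (o x) = o₀

variable (o : ∀ x : M, Orientation ℝ (TangentSpace (𝓡 2) x) (Fin 2))

/-- The twisted form `ω_s = dα - s π^*σ` on `TM`, where `σ` is the Riemannian area form. -/
def twistedForm (s : ℝ) (p : TangentBundle (𝓡 2) M) (ξ ζ : TangentSpace (𝓡 2).tangent p) : ℝ :=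
  mextDeriv (𝓡 2).tangent (canonicalForm (n := 2) (M := M)) p ![ξ, ζ]
    - s * (o p.proj).areaForm (dproj p ξ) (dproj p ζ)

/-- The horizontal vector field `H_{(x,v)} = L^H(ι v)`. The complex structure `ι`, given by
`σ(·, ·) = g(ι ·, ·)`, is `Orientation.rightAngleRotation`. -/
def horizontalField (p : TangentBundle (𝓡 2) M) : TangentSpace (𝓡 2).tangent p :=
  horizontalLift p ((o p.proj).rightAngleRotation p.snd)

end Surface

end TwistedBundle

end

/-!
Write `α` for the canonical one-form on the tangent bundle, `σ` for the area form, and `θ` for the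
connection form, defined away from the zero section, that measures the rotation of `v` relative to
parallel transport. Both `α` and `θ` annihilate the field `-H`, and

* `dα(-H, ·) = r² θ` with `r = |v|` (`mextDeriv_canonicalForm_negHorizontal`),
* `dθ = π^*σ`, because the curvature is `-1` (`mextDeriv_connectionForm`), hence `dθ(-H, ·) = α`
  (`mextDeriv_connectionForm_negHorizontal`).

Parallel transport preserves `r`, so by Cartan's formula (`IsGlobalFlow.hasDerivAt_pullback`) the
pullbacks of `α` and `θ` by the flow `φ_t` of `-H` solve a linear system with constant coefficients,
and `φ_t^*α = cosh(rt) α + r sinh(rt) θ` (`IsGlobalFlow.pullback_canonicalOneForm`). A time that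
depends on the point contributes only a multiple of `-H` to the derivative of the flow, which `α`
annihilates, and the scaling of the fibres by `a` multiplies `α` by `a`. The factor `a` and the time
`b` of the theorem are those for which `a cosh(rb) = 1` and `a r sinh(rb) = -s`. Therefore
`F^*α = α - s θ` (`IsGlobalFlow.pullback_untwist`), and taking exterior derivatives
(`mextDeriv_toOneForm_pullback`) gives `F^*ω₀ = dα - s π^*σ = ω_s`. The inverse of `F` is explicit,
since `F` maps vectors of length `r` to vectors of length `√(r² - s²)`.

The flow of `-H` exists for all times because it preserves the compact sets `{|v| ≤ R}`
(`exists_isGlobalFlow`). Its joint smoothness (`IsGlobalFlow.contMDiff`) comes from the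
implicit function theorem applied to the integral equation of the rescaled curves
(`contDiffAt_of_localFlow`). The Levi-Civita connection enters only through torsion freeness and
metric compatibility in charts (`IsLeviCivitaAt`, `isLeviCivitaAt_chart`); the transformation law of
the Christoffel symbols, the parallelism of the complex structure and the skew symmetry of the
curvature are derived from these two properties.
-/

open scoped Manifold ContDiff Topology
open Bundle

noncomputable section

set_option maxSynthPendingDepth 3

namespace TwistedBundle

/-! ### Smooth dependence of flows on time and initial value -/

section Nemytskii

universe u

variable {K : Type*} [TopologicalSpace K] [CompactSpace K]
  {E : Type u} [NormedAddCommGroup E] [NormedSpace ℝ E]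

/-- Pointwise application of a family of continuous linear maps to a family of vectors, both
parametrized continuously by a compact space. -/
def pointwiseApply (K : Type*) [TopologicalSpace K] [CompactSpace K]
    (E F : Type*) [NormedAddCommGroup E] [NormedSpace ℝ E] [NormedAddCommGroup F]
    [NormedSpace ℝ F] : C(K, E →L[ℝ] F) →L[ℝ] C(K, E) →L[ℝ] C(K, F) :=
  LinearMap.mkContinuous₂
    (LinearMap.mk₂ ℝ (fun (A : C(K, E →L[ℝ] F)) (h : C(K, E)) ↦
        (⟨fun k ↦ A k (h k), by fun_prop⟩ : C(K, F)))
      (fun _ _ _ ↦ by ext; simp) (fun _ _ _ ↦ by ext; simp)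
      (fun _ _ _ ↦ by ext; simp) (fun _ _ _ ↦ by ext; simp)) 1
    (fun A h ↦ by
      rw [one_mul, ContinuousMap.norm_le _ (by positivity)]
      refine fun k ↦ (ContinuousLinearMap.le_opNorm _ _).trans ?_
      gcongr
      exacts [A.norm_coe_le_norm k, h.norm_coe_le_norm k])

@[simp]
lemma pointwiseApply_apply {F : Type*} [NormedAddCommGroup F] [NormedSpace ℝ F]
    (A : C(K, E →L[ℝ] F)) (h : C(K, E)) (k : K) : pointwiseApply K E F A h k = A k (h k) := rfl

/-- The superposition operator `g ↦ f ∘ g` is differentiable when `f` is `C¹`. The remainder is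
controlled uniformly on the compact space because `g ↦ fderiv f ∘ g` is continuous at `g`, tested
on constant perturbations of `g`. -/
lemma hasFDerivAt_superposition {F : Type*} [NormedAddCommGroup F] [NormedSpace ℝ F]
    (f : C(E, F)) (f' : C(E, E →L[ℝ] F)) (hf : ∀ x, HasFDerivAt f (f' x) x) (g : C(K, E)) :
    HasFDerivAt (fun g : C(K, E) ↦ f.comp g) (pointwiseApply K E F (f'.comp g)) g := by
  rw [hasFDerivAt_iff_isLittleO_nhds_zero, Asymptotics.isLittleO_iff]
  intro c hc
  have hcont : Continuous fun g : C(K, E) ↦ f'.comp g := ContinuousMap.continuous_postcomp f'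
  obtain ⟨δ, hδ, H⟩ := (Metric.continuous_iff (α := C(K, E)) (β := C(K, E →L[ℝ] F))).1 hcont g c hc
  filter_upwards [Metric.ball_mem_nhds (0 : C(K, E)) hδ] with h hh
  rw [mem_ball_zero_iff] at hh
  rw [ContinuousMap.norm_le _ (by positivity)]
  intro k
  have hk : ‖h k‖ < δ := (h.norm_coe_le_norm k).trans_lt hh
  have key : ∀ w ∈ Metric.ball (0 : E) δ, ‖f' (g k + w) - f' (g k)‖ ≤ c := by
    intro w hw
    rw [mem_ball_zero_iff] at hw
    have h1 : dist (g + ContinuousMap.const K w) g < δ := by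
      rw [dist_eq_norm, add_sub_cancel_left]
      exact (ContinuousMap.norm_lt_iff _ hδ).2 fun _ ↦ hw
    rw [← dist_eq_norm]
    exact (ContinuousMap.dist_apply_le_dist (f := f'.comp (g + ContinuousMap.const K w))
      (g := f'.comp g) k).trans (H _ h1).le
  have := (convex_ball (0 : E) δ).norm_image_sub_le_of_norm_hasFDerivWithin_le'
    (f := fun w ↦ f (g k + w)) (f' := fun w ↦ f' (g k + w)) (φ := f' (g k)) (C := c)
    (fun w _ ↦ ((hf (g k + w)).comp w ((hasFDerivAt_id w).const_add (g k))).hasFDerivWithinAt)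
    key (Metric.mem_ball_self hδ) (mem_ball_zero_iff.2 hk)
  simp only [add_zero, sub_zero] at this
  refine (le_trans ?_ this).trans (by gcongr; exact h.norm_coe_le_norm k)
  simp

/-- The superposition operator `g ↦ f ∘ g` on continuous functions on a compact space is `Cⁿ` when
`f` is. -/
lemma contDiff_superposition (n : ℕ) : ∀ {F : Type u} [NormedAddCommGroup F] [NormedSpace ℝ F]
    (f : C(E, F)), ContDiff ℝ n f → ContDiff ℝ n fun g : C(K, E) ↦ f.comp g := by
  induction n with
  | zero =>
    intro F _ _ f _
    rw [Nat.cast_zero, contDiff_zero]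
    exact ContinuousMap.continuous_postcomp f
  | succ n ih =>
    intro F _ _ f hf
    rw [Nat.cast_succ, contDiff_succ_iff_hasFDerivAt] at hf ⊢
    obtain ⟨f', hf', h⟩ := hf
    let f'c : C(E, E →L[ℝ] F) := ⟨f', hf'.continuous⟩
    have hT : ContDiff ℝ n (pointwiseApply K E F) := by apply ContinuousLinearMap.contDiff
    have hg : ContDiff ℝ n fun g : C(K, E) ↦ f'c.comp g := ih f'c hf'
    exact ⟨fun g ↦ pointwiseApply K E F (f'c.comp g), hT.comp hg,
      fun g ↦ hasFDerivAt_superposition f f'c h g⟩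

end Nemytskii

section LocalFlow

open unitInterval

variable {E : Type*} [NormedAddCommGroup E] [NormedSpace ℝ E]

/-- The operator `g ↦ (s ↦ ∫ τ in 0..s, g τ)` on continuous curves `[0, 1] → E`. -/
def integralOperator (E : Type*) [NormedAddCommGroup E] [NormedSpace ℝ E] :
    C(I, E) →L[ℝ] C(I, E) :=
  LinearMap.mkContinuous
    { toFun g := ⟨fun s ↦ ∫ τ in (0 : ℝ)..s, g (Set.projIcc 0 1 zero_le_one τ),
        (intervalIntegral.continuous_primitive
          (fun a b ↦ (g.continuous.comp continuous_projIcc).intervalIntegrable a b) 0).comp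
          continuous_subtype_val⟩
      map_add' g h := by
        ext s
        exact intervalIntegral.integral_add
          ((g.continuous.comp continuous_projIcc).intervalIntegrable _ _)
          ((h.continuous.comp continuous_projIcc).intervalIntegrable _ _)
      map_smul' c g := by
        ext s
        exact intervalIntegral.integral_smul c _ } 1
    (fun g ↦ by
      rw [ContinuousMap.norm_le _ (by positivity), one_mul]
      intro s
      refine (intervalIntegral.norm_integral_le_of_norm_le_const
        (C := ‖g‖) fun τ _ ↦ g.norm_coe_le_norm _).trans ?_
      rw [sub_zero, abs_of_nonneg s.2.1]
      exact mul_le_of_le_one_right (norm_nonneg _) s.2.2)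

lemma integralOperator_apply (g : C(I, E)) (s : I) :
    integralOperator E g s = ∫ τ in (0 : ℝ)..s, g (Set.projIcc 0 1 zero_le_one τ) := rfl

/-- The constant curves, as a continuous linear map. -/
def constCurve (E : Type*) [NormedAddCommGroup E] [NormedSpace ℝ E] : E →L[ℝ] C(I, E) :=
  LinearMap.mkContinuous
    { toFun x := ContinuousMap.const I x
      map_add' _ _ := by ext; rfl
      map_smul' _ _ := by ext; rfl } 1
    (fun x ↦ by
      rw [ContinuousMap.norm_le _ (by positivity), one_mul]
      exact fun _ ↦ le_rfl)

/-- A local flow of a `Cⁿ` vector field is `Cⁿ` jointly in time and initial value. The rescaled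
curve `s ↦ α (s * t, x)` solves `γ - x - t * ∫ f ∘ γ = 0` in `C([0, 1], E)`, and this equation has
invertible derivative in `γ` at `t = 0`, so that the implicit function theorem applies. -/
theorem contDiffAt_of_localFlow [CompleteSpace E] {f : E → E} {n : ℕ} (hn : n ≠ 0)
    (hf : ContDiff ℝ n f) {x₀ : E} {α : ℝ × E → E} (hα : ContinuousAt α (0, x₀))
    (h0 : ∀ᶠ z in 𝓝 ((0 : ℝ), x₀), α (0, z.2) = z.2)
    (hd : ∀ᶠ z in 𝓝 ((0 : ℝ), x₀), HasDerivAt (fun t ↦ α (t, z.2)) (f (α z)) z.1) :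
    ContDiffAt ℝ n α (0, x₀) := by
  have hα0 : α (0, x₀) = x₀ := h0.self_of_nhds
  let fc : C(E, E) := ⟨f, hf.continuous⟩
  let Φ : (ℝ × E) × C(I, E) → C(I, E) := fun p ↦
    p.2 - constCurve E p.1.2 - p.1.1 • integralOperator E (fc.comp p.2)
  let u : (ℝ × E) × C(I, E) := ((0, x₀), constCurve E x₀)
  have hΦ : ContDiff ℝ n Φ := by
    have h1 : ContDiff ℝ n fun p : (ℝ × E) × C(I, E) ↦ fc.comp p.2 :=
      (contDiff_superposition n fc hf).comp contDiff_snd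
    have h2 : ContDiff ℝ n fun p : (ℝ × E) × C(I, E) ↦ integralOperator E (fc.comp p.2) :=
      (integralOperator E).contDiff.comp h1
    have h3 : ContDiff ℝ n fun p : (ℝ × E) × C(I, E) ↦ constCurve E p.1.2 :=
      (constCurve E).contDiff.comp (contDiff_snd.comp contDiff_fst)
    exact (contDiff_snd.sub h3).sub ((contDiff_fst.comp contDiff_fst).smul h2)
  have hn' : (n : WithTop ℕ∞) ≠ 0 := by exact_mod_cast hn
  have hu : Φ u = 0 := by simp [Φ, u]
  have hder : fderiv ℝ Φ u ∘L .inr ℝ (ℝ × E) C(I, E) = ContinuousLinearMap.id ℝ _ := by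
    have h1 : HasFDerivAt (fun γ ↦ Φ ((0, x₀), γ)) (fderiv ℝ Φ u ∘L .inr ℝ (ℝ × E) C(I, E))
        (constCurve E x₀) :=
      ((hΦ.differentiable hn').differentiableAt.hasFDerivAt).comp _
        (hasFDerivAt_prodMk_right (0, x₀) (constCurve E x₀))
    have h2 : HasFDerivAt (fun γ ↦ Φ ((0, x₀), γ)) (ContinuousLinearMap.id ℝ _)
        (constCurve E x₀) := by
      have : (fun γ ↦ Φ ((0, x₀), γ)) = fun γ ↦ γ - constCurve E x₀ := by
        ext; simp [Φ]
      rw [this]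
      exact (hasFDerivAt_id _).sub_const _
    exact h1.unique h2
  have hinv : (fderiv ℝ Φ u ∘L .inr ℝ (ℝ × E) C(I, E)).IsInvertible := by
    rw [hder]; exact ⟨.refl ℝ _, rfl⟩
  have hΦu : ContDiffAt ℝ n Φ u := hΦ.contDiffAt
  let ψ := hΦu.implicitFunction hn' hinv
  have hψ : ContDiffAt ℝ n ψ (0, x₀) := hΦu.contDiffAt_implicitFunction hn' hinv
  have hev := hΦu.eventually_apply_eq_iff_implicitFunction hn' hinv
  rw [hu] at hev
  -- it remains to see that the rescaled curves are close to the constant curve and solve `Φ = 0`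
  obtain ⟨ρ, hρ, hev⟩ := Metric.eventually_nhds_iff.1 hev
  have hball : ∀ᶠ z in 𝓝 ((0 : ℝ), x₀), dist (α z) x₀ < ρ := by
    have := hα.eventually (Metric.ball_mem_nhds (α (0, x₀)) hρ)
    rwa [hα0] at this
  obtain ⟨δ, hδ, H⟩ := Metric.eventually_nhds_iff.1 ((h0.and hd).and hball)
  have hclose : α =ᶠ[𝓝 (0, x₀)] fun z ↦ ψ z 1 := by
    rw [Filter.EventuallyEq, Metric.eventually_nhds_iff]
    refine ⟨min δ ρ, lt_min hδ hρ, ?_⟩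
    rintro ⟨t, x⟩ hz
    have hzδ := hz.trans_le (min_le_left _ _)
    have hbox : ∀ s ∈ Set.Icc (0 : ℝ) 1, dist ((s * t, x) : ℝ × E) (0, x₀) < δ := by
      intro s hs
      refine lt_of_le_of_lt ?_ hzδ
      simp only [Prod.dist_eq, dist_zero_right, norm_mul]
      refine max_le_max ?_ le_rfl
      rw [Real.norm_of_nonneg hs.1]
      exact mul_le_of_le_one_left (norm_nonneg _) hs.2
    have hderiv : ∀ s ∈ Set.Icc (0 : ℝ) 1,
        HasDerivAt (fun s ↦ α (s * t, x)) (t • f (α (s * t, x))) s := fun s hs ↦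
      HasDerivAt.scomp (h := fun s ↦ s * t) s (H (hbox s hs)).1.2
        (by simpa using (hasDerivAt_id s).mul_const t)
    have hcont : ContinuousOn (fun s ↦ α (s * t, x)) (Set.Icc 0 1) := fun s hs ↦
      (hderiv s hs).continuousAt.continuousWithinAt
    let c : C(I, E) := ⟨fun s ↦ α (s * t, x), hcont.comp_continuous continuous_subtype_val
      fun s ↦ s.2⟩
    have hc : dist c (constCurve E x₀) < ρ :=
      (ContinuousMap.dist_lt_iff hρ).2 fun s ↦ (H (hbox s s.2)).2
    have hsol : Φ ((t, x), c) = 0 := by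
      ext s
      have hint : ∫ τ in (0 : ℝ)..s, t • f (α (τ * t, x)) = α (s * t, x) - α (0 * t, x) := by
        have hsub : Set.uIcc (0 : ℝ) s ⊆ Set.Icc 0 1 := by
          rw [Set.uIcc_of_le s.2.1]; exact Set.Icc_subset_Icc le_rfl s.2.2
        refine intervalIntegral.integral_eq_sub_of_hasDerivAt
          (f := fun s ↦ α (s * t, x)) (fun τ hτ ↦ hderiv τ (hsub hτ)) ?_
        exact ((hf.continuous.comp_continuousOn (hcont.mono hsub)).const_smul t).intervalIntegrable
      have h00 : α (0 * t, x) = x := by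
        rw [zero_mul]; exact (H hzδ).1.1
      rw [intervalIntegral.integral_smul, h00] at hint
      have heq : integralOperator E (fc.comp c) s = ∫ τ in (0 : ℝ)..s, f (α (τ * t, x)) := by
        rw [integralOperator_apply]
        refine intervalIntegral.integral_congr fun τ hτ ↦ ?_
        rw [Set.uIcc_of_le s.2.1] at hτ
        have : Set.projIcc (0 : ℝ) 1 zero_le_one τ = ⟨τ, hτ.1, hτ.2.trans s.2.2⟩ :=
          Set.projIcc_of_mem _ _
        simp only [this]
        rfl
      change c s - x - t • integralOperator E (fc.comp c) s = 0
      rw [heq, hint]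
      exact sub_self _
    have hdist : dist (((t, x), c) : (ℝ × E) × C(I, E)) u < ρ :=
      max_lt (hz.trans_le (min_le_right _ _)) hc
    have := (hev hdist).1 hsol
    change α (t, x) = ψ (t, x) 1
    have h2 : ψ (t, x) = c := this
    rw [h2]
    change _ = α (1 * t, x)
    rw [one_mul]
  refine ContDiffAt.congr_of_eventuallyEq ?_ hclose
  exact (ContinuousMap.evalCLM ℝ (1 : I)).contDiff.contDiffAt.comp _ hψ

end LocalFlow

/-! ### Flows of smooth vector fields on manifolds -/

section ManifoldFlow

variable {E : Type*} [NormedAddCommGroup E] [NormedSpace ℝ E]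
  {H : Type*} [TopologicalSpace H] {J : ModelWithCorners ℝ E H}
  {N : Type*} [TopologicalSpace N] [ChartedSpace H N]

section Charts

variable [IsManifold J 1 N]

lemma mfderiv_extChartAt_eq {p q : N} (h : p ∈ (extChartAt J q).source) :
    mfderiv J 𝓘(ℝ, E) (extChartAt J q) p = tangentCoordChange J p q p := by
  rw [extChartAt_source] at h
  rw [← TangentBundle.continuousLinearMapAt_trivializationAt h]
  exact TangentBundle.continuousLinearMapAt_trivializationAt_eq_core h

/-- The vector field `X` read in the chart at `q`. -/
def chartField (X : ∀ p : N, TangentSpace J p) (q : N) (y : E) : E :=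
  tangentCoordChange J ((extChartAt J q).symm y) q ((extChartAt J q).symm y)
    (X ((extChartAt J q).symm y))

lemma chartField_eq_mfderiv (X : ∀ p : N, TangentSpace J p) {q p : N}
    (h : p ∈ (extChartAt J q).source) :
    chartField X q (extChartAt J q p) = mfderiv J 𝓘(ℝ, E) (extChartAt J q) p (X p) := by
  rw [mfderiv_extChartAt_eq h, chartField, (extChartAt J q).left_inv h]
  rfl

variable [J.Boundaryless]

lemma mfderiv_extChartAt_symm_eq {q : N} {y : E} (h : y ∈ (extChartAt J q).target) :
    mfderiv 𝓘(ℝ, E) J (extChartAt J q).symm y =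
      tangentCoordChange J q ((extChartAt J q).symm y) ((extChartAt J q).symm y) := by
  have hs : (extChartAt J q).symm y ∈ (chartAt H q).source := by
    rw [← extChartAt_source J]; exact (extChartAt J q).map_target h
  have h1 := TangentBundle.symmL_trivializationAt (I := J) hs
  rw [(extChartAt J q).right_inv h, J.range_eq_univ, mfderivWithin_univ] at h1
  rw [← h1]
  exact TangentBundle.symmL_trivializationAt_eq_core hs

lemma hasFDerivAt_tangentCoordChange {x y z : N}
    (h : z ∈ (extChartAt J x).source ∩ (extChartAt J y).source) :
    HasFDerivAt (extChartAt J y ∘ (extChartAt J x).symm) (tangentCoordChange J x y z)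
      (extChartAt J x z) := by
  have := hasFDerivWithinAt_tangentCoordChange h
  rwa [J.range_eq_univ, hasFDerivWithinAt_univ] at this

lemma mdifferentiableAt_extChartAt_symm {q : N} {y : E} (h : y ∈ (extChartAt J q).target) :
    MDifferentiableAt 𝓘(ℝ, E) J (extChartAt J q).symm y := by
  have := mdifferentiableWithinAt_extChartAt_symm h
  rwa [J.range_eq_univ, mdifferentiableWithinAt_univ] at this

lemma mfderiv_extChartAt_symm_chartField (X : ∀ p : N, TangentSpace J p) {q : N} {y : E}
    (h : y ∈ (extChartAt J q).target) :
    mfderiv 𝓘(ℝ, E) J (extChartAt J q).symm y (chartField (E := E) X q y) =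
      X ((extChartAt J q).symm y) := by
  have h1 : (extChartAt J q).symm y ∈ (extChartAt J q).source := (extChartAt J q).map_target h
  have h2 := mem_extChartAt_source (I := J) ((extChartAt J q).symm y)
  rw [mfderiv_extChartAt_symm_eq h]
  refine (tangentCoordChange_comp ⟨⟨h2, h1⟩, h2⟩).trans ?_
  exact tangentCoordChange_self h2

lemma contDiffAt_chartField {n : WithTop ℕ∞} {X : ∀ p : N, TangentSpace J p} {q : N}
    (hX : ContMDiffAt J J.tangent n (fun p ↦ (⟨p, X p⟩ : TangentBundle J N)) q) :
    ContDiffAt ℝ n (chartField X q) (extChartAt J q q) := by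
  rw [contMDiffAt_iff] at hX
  have := (hX.2.contDiffAt (by rw [J.range_eq_univ]; exact Filter.univ_mem)).snd
  exact this

/-- A solution of the equation in a chart gives an integral curve on the manifold. -/
lemma hasMFDerivAt_chart_symm_comp (X : ∀ p : N, TangentSpace J p) {q : N} {f : ℝ → E} {t : ℝ}
    (ht : f t ∈ (extChartAt J q).target) (h : HasDerivAt f (chartField X q (f t)) t) :
    HasMFDerivAt 𝓘(ℝ, ℝ) J (fun t ↦ (extChartAt J q).symm (f t)) t
      ((1 : ℝ →L[ℝ] ℝ).smulRight (X ((extChartAt J q).symm (f t)))) := by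
  have h1 : HasMFDerivAt 𝓘(ℝ, ℝ) 𝓘(ℝ, E) f t
      ((1 : ℝ →L[ℝ] ℝ).smulRight (chartField (E := E) X q (f t))) :=
    HasFDerivAt.hasMFDerivAt (by
      have := h.hasFDerivAt
      convert! this using 1)
  have h2 := HasMFDerivAt.comp t (mdifferentiableAt_extChartAt_symm ht).hasMFDerivAt h1
  refine h2.congr_mfderiv ?_
  refine ContinuousLinearMap.ext fun a ↦ ?_
  refine ((mfderiv 𝓘(ℝ, E) J (extChartAt J q).symm (f t)).map_smul a
    (chartField (E := E) X q (f t))).trans ?_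
  rw [mfderiv_extChartAt_symm_chartField X ht]
  rfl

end Charts

/-- A vector field that is `Cⁿ` near a point agrees near this point with a globally `Cⁿ` one. -/
lemma exists_contDiff_eventuallyEq [FiniteDimensional ℝ E] {n : ℕ} {f : E → E} {x₀ : E}
    (hf : ContDiffAt ℝ n f x₀) : ∃ g : E → E, ContDiff ℝ n g ∧ g =ᶠ[𝓝 x₀] f := by
  obtain ⟨u, hu, hfu⟩ := hf.contDiffOn (m := n) le_rfl (by simp)
  obtain ⟨r, hr, hru⟩ := Metric.mem_nhds_iff.1 hu
  let χ : ContDiffBump x₀ := ⟨r / 4, r / 2, by positivity, by linarith⟩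
  refine ⟨fun x ↦ χ x • f x, ?_, ?_⟩
  · refine contDiff_iff_contDiffAt.2 fun x ↦ ?_
    by_cases hx : x ∈ tsupport fun x ↦ χ x • f x
    swap
    · exact contDiffAt_const.congr_of_eventuallyEq (notMem_tsupport_iff_eventuallyEq.1 hx)
    have hx' : x ∈ Metric.ball x₀ r := by
      have h1 : x ∈ tsupport χ := closure_mono (Function.support_smul_subset_left _ _) hx
      rw [χ.tsupport_eq] at h1
      exact Metric.closedBall_subset_ball (by change r / 2 < r; linarith) h1
    exact χ.contDiff.contDiffAt.smul
      (hfu.contDiffAt (Filter.mem_of_superset (Metric.isOpen_ball.mem_nhds hx') hru))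
  · filter_upwards [χ.eventuallyEq_one] with x hx
    simp [hx]

lemma IsGlobalFlow.continuous_curve {X : ∀ p : N, TangentSpace J p} {φ : ℝ → N → N}
    (hφ : IsGlobalFlow J X φ) (p : N) :
    Continuous fun t ↦ φ t p := (hφ.integralCurve p).continuous

/-- A function whose derivative vanishes along `X` is constant on the integral curves of `X`. -/
lemma IsMIntegralCurve.const_of_mfderiv_eq_zero {X : ∀ p : N, TangentSpace J p}
    {γ : ℝ → N} {e : N → ℝ}
    (hγ : IsMIntegralCurve γ X) (he : MDifferentiable J 𝓘(ℝ, ℝ) e)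
    (heX : ∀ p, mfderiv J 𝓘(ℝ, ℝ) e p (X p) = 0) (t : ℝ) : e (γ t) = e (γ 0) := by
  have h : ∀ t, HasDerivAt (fun t ↦ e (γ t)) 0 t := by
    intro t
    have h1 : HasMFDerivAt 𝓘(ℝ, ℝ) 𝓘(ℝ, ℝ) (fun t ↦ e (γ t)) t (0 : ℝ →L[ℝ] ℝ) :=
      ((he (γ t)).hasMFDerivAt.comp t (hγ t)).congr_mfderiv (ContinuousLinearMap.ext fun a ↦
        ((mfderiv J 𝓘(ℝ, ℝ) e (γ t)).map_smul (a : ℝ) (X (γ t))).trans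
          ((congrArg (fun r : ℝ ↦ HSMul.hSMul (α := ℝ) a r) (heX (γ t))).trans
            (smul_zero (M := ℝ) (A := ℝ) a)))
    have h2 : HasFDerivAt (fun t ↦ e (γ t)) (0 : ℝ →L[ℝ] ℝ) t := h1.hasFDerivAt
    simpa using h2.hasDerivAt
  exact is_const_of_deriv_eq_zero (fun t ↦ (h t).differentiableAt) (fun t ↦ (h t).deriv) t 0

variable [J.Boundaryless] [IsManifold J ∞ N]

lemma IsGlobalFlow.add [T2Space N] {X : ∀ p : N, TangentSpace J p} {φ : ℝ → N → N}
    (hX : ContMDiff J J.tangent ∞ (fun p ↦ (⟨p, X p⟩ : TangentBundle J N)))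
    (hφ : IsGlobalFlow J X φ) (t s : ℝ) (p : N) : φ (t + s) p = φ t (φ s p) := by
  have h1 : IsMIntegralCurve (fun t ↦ φ (t + s) p) X := (hφ.integralCurve p).comp_add s
  refine congrFun (isMIntegralCurve_Ioo_eq_of_contMDiff_boundaryless (I := J) (t₀ := 0)
    (hX.of_le (by exact_mod_cast le_top)) h1 (hφ.integralCurve (φ s p)) ?_) t
  simp [hφ.zero]

variable [FiniteDimensional ℝ E]

/-- In the chart at `q`, a smooth vector field has a `Cⁿ` local flow near `q`. -/
lemma exists_chart_localFlow {X : ∀ p : N, TangentSpace J p}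
    (hX : ContMDiff J J.tangent ∞ (fun p ↦ (⟨p, X p⟩ : TangentBundle J N))) (q : N) {n : ℕ}
    (hn : n ≠ 0) :
    ∃ α : ℝ × E → E, ContDiffAt ℝ n α (0, extChartAt J q q) ∧
      ∀ᶠ z in 𝓝 ((0 : ℝ), extChartAt J q q), α z ∈ (extChartAt J q).target ∧ α (0, z.2) = z.2 ∧
        HasDerivAt (fun t ↦ α (t, z.2)) (chartField X q (α z)) z.1 := by
  have : CompleteSpace E := FiniteDimensional.complete ℝ E
  set c := extChartAt J q with hc
  set x₀ := c q with hx₀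
  obtain ⟨g, hg, hgX⟩ := exists_contDiff_eventuallyEq (n := n)
    ((contDiffAt_chartField (hX.contMDiffAt (x := q))).of_le (by exact_mod_cast le_top))
  obtain ⟨ε, hε, a, r, L, K, hr, hpl⟩ := IsPicardLindelof.of_contDiffAt_one
    ((hg.contDiffAt (x := x₀)).of_le (by exact_mod_cast Nat.one_le_iff_ne_zero.2 hn))
  obtain ⟨α', hα', hcont⟩ := (hpl 0).exists_forall_mem_closedBall_eq_hasDerivWithinAt_continuousOn
  simp only [zero_sub, zero_add] at hα' hcont
  let α : ℝ × E → E := fun z ↦ α' (z.2, z.1)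
  have hbox : ∀ᶠ z in 𝓝 ((0 : ℝ), x₀), z.1 ∈ Set.Ioo (-ε) ε ∧ z.2 ∈ Metric.closedBall x₀ r :=
    (continuous_fst.continuousAt.eventually (Ioo_mem_nhds (neg_lt_zero.2 hε) hε)).and
      (continuous_snd.continuousAt.eventually (Metric.closedBall_mem_nhds x₀ hr))
  have hα0 : α (0, x₀) = x₀ := (hα' x₀ (Metric.mem_closedBall_self r.2)).1
  have hαc : ContinuousAt α (0, x₀) := by
    have h1 : ContinuousAt α' (x₀, 0) := hcont.continuousAt
      (prod_mem_nhds (Metric.closedBall_mem_nhds x₀ hr) (Icc_mem_nhds (neg_lt_zero.2 hε) hε))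
    exact ContinuousAt.comp (f := fun z : ℝ × E ↦ (z.2, z.1)) h1 (by fun_prop)
  have hd : ∀ᶠ z in 𝓝 ((0 : ℝ), x₀), HasDerivAt (fun t ↦ α (t, z.2)) (g (α z)) z.1 := by
    filter_upwards [hbox] with z hz
    exact ((hα' z.2 hz.2).2 z.1 (Set.Ioo_subset_Icc_self hz.1)).hasDerivAt
      (Icc_mem_nhds hz.1.1 hz.1.2)
  have h0 : ∀ᶠ z in 𝓝 ((0 : ℝ), x₀), α (0, z.2) = z.2 := by
    filter_upwards [hbox] with z hz using (hα' z.2 hz.2).1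
  have hsm : ContDiffAt ℝ n α (0, x₀) := contDiffAt_of_localFlow hn hg hαc h0 hd
  have htar : ∀ᶠ y in 𝓝 x₀, y ∈ c.target ∧ g y = chartField X q y :=
    Filter.Eventually.and
      ((isOpen_extChartAt_target q).mem_nhds (mem_extChartAt_target (I := J) q)) hgX
  refine ⟨α, hsm, ?_⟩
  filter_upwards [hαc.eventually (by rwa [hα0]), h0, hd] with z h1 h2 h3
  exact ⟨h1.1, h2, h1.2 ▸ h3⟩

/-- If a smooth vector field is read in the chart at `q`, then its local flow gives integral curves
on the manifold, defined on a common time interval for all initial points near `q`. -/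
lemma exists_chart_localFlow_integralCurve {X : ∀ p : N, TangentSpace J p}
    (hX : ContMDiff J J.tangent ∞ (fun p ↦ (⟨p, X p⟩ : TangentBundle J N))) (q : N) {n : ℕ}
    (hn : n ≠ 0) :
    ∃ α : ℝ × E → E, ContDiffAt ℝ n α (0, extChartAt J q q) ∧
      α (0, extChartAt J q q) = extChartAt J q q ∧ ∃ δ > (0 : ℝ), ∀ᶠ p in 𝓝 q,
        (extChartAt J q).symm (α (0, extChartAt J q p)) = p ∧
        IsMIntegralCurveOn (fun s ↦ (extChartAt J q).symm (α (s, extChartAt J q p))) X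
          (Set.Ioo (-δ) δ) := by
  obtain ⟨α, hα, hgood⟩ := exists_chart_localFlow hX q hn
  obtain ⟨δ, hδ, Hδ⟩ := Metric.eventually_nhds_iff.1 hgood
  refine ⟨α, hα, (hgood.self_of_nhds).2.1, δ, hδ, ?_⟩
  filter_upwards [(continuousAt_extChartAt (I := J) q).eventually (Metric.ball_mem_nhds _ hδ),
    extChartAt_source_mem_nhds (I := J) q] with p hp hsrc
  have hin : ∀ s ∈ Set.Ioo (-δ) δ,
      dist (s, extChartAt J q p) ((0 : ℝ), extChartAt J q q) < δ := fun s hs ↦ by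
    simpa [Prod.dist_eq, max_lt_iff, abs_lt] using! ⟨hs, hp⟩
  constructor
  · rw [(Hδ (hin 0 ⟨neg_lt_zero.2 hδ, hδ⟩)).2.1, (extChartAt J q).left_inv hsrc]
  · intro s hs
    have h3 := Hδ (hin s hs)
    exact (hasMFDerivAt_chart_symm_comp X (f := fun s ↦ α (s, extChartAt J q p)) h3.1
      h3.2.2).hasMFDerivWithinAt

section Smoothness

variable [T2Space N] {X : ∀ p : N, TangentSpace J p} {φ : ℝ → N → N}

/-- The flow of a smooth vector field is smooth at time zero: it is given by the local flow in a
chart. -/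
theorem IsGlobalFlow.contMDiffAt_zero
    (hX : ContMDiff J J.tangent ∞ (fun p ↦ (⟨p, X p⟩ : TangentBundle J N)))
    (hφ : IsGlobalFlow J X φ) (q : N) {n : ℕ} (hn : n ≠ 0) :
    ContMDiffAt (𝓘(ℝ, ℝ).prod J) J n (fun z : ℝ × N ↦ φ z.1 z.2) (0, q) := by
  obtain ⟨α, hsm, hα0, δ, hδ, hev⟩ := exists_chart_localFlow_integralCurve hX q hn
  have hX1 := hX.of_le (m := 1) (by exact_mod_cast le_top)
  set c := extChartAt J q with hc
  set x₀ := c q with hx₀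
  have hloc : (fun z : ℝ × N ↦ φ z.1 z.2) =ᶠ[𝓝 (0, q)] fun z ↦ c.symm (α (z.1, c z.2)) := by
    filter_upwards [continuousAt_fst.eventually (Ioo_mem_nhds (neg_lt_zero.2 hδ) hδ),
      continuousAt_snd.eventually hev] with ⟨t, p⟩ ht hp
    refine isMIntegralCurveOn_Ioo_eqOn_of_contMDiff_boundaryless (I := J)
      ⟨neg_lt_zero.2 hδ, hδ⟩ hX1 ((hφ.integralCurve p).isMIntegralCurveOn _) hp.2 ?_ ht
    rw [hφ.zero, hp.1]
  refine ContMDiffAt.congr_of_eventuallyEq ?_ hloc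
  have hin : ContMDiffAt (𝓘(ℝ, ℝ).prod J) 𝓘(ℝ, ℝ × E) n (fun z : ℝ × N ↦ (z.1, c z.2)) (0, q) :=
    contMDiffAt_fst.prodMk_space
      (ContMDiffAt.comp (I' := J) (0, q) contMDiffAt_extChartAt contMDiffAt_snd)
  have hmid : ContMDiffAt (𝓘(ℝ, ℝ).prod J) 𝓘(ℝ, E) n (fun z : ℝ × N ↦ α (z.1, c z.2)) (0, q) :=
    ContMDiffAt.comp (I' := 𝓘(ℝ, ℝ × E)) (g := α) (0, q) hsm.contMDiffAt hin
  refine ContMDiffAt.comp (I' := 𝓘(ℝ, E)) (0, q) ?_ hmid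
  change ContMDiffAt 𝓘(ℝ, E) J n c.symm (α (0, x₀))
  rw [hα0]
  exact (contMDiffOn_extChartAt_symm q).contMDiffAt
    ((isOpen_extChartAt_target q).mem_nhds (mem_extChartAt_target q))

/-- The flow of a smooth vector field is smooth. For each `p` the set of times at which the flow is
smooth along the orbit of `p` is open, and it is closed by the group property of the flow and its
smoothness at time zero. -/
theorem IsGlobalFlow.contMDiff
    (hX : ContMDiff J J.tangent ∞ (fun p ↦ (⟨p, X p⟩ : TangentBundle J N)))
    (hφ : IsGlobalFlow J X φ) :
    ContMDiff (𝓘(ℝ, ℝ).prod J) J ∞ (fun z : ℝ × N ↦ φ z.1 z.2) := by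
  rw [contMDiff_infty]
  intro m
  suffices h : ∀ n : ℕ, n ≠ 0 →
      ContMDiff (𝓘(ℝ, ℝ).prod J) J n (fun z : ℝ × N ↦ φ z.1 z.2) from
    (h (m + 1) m.succ_ne_zero).of_le (by exact_mod_cast m.le_succ)
  rintro n hn ⟨t, p⟩
  have : IsManifold J n N := .of_le (n := ∞) (by exact_mod_cast le_top)
  have hne : (n : WithTop ℕ∞) ≠ ∞ := by exact_mod_cast ENat.natCast_ne_top n
  let A : Set ℝ :=
    {t | ContMDiffAt (𝓘(ℝ, ℝ).prod J) J n (fun z : ℝ × N ↦ φ z.1 z.2) (t, p)}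
  suffices h : A = Set.univ from Set.eq_univ_iff_forall.1 h t
  have hopen : ∀ z : ℝ × N, ContMDiffAt (𝓘(ℝ, ℝ).prod J) J n (fun z : ℝ × N ↦ φ z.1 z.2) z →
      ∀ᶠ z' in 𝓝 z, ContMDiffAt (𝓘(ℝ, ℝ).prod J) J n (fun z : ℝ × N ↦ φ z.1 z.2) z' :=
    fun z hz ↦ (contMDiffAt_iff_contMDiffAt_nhds hne).1 hz
  refine IsClopen.eq_univ ⟨?_, ?_⟩ ⟨0, hφ.contMDiffAt_zero hX p hn⟩
  · refine isClosed_iff_frequently.2 fun t₁ hfreq ↦ ?_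
    have hlim : Filter.Tendsto (fun s ↦ (t₁ - s, φ s p)) (𝓝 t₁) (𝓝 (0, φ t₁ p)) := by
      have : ContinuousAt (fun s ↦ (t₁ - s, φ s p)) t₁ :=
        ((continuous_const.sub continuous_id).prodMk (hφ.continuous_curve p)).continuousAt
      simpa [ContinuousAt] using this
    obtain ⟨s, hsA, hs⟩ := (hfreq.and_eventually
      (hlim.eventually (hopen _ (hφ.contMDiffAt_zero hX (φ t₁ p) hn)))).exists
    have heq : (fun z : ℝ × N ↦ φ z.1 z.2) = fun z ↦ φ (z.1 - s) (φ s z.2) := by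
      ext z
      rw [← hφ.add hX, sub_add_cancel]
    change ContMDiffAt _ _ _ _ _
    rw [heq]
    have h1 : ContMDiffAt (𝓘(ℝ, ℝ).prod J) (𝓘(ℝ, ℝ).prod J) n
        (fun z : ℝ × N ↦ (z.1 - s, φ s z.2)) (t₁, p) := by
      refine ContMDiffAt.prodMk ?_ ?_
      · exact (contDiff_id.sub contDiff_const).contMDiff.contMDiffAt.comp (t₁, p) contMDiffAt_fst
      · exact ContMDiffAt.comp (I' := 𝓘(ℝ, ℝ).prod J) (g := fun z : ℝ × N ↦ φ z.1 z.2)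
          (f := fun z : ℝ × N ↦ (s, z.2)) (t₁, p) hsA
          (contMDiffAt_const.prodMk contMDiffAt_snd)
    exact ContMDiffAt.comp (I' := 𝓘(ℝ, ℝ).prod J) (g := fun z : ℝ × N ↦ φ z.1 z.2) (t₁, p) hs h1
  · refine isOpen_iff_mem_nhds.2 fun t₁ ht₁ ↦ ?_
    exact (by fun_prop : ContinuousAt (fun t : ℝ ↦ (t, p)) t₁).eventually (hopen _ ht₁)

/-- A smooth vector field is complete if it annihilates a smooth function with relatively compact
sublevel sets: cut off outside a sublevel set, the field has integral curves that exist for a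
uniform time, hence for all times, and those starting in the sublevel set never leave it. -/
theorem exists_isGlobalFlow
    (hX : ContMDiff J J.tangent ∞ (fun p ↦ (⟨p, X p⟩ : TangentBundle J N))) {e : N → ℝ}
    (he : ContMDiff J 𝓘(ℝ, ℝ) ∞ e) (heX : ∀ p, mfderiv J 𝓘(ℝ, ℝ) e p (X p) = 0)
    (hK : ∀ R, ∃ K : Set N, IsCompact K ∧ {p | e p ≤ R} ⊆ K) :
    ∃ φ, IsGlobalFlow J X φ := by
  suffices h : ∀ p, ∃ γ : ℝ → N, γ 0 = p ∧ IsMIntegralCurve γ X by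
    choose γ h0 hγ using h
    exact ⟨fun t p ↦ γ p t, h0, hγ⟩
  intro p
  let χ : N → ℝ := fun q ↦ Real.smoothTransition (e p + 1 - e q)
  have hχ : ContMDiff J 𝓘(ℝ, ℝ) ∞ χ :=
    (Real.smoothTransition.contDiff (n := ⊤).comp
      (contDiff_const.sub contDiff_id : ContDiff ℝ ∞ fun r : ℝ ↦ e p + 1 - r)).contMDiff.comp he
  let Y : ∀ q : N, TangentSpace J q := fun q ↦ χ q • X q
  have hY : ContMDiff J J.tangent ∞ (fun q ↦ (⟨q, Y q⟩ : TangentBundle J N)) :=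
    hχ.smul_section hX
  obtain ⟨K, hKc, hK⟩ := hK (e p + 1)
  have hloc : ∀ q : N, ∃ δ > (0 : ℝ), ∀ᶠ q' in 𝓝 q, ∃ γ : ℝ → N, γ 0 = q' ∧
      IsMIntegralCurveOn γ Y (Set.Ioo (-δ) δ) := by
    intro q
    obtain ⟨α, -, -, δ, hδ, hev⟩ := exists_chart_localFlow_integralCurve hY q one_ne_zero
    exact ⟨δ, hδ, hev.mono fun q' hq' ↦ ⟨_, hq'.1, hq'.2⟩⟩
  have hunif : ∃ δ > (0 : ℝ), ∀ q ∈ K, ∃ γ : ℝ → N, γ 0 = q ∧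
      IsMIntegralCurveOn γ Y (Set.Ioo (-δ) δ) := by
    refine hKc.induction_on (p := fun K ↦ ∃ δ > (0 : ℝ), ∀ q ∈ K, ∃ γ : ℝ → N, γ 0 = q ∧
      IsMIntegralCurveOn γ Y (Set.Ioo (-δ) δ)) ⟨1, one_pos, by simp⟩ ?_ ?_ ?_
    · rintro s t hst ⟨δ, hδ, h⟩
      exact ⟨δ, hδ, fun q hq ↦ h q (hst hq)⟩
    · rintro s t ⟨δ, hδ, h⟩ ⟨δ', hδ', h'⟩
      refine ⟨min δ δ', lt_min hδ hδ', fun q hq ↦ ?_⟩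
      rcases hq with hq | hq
      · obtain ⟨γ, h0, hγ⟩ := h q hq
        exact ⟨γ, h0, hγ.mono (Set.Ioo_subset_Ioo (neg_le_neg (min_le_left _ _)) (min_le_left _ _))⟩
      · obtain ⟨γ, h0, hγ⟩ := h' q hq
        exact ⟨γ, h0,
          hγ.mono (Set.Ioo_subset_Ioo (neg_le_neg (min_le_right _ _)) (min_le_right _ _))⟩
    · intro q _
      obtain ⟨δ, hδ, h⟩ := hloc q
      exact ⟨_, mem_nhdsWithin_of_mem_nhds h, δ, hδ, fun q' hq' ↦ hq'⟩
  obtain ⟨δ, hδ, hunif⟩ := hunif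
  obtain ⟨γ, hγ0, hγ⟩ := exists_isMIntegralCurve_of_isMIntegralCurveOn
    (hY.of_le (by exact_mod_cast le_top)) hδ (fun q ↦ by
      by_cases hq : e q ≤ e p + 1
      · exact hunif q (hK hq)
      · refine ⟨fun _ ↦ q, rfl, fun t _ ↦ ?_⟩
        have : Y q = 0 := by
          simp only [Y, χ]
          rw [Real.smoothTransition.zero_of_nonpos (by linarith), zero_smul]
        rw [this]
        refine (hasMFDerivWithinAt_const q _ t).congr_mfderiv ?_
        exact ContinuousLinearMap.ext fun a ↦ (smul_zero (M := ℝ) (A := E) a).symm) p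
  refine ⟨γ, hγ0, fun t ↦ ?_⟩
  have h1 : e (γ t) = e p := by
    rw [← hγ0]
    refine IsMIntegralCurve.const_of_mfderiv_eq_zero hγ (he.mdifferentiable (by simp))
      (fun q ↦ ?_) t
    rw [map_smul, heX, smul_zero]
  have h2 : Y (γ t) = X (γ t) := by
    simp only [Y, χ]
    rw [h1, Real.smoothTransition.one_of_one_le (by linarith), one_smul]
  exact h2 ▸ hγ t

end Smoothness

end ManifoldFlow

/-! ### Derivatives of one-forms along flows -/

section Forms

/-- Lie derivative of a one-form `A` that annihilates `Y`, along the local flow `ψ` of `Y`: it is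
the contraction of the exterior derivative of `A` with `Y`. -/
lemma hasDerivAt_pullback_of_apply_eq_zero {E : Type*} [NormedAddCommGroup E] [NormedSpace ℝ E]
    {A : E → E →L[ℝ] ℝ} {ψ : ℝ × E → E} {Y : E → E} {x₀ : E}
    (hA : DifferentiableAt ℝ A x₀) (hψ : ContDiffAt ℝ 2 ψ (0, x₀)) (hY : DifferentiableAt ℝ Y x₀)
    (h0 : ∀ᶠ y in 𝓝 x₀, ψ (0, y) = y)
    (hd : ∀ᶠ y in 𝓝 x₀, HasDerivAt (fun h ↦ ψ (h, y)) (Y y) 0)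
    (hAY : ∀ᶠ y in 𝓝 x₀, A y (Y y) = 0) (ζ : E) :
    HasDerivAt (fun h ↦ A (ψ (h, x₀)) (fderiv ℝ ψ (h, x₀) (0, ζ)))
      (fderiv ℝ A x₀ (Y x₀) ζ - fderiv ℝ A x₀ ζ (Y x₀)) 0 := by
  have hψ1 : DifferentiableAt ℝ ψ (0, x₀) := hψ.differentiableAt (by simp)
  have hψ2 : DifferentiableAt ℝ (fderiv ℝ ψ) (0, x₀) :=
    (hψ.fderiv_right (m := 1) (by norm_num)).differentiableAt (by simp)
  have hsymm : fderiv ℝ (fderiv ℝ ψ) (0, x₀) (1, 0) (0, ζ) =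
      fderiv ℝ (fderiv ℝ ψ) (0, x₀) (0, ζ) (1, 0) :=
    hψ.isSymmSndFDerivAt (by simp) _ _
  have hline : HasDerivAt (fun h : ℝ ↦ (h, x₀)) ((1 : ℝ), (0 : E)) 0 :=
    (hasDerivAt_id _).prodMk (hasDerivAt_const _ _)
  have hslice : HasFDerivAt (fun y : E ↦ ((0 : ℝ), y)) (ContinuousLinearMap.inr ℝ ℝ E) x₀ :=
    hasFDerivAt_prodMk_right 0 x₀
  have hζ : fderiv ℝ ψ (0, x₀) (0, ζ) = ζ := by
    have h1 := HasFDerivAt.comp x₀ hψ1.hasFDerivAt hslice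
    have h2 : HasFDerivAt (ψ ∘ fun y : E ↦ ((0 : ℝ), y)) (ContinuousLinearMap.id ℝ E) x₀ :=
      (hasFDerivAt_id x₀).congr_of_eventuallyEq h0
    exact congrArg (fun T : E →L[ℝ] E ↦ T ζ) (h1.unique h2)
  have hYψ : ∀ᶠ y in 𝓝 x₀, fderiv ℝ ψ (0, y) (1, 0) = Y y := by
    have h1 : ∀ᶠ z in 𝓝 ((0 : ℝ), x₀), DifferentiableAt ℝ ψ z :=
      (hψ.eventually (by simp)).mono fun z hz ↦ hz.differentiableAt (by simp)
    have h2 : ∀ᶠ y in 𝓝 x₀, DifferentiableAt ℝ ψ (0, y) :=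
      (by fun_prop : ContinuousAt (fun y : E ↦ ((0 : ℝ), y)) x₀).eventually h1
    filter_upwards [h2, hd] with y hy hy'
    exact (hy.hasFDerivAt.comp_hasDerivAt (0 : ℝ)
      ((hasDerivAt_id (0 : ℝ)).prodMk (hasDerivAt_const _ y))).unique hy'
  -- the mixed second derivative of the flow is the derivative of the vector field
  have hmix : fderiv ℝ (fderiv ℝ ψ) (0, x₀) (0, ζ) (1, 0) = fderiv ℝ Y x₀ ζ := by
    have h1 := (HasFDerivAt.comp x₀ hψ2.hasFDerivAt hslice).clm_apply
      (hasFDerivAt_const ((1 : ℝ), (0 : E)) x₀)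
    have h2 := hY.hasFDerivAt.congr_of_eventuallyEq hYψ
    simpa using congrArg (fun T : E →L[ℝ] E ↦ T ζ) (h1.unique h2)
  have hG : HasDerivAt (fun h : ℝ ↦ fderiv ℝ ψ (h, x₀) (0, ζ)) (fderiv ℝ Y x₀ ζ) 0 := by
    have h1 : HasDerivAt (fun h : ℝ ↦ fderiv ℝ ψ (h, x₀)) (fderiv ℝ (fderiv ℝ ψ) (0, x₀) (1, 0))
        0 := hψ2.hasFDerivAt.comp_hasDerivAt (0 : ℝ) hline
    have h2 := h1.clm_apply (hasDerivAt_const (0 : ℝ) ((0 : ℝ), ζ))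
    simpa [hsymm, hmix] using h2
  have hψ0 : ψ (0, x₀) = x₀ := h0.self_of_nhds
  have hF : HasDerivAt (fun h : ℝ ↦ A (ψ (h, x₀))) (fderiv ℝ A x₀ (Y x₀)) 0 := by
    have h1 : HasFDerivAt A (fderiv ℝ A x₀) (ψ (0, x₀)) := by rw [hψ0]; exact hA.hasFDerivAt
    exact h1.comp_hasDerivAt (0 : ℝ) hd.self_of_nhds
  -- differentiate `A Y = 0` in the direction `ζ`
  have hzero : fderiv ℝ A x₀ ζ (Y x₀) + A x₀ (fderiv ℝ Y x₀ ζ) = 0 := by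
    have h1 := hA.hasFDerivAt.clm_apply hY.hasFDerivAt
    have h2 : HasFDerivAt (fun y ↦ A y (Y y)) (0 : E →L[ℝ] ℝ) x₀ :=
      (hasFDerivAt_const (0 : ℝ) x₀).congr_of_eventuallyEq hAY
    have h3 := congrArg (fun T : E →L[ℝ] ℝ ↦ T ζ) (h1.unique h2)
    simp only [add_apply, ContinuousLinearMap.comp_apply,
      ContinuousLinearMap.flip_apply, zero_apply] at h3
    linarith
  have := hF.clm_apply hG
  rw [hζ, hψ0] at this
  convert! this using 1
  linarith

variable {E : Type*} [NormedAddCommGroup E] [NormedSpace ℝ E]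
  {H : Type*} [TopologicalSpace H] {J : ModelWithCorners ℝ E H}
  {N : Type*} [TopologicalSpace N] [ChartedSpace H N]

/-- A field of cotangent vectors as a differential form of degree one. -/
def toOneForm (η : ∀ p : N, TangentSpace J p →L[ℝ] ℝ) (p : N) :
    TangentSpace J p [⋀^Fin 1]→L[ℝ] ℝ :=
  ContinuousAlternatingMap.ofSubsingleton ℝ (TangentSpace J p) ℝ (0 : Fin 1) (η p)

/-- The one-form `η` read in the chart at `q`. -/
def chartForm (η : ∀ p : N, TangentSpace J p →L[ℝ] ℝ) (q : N) (y : E) : E →L[ℝ] ℝ :=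
  (η ((extChartAt J q).symm y)).comp (mfderiv 𝓘(ℝ, E) J (extChartAt J q).symm y)

lemma extDeriv_ofSubsingleton {A : E → E →L[ℝ] ℝ} {x₀ : E} (hA : DifferentiableAt ℝ A x₀)
    (ξ ζ : E) :
    extDeriv (fun y ↦ ContinuousAlternatingMap.ofSubsingleton ℝ E ℝ (0 : Fin 1) (A y)) x₀ ![ξ, ζ] =
      fderiv ℝ A x₀ ξ ζ - fderiv ℝ A x₀ ζ ξ := by
  have hd : DifferentiableAt ℝ
      (fun y ↦ ContinuousAlternatingMap.ofSubsingleton ℝ E ℝ (0 : Fin 1) (A y)) x₀ :=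
    (ContinuousAlternatingMap.ofSubsingletonLIE (𝕜 := ℝ) (E := E) (F := ℝ)
      (0 : Fin 1)).differentiableAt.comp x₀ hA
  have hap : ∀ v w : E, fderiv ℝ (fun y ↦ A y v) x₀ w = fderiv ℝ A x₀ w v := fun v w ↦ by
    rw [fderiv_clm_apply hA (differentiableAt_const v)]
    simp
  rw [extDeriv_apply hd, Fin.sum_univ_two]
  simp [Fin.removeNth, ContinuousAlternatingMap.ofSubsingleton_apply_apply, hap, sub_eq_add_neg]

lemma mextDeriv_toOneForm [J.Boundaryless] {η : ∀ p : N, TangentSpace J p →L[ℝ] ℝ} {q : N}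
    (hη : DifferentiableAt ℝ (chartForm η q) (extChartAt J q q)) (ξ ζ : TangentSpace J q) :
    mextDeriv J (toOneForm η) q ![ξ, ζ] =
      fderiv ℝ (chartForm η q) (extChartAt J q q) ξ ζ -
        fderiv ℝ (chartForm η q) (extChartAt J q q) ζ ξ :=
  extDeriv_ofSubsingleton hη ξ ζ

variable [J.Boundaryless]

lemma mfderiv_extChartAt_symm_self [IsManifold J 1 N] (q : N) :
    mfderiv 𝓘(ℝ, E) J (extChartAt J q).symm (extChartAt J q q) = ContinuousLinearMap.id ℝ E := by
  have := mfderivWithin_range_extChartAt_symm (I := J) (x := q)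
  rwa [J.range_eq_univ, mfderivWithin_univ] at this

lemma chartForm_mfderiv_extChartAt [IsManifold J 1 N] (η : ∀ p : N, TangentSpace J p →L[ℝ] ℝ)
    {q p : N} (h : p ∈ (extChartAt J q).source) (w : TangentSpace J p) :
    chartForm η q (extChartAt J q p) (mfderiv J 𝓘(ℝ, E) (extChartAt J q) p w) = η p w := by
  have h1 := mfderivWithin_extChartAt_symm_comp_mfderiv_extChartAt' (I := J) h
  rw [J.range_eq_univ, mfderivWithin_univ] at h1
  have h2 : (extChartAt J q).symm (extChartAt J q p) = p := (extChartAt J q).left_inv h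
  have h3 : mfderiv 𝓘(ℝ, E) J (extChartAt J q).symm (extChartAt J q p)
      (mfderiv J 𝓘(ℝ, E) (extChartAt J q) p w) = w := congrArg (fun T ↦ T w) h1
  have key : ∀ p', p' = p → ∀ w' : E, w' = (w : E) → (η p' : E →L[ℝ] ℝ) w' = η p w := by
    rintro _ rfl _ rfl; rfl
  exact key _ h2 _ h3

end Forms

section PullbackFlow

variable {E : Type*} [NormedAddCommGroup E] [NormedSpace ℝ E]
  {H : Type*} [TopologicalSpace H] {J : ModelWithCorners ℝ E H}
  {N : Type*} [TopologicalSpace N] [ChartedSpace H N]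
  [J.Boundaryless] [IsManifold J ∞ N] [T2Space N] [FiniteDimensional ℝ E]
  {X : ∀ p : N, TangentSpace J p} {φ : ℝ → N → N}

lemma IsGlobalFlow.contMDiff_time
    (hX : ContMDiff J J.tangent ∞ (fun p ↦ (⟨p, X p⟩ : TangentBundle J N)))
    (hφ : IsGlobalFlow J X φ) (t : ℝ) : ContMDiff J J ∞ (φ t) :=
  (hφ.contMDiff hX).comp (contMDiff_const.prodMk contMDiff_id)

/-- The Lie derivative formula at time zero, by reduction to the chart at `q`. -/
lemma IsGlobalFlow.hasDerivAt_pullback_zero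
    (hX : ContMDiff J J.tangent ∞ (fun p ↦ (⟨p, X p⟩ : TangentBundle J N)))
    (hφ : IsGlobalFlow J X φ) {η : ∀ p : N, TangentSpace J p →L[ℝ] ℝ} {q : N}
    (hη : DifferentiableAt ℝ (chartForm η q) (extChartAt J q q))
    (hηX : ∀ᶠ p in 𝓝 q, η p (X p) = 0) (ζ : TangentSpace J q) :
    HasDerivAt (fun t ↦ η (φ t q) (mfderiv J J (φ t) q ζ))
      (mextDeriv J (toOneForm η) q ![X q, ζ]) 0 := by
  set c := extChartAt J q with hc
  set x₀ := c q with hx₀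
  let ψ : ℝ × E → E := fun z ↦ c (φ z.1 (c.symm z.2))
  have hsymm0 : c.symm x₀ = q := (extChartAt J q).left_inv (mem_extChartAt_source q)
  have htarget : ∀ᶠ y in 𝓝 x₀, y ∈ c.target :=
    (isOpen_extChartAt_target q).mem_nhds (mem_extChartAt_target (I := J) q)
  have hcsymm : ContinuousAt c.symm x₀ := continuousAt_extChartAt_symm q
  have hφs := hφ.contMDiff hX
  -- the flow read in the chart
  have hψm : ContMDiffAt 𝓘(ℝ, ℝ × E) 𝓘(ℝ, E) ∞ ψ (0, x₀) := by
    have h1 : ContMDiffAt 𝓘(ℝ, ℝ × E) (𝓘(ℝ, ℝ).prod J) ∞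
        (fun z : ℝ × E ↦ (z.1, c.symm z.2)) (0, x₀) := by
      refine ContMDiffAt.prodMk contDiff_fst.contMDiff.contMDiffAt ?_
      refine ContMDiffAt.comp (I' := 𝓘(ℝ, E)) (0, x₀) ?_ contDiff_snd.contMDiff.contMDiffAt
      exact (contMDiffOn_extChartAt_symm q).contMDiffAt htarget
    have h2 := ContMDiffAt.comp (0, x₀) (hφs.contMDiffAt (x := ((0 : ℝ), c.symm x₀))) h1
    refine ContMDiffAt.comp (I' := J) (0, x₀) ?_ h2
    change ContMDiffAt J 𝓘(ℝ, E) ∞ c (φ 0 (c.symm x₀))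
    rw [hφ.zero, hsymm0]
    exact contMDiffAt_extChartAt
  have hψ : ContDiffAt ℝ 2 ψ (0, x₀) := hψm.contDiffAt.of_le ENat.LEInfty.out
  have hY : DifferentiableAt ℝ (chartField X q) x₀ :=
    (contDiffAt_chartField (hX.contMDiffAt (x := q))).differentiableAt (by simp)
  have h0 : ∀ᶠ y in 𝓝 x₀, ψ (0, y) = y := by
    filter_upwards [htarget] with y hy
    change c (φ 0 (c.symm y)) = y
    rw [hφ.zero, c.right_inv hy]
  have hd : ∀ᶠ y in 𝓝 x₀, HasDerivAt (fun h ↦ ψ (h, y)) (chartField X q y) 0 := by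
    filter_upwards [htarget] with y hy
    have hsrc : c.symm y ∈ c.source := c.map_target hy
    have h1 := hφ.integralCurve (c.symm y) 0
    have h2 : HasMFDerivAt J 𝓘(ℝ, E) c (φ 0 (c.symm y))
        (mfderiv J 𝓘(ℝ, E) c (φ 0 (c.symm y))) := by
      rw [hφ.zero]
      have hsrc' := hsrc
      rw [extChartAt_source] at hsrc'
      exact (mdifferentiableAt_extChartAt hsrc').hasMFDerivAt
    let T : E →L[ℝ] E := mfderiv J 𝓘(ℝ, E) c (φ 0 (c.symm y))
    let v : E := X (φ 0 (c.symm y))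
    have h3 : HasFDerivAt (fun h ↦ ψ (h, y)) (T.comp ((1 : ℝ →L[ℝ] ℝ).smulRight v)) 0 :=
      (h2.comp (0 : ℝ) h1).hasFDerivAt
    have h4 : HasDerivAt (fun h ↦ ψ (h, y)) (T v) 0 := by simpa using h3.hasDerivAt
    have h5 := chartField_eq_mfderiv X hsrc
    rw [c.right_inv hy] at h5
    rw [h5]
    have h6 : ∀ p p', p = p' → (mfderiv J 𝓘(ℝ, E) c p (X p) : E) =
        mfderiv J 𝓘(ℝ, E) c p' (X p') := by rintro _ _ rfl; rfl
    exact h6 _ _ (hφ.zero (c.symm y)) ▸ h4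
  have hAY : ∀ᶠ y in 𝓝 x₀, chartForm η q y (chartField X q y) = 0 := by
    have h1 : ∀ᶠ y in 𝓝 x₀, η (c.symm y) (X (c.symm y)) = 0 :=
      hcsymm.eventually (by rwa [hsymm0])
    filter_upwards [htarget, h1] with y hy h1
    change η (c.symm y) (mfderiv 𝓘(ℝ, E) J c.symm y (chartField (E := E) X q y)) = 0
    rw [mfderiv_extChartAt_symm_chartField X hy, h1]
  have key := hasDerivAt_pullback_of_apply_eq_zero hη hψ hY h0 hd hAY ζ
  have hYX : chartField X q x₀ = X q := by
    rw [chartField_eq_mfderiv X (mem_extChartAt_source q), mfderiv_extChartAt_self]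
    rfl
  rw [mextDeriv_toOneForm hη, ← hc, ← hx₀]
  rw [hYX] at key
  refine key.congr_of_eventuallyEq ?_
  have hsrc : ∀ᶠ h in 𝓝 (0 : ℝ), φ h q ∈ c.source := by
    refine (hφ.continuous_curve q).continuousAt.eventually ?_
    change ∀ᶠ y in 𝓝 (φ 0 q), y ∈ c.source
    rw [hφ.zero]
    exact extChartAt_source_mem_nhds q
  have hψd : ∀ᶠ h in 𝓝 (0 : ℝ), DifferentiableAt ℝ ψ (h, x₀) :=
    (by fun_prop : ContinuousAt (fun h : ℝ ↦ (h, x₀)) 0).eventually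
      ((hψ.eventually (by simp)).mono fun z hz ↦ hz.differentiableAt (by simp))
  filter_upwards [hsrc, hψd] with h hh hh'
  have e1 : ψ (h, x₀) = c (φ h q) := by change c (φ h (c.symm x₀)) = _; rw [hsymm0]
  have e2 : fderiv ℝ ψ (h, x₀) (0, ζ) = mfderiv J 𝓘(ℝ, E) c (φ h q) (mfderiv J J (φ h) q ζ) := by
    have f1 : HasFDerivAt (fun y : E ↦ ψ (h, y))
        ((fderiv ℝ ψ (h, x₀)).comp (ContinuousLinearMap.inr ℝ ℝ E)) x₀ :=
      HasFDerivAt.comp x₀ hh'.hasFDerivAt (hasFDerivAt_prodMk_right h x₀)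
    have f2 : HasMFDerivAt 𝓘(ℝ, E) J c.symm x₀ (ContinuousLinearMap.id ℝ E) := by
      have := (mdifferentiableAt_extChartAt_symm (mem_extChartAt_target (I := J) q)).hasMFDerivAt
      rwa [mfderiv_extChartAt_symm_self] at this
    have f3 : HasMFDerivAt J J (φ h) (c.symm x₀) (mfderiv J J (φ h) q : E →L[ℝ] E) := by
      rw [hsymm0]
      exact ((hφ.contMDiff_time hX h).mdifferentiable (by simp) q).hasMFDerivAt
    have f4 : HasMFDerivAt J 𝓘(ℝ, E) c (φ h (c.symm x₀))
        (mfderiv J 𝓘(ℝ, E) c (φ h q) : E →L[ℝ] E) := by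
      rw [hsymm0]
      rw [extChartAt_source] at hh
      exact (mdifferentiableAt_extChartAt hh).hasMFDerivAt
    have f5 : HasFDerivAt (fun y : E ↦ ψ (h, y))
        ((mfderiv J 𝓘(ℝ, E) c (φ h q) : E →L[ℝ] E).comp
          ((mfderiv J J (φ h) q : E →L[ℝ] E).comp (ContinuousLinearMap.id ℝ E))) x₀ :=
      ((f4.comp x₀ (f3.comp x₀ f2))).hasFDerivAt
    exact congrArg (fun T : E →L[ℝ] E ↦ T ζ) (f1.unique f5)
  change η (φ h q) (mfderiv J J (φ h) q ζ) = _
  rw [e1, e2, chartForm_mfderiv_extChartAt η hh]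

/-- The Lie derivative formula along a flow, for a one-form `η` that annihilates the vector field:
`d/dt φ_t^* η = φ_t^* (i_X dη)`. -/
theorem IsGlobalFlow.hasDerivAt_pullback
    (hX : ContMDiff J J.tangent ∞ (fun p ↦ (⟨p, X p⟩ : TangentBundle J N)))
    (hφ : IsGlobalFlow J X φ) {η : ∀ p : N, TangentSpace J p →L[ℝ] ℝ} {p : N} {t : ℝ}
    (hη : DifferentiableAt ℝ (chartForm η (φ t p)) (extChartAt J (φ t p) (φ t p)))
    (hηX : ∀ᶠ p' in 𝓝 (φ t p), η p' (X p') = 0) (ζ : TangentSpace J p) :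
    HasDerivAt (fun t ↦ η (φ t p) (mfderiv J J (φ t) p ζ))
      (mextDeriv J (toOneForm η) (φ t p) ![X (φ t p), mfderiv J J (φ t) p ζ]) t := by
  have h := hφ.hasDerivAt_pullback_zero hX hη hηX (mfderiv J J (φ t) p ζ)
  have h1 := HasDerivAt.comp_sub_const t t (by rwa [sub_self])
  refine h1.congr_of_eventuallyEq (Filter.Eventually.of_forall fun s ↦ ?_)
  have hcomp : φ s = φ (s - t) ∘ φ t := by
    ext p'
    rw [Function.comp_apply, ← hφ.add hX, sub_add_cancel]
  have hd : ∀ r, MDifferentiable J J (φ r) := fun r ↦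
    (hφ.contMDiff_time hX r).mdifferentiable (by simp)
  have hm : mfderiv J J (φ s) p = (mfderiv J J (φ (s - t)) (φ t p)).comp (mfderiv J J (φ t) p) := by
    conv_lhs => rw [hcomp]
    exact mfderiv_comp p (hd _ _) (hd _ _)
  have key : ∀ p' p'', p' = p'' → ∀ w w' : E, w = w' →
      (η p' : E →L[ℝ] ℝ) w = (η p'' : E →L[ℝ] ℝ) w' := by
    rintro _ _ rfl _ _ rfl; rfl
  exact key _ _ (congrFun hcomp p) _ _ (congrArg (fun T : E →L[ℝ] E ↦ T ζ) hm)

end PullbackFlow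

/-! ### Levi-Civita connection and area form in a coordinate domain -/

section LocalGeometry

variable {E : Type*} [NormedAddCommGroup E] [NormedSpace ℝ E]

/-- A metric `G` and a bundle map `Γ` (the Christoffel symbols) on a coordinate domain such that `Γ`
is torsion free and compatible with the metric at `y`. -/
structure IsLeviCivitaAt (G : E → E →L[ℝ] E →L[ℝ] ℝ) (Γ : E → E →L[ℝ] E →L[ℝ] E) (y : E) :
    Prop where
  differentiableAt_metric : DifferentiableAt ℝ G y
  symm : ∀ u w, G y u w = G y w u
  pos : ∀ u, u ≠ 0 → 0 < G y u u
  torsion : ∀ u w, Γ y u w = Γ y w u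
  compat : ∀ z u w, fderiv ℝ G y z u w = G y (Γ y z u) w + G y u (Γ y z w)

/-- Transformation law of the Christoffel symbols of the Levi-Civita connection under a change of
coordinates `τ`. The difference of the two sides is symmetric in its two arguments, and the metric
compatibility makes it skew with respect to the metric, hence it vanishes. -/
theorem IsLeviCivitaAt.christoffel_transform {G G' : E → E →L[ℝ] E →L[ℝ] ℝ}
    {Γ Γ' : E → E →L[ℝ] E →L[ℝ] E} {τ : E → E} {y : E}
    (h : IsLeviCivitaAt G Γ (τ y)) (h' : IsLeviCivitaAt G' Γ' y) (hτ : ContDiffAt ℝ 2 τ y)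
    (hG : ∀ᶠ x in 𝓝 y, ∀ u w, G' x u w = G (τ x) (fderiv ℝ τ x u) (fderiv ℝ τ x w))
    (hsurj : Function.Surjective (fderiv ℝ τ y)) (u w : E) :
    fderiv ℝ τ y (Γ' y u w) =
      Γ (τ y) (fderiv ℝ τ y u) (fderiv ℝ τ y w) + fderiv ℝ (fderiv ℝ τ) y u w := by
  set A := fderiv ℝ τ y with hA
  have hτ1 : HasFDerivAt τ A y := (hτ.differentiableAt (by simp)).hasFDerivAt
  have hτ2 : HasFDerivAt (fderiv ℝ τ) (fderiv ℝ (fderiv ℝ τ) y) y :=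
    ((hτ.fderiv_right (m := 1) (by norm_num)).differentiableAt (by simp)).hasFDerivAt
  set D := fderiv ℝ (fderiv ℝ τ) y with hD
  have hDsymm : ∀ a b, D a b = D b a := fun a b ↦ hτ.isSymmSndFDerivAt (by simp) a b
  have hderiv : ∀ z a b, fderiv ℝ G' y z a b =
      fderiv ℝ G (τ y) (A z) (A a) (A b) + G (τ y) (D z a) (A b) + G (τ y) (A a) (D z b) := by
    intro z a b
    have h1 : HasFDerivAt (fun x ↦ G' x a b) _ y :=
      ((h'.differentiableAt_metric.hasFDerivAt.clm_apply (hasFDerivAt_const a y))).clm_apply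
        (hasFDerivAt_const b y)
    have h2 : HasFDerivAt (fun x ↦ G (τ x) (fderiv ℝ τ x a) (fderiv ℝ τ x b)) _ y :=
      ((HasFDerivAt.comp y h.differentiableAt_metric.hasFDerivAt hτ1).clm_apply
        (hτ2.clm_apply (hasFDerivAt_const a y))).clm_apply
        (hτ2.clm_apply (hasFDerivAt_const b y))
    have h3 := h2.congr_of_eventuallyEq (hG.mono fun x hx ↦ hx a b)
    have h4 := congrArg (fun T : E →L[ℝ] ℝ ↦ T z) (h1.unique h3)
    simp [← hA] at h4
    rw [h4]; ring
  let C : E → E → E := fun a b ↦ A (Γ' y a b) - Γ (τ y) (A a) (A b) - D a b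
  have hCsymm : ∀ a b, C a b = C b a := fun a b ↦ by
    simp only [C]; rw [h'.torsion a b, h.torsion (A a), hDsymm a b]
  have hskew : ∀ z a b, G (τ y) (C z a) (A b) = - G (τ y) (C z b) (A a) := by
    intro z a b
    have h1 := hderiv z a b
    rw [h'.compat, h.compat, hG.self_of_nhds, hG.self_of_nhds] at h1
    simp only [C, map_sub, sub_apply]
    rw [h.symm (A (Γ' y z b)) (A a), h.symm (Γ (τ y) (A z) (A b)) (A a), h.symm (D z b) (A a)]
    linarith
  -- a trilinear form symmetric in two and skew in two of its arguments vanishes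
  have hzero : ∀ z a b, G (τ y) (C z a) (A b) = 0 := by
    intro z a b
    have e1 := hskew z a b
    have e2 := hskew b z a
    have e3 := hskew a b z
    rw [hCsymm b z, hCsymm b a] at e2
    rw [hCsymm a z] at e3
    linarith
  have hC : C u w = 0 := by
    by_contra hne
    obtain ⟨b, hb⟩ := hsurj (C u w)
    have := h.pos _ hne
    rw [← hb] at this
    have h1 := hzero u w b
    rw [← hb] at h1
    exact this.ne' h1
  have : C u w = A (Γ' y u w) - (Γ (τ y) (A u) (A w) + D u w) := by simp only [C]; abel
  rw [this] at hC
  exact sub_eq_zero.1 hC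

/-- The almost complex structure `I` is a rotation by a right angle of the plane with scalar product
`G`; the last field expresses that `a` and `I a` span the plane. -/
structure IsRotation (G : E →L[ℝ] E →L[ℝ] ℝ) (I : E →L[ℝ] E) : Prop where
  skew : ∀ u w, G (I u) w = - G u (I w)
  sq : ∀ u, I (I u) = -u
  pythagoras : ∀ a x w, G a x * G a w + G (I a) x * G (I a) w = G a a * G x w

/-- The complex structure of a surface is parallel for the Levi-Civita connection: its covariant
derivative `B` is skew and anticommutes with it, so that `B u` is orthogonal to `u` and `I u`. -/
theorem IsLeviCivitaAt.fderiv_rotation {G : E → E →L[ℝ] E →L[ℝ] ℝ} {Γ : E → E →L[ℝ] E →L[ℝ] E}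
    {I : E → E →L[ℝ] E} {y : E} (h : IsLeviCivitaAt G Γ y) (hI : DifferentiableAt ℝ I y)
    (hrot : ∀ᶠ x in 𝓝 y, IsRotation (G x) (I x)) (z u : E) :
    fderiv ℝ I y z u = I y (Γ y z u) - Γ y z (I y u) := by
  have hr := hrot.self_of_nhds
  have dskew : ∀ a b, fderiv ℝ G y z (I y a) b + G y (fderiv ℝ I y z a) b =
      - (fderiv ℝ G y z a (I y b) + G y a (fderiv ℝ I y z b)) := by
    intro a b
    have h1 := (h.differentiableAt_metric.hasFDerivAt.clm_apply
      (hI.hasFDerivAt.clm_apply (hasFDerivAt_const a y))).clm_apply (hasFDerivAt_const b y)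
    have h2 := ((h.differentiableAt_metric.hasFDerivAt.clm_apply (hasFDerivAt_const a y)).clm_apply
      (hI.hasFDerivAt.clm_apply (hasFDerivAt_const b y))).neg
    have h3 := h2.congr_of_eventuallyEq (f₁ := fun x ↦ G x (I x a) b)
      (hrot.mono fun x hx ↦ hx.skew a b)
    have h4 := congrArg (fun T : E →L[ℝ] ℝ ↦ T z) (h1.unique h3)
    simp at h4
    linarith
  have dsq : ∀ a, fderiv ℝ I y z (I y a) + I y (fderiv ℝ I y z a) = 0 := by
    intro a
    have h1 := hI.hasFDerivAt.clm_apply (hI.hasFDerivAt.clm_apply (hasFDerivAt_const a y))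
    have h2 : HasFDerivAt (fun x ↦ I x (I x a)) (0 : E →L[ℝ] E) y :=
      (hasFDerivAt_const (-a) y).congr_of_eventuallyEq (hrot.mono fun x hx ↦ hx.sq a)
    have h4 := congrArg (fun T : E →L[ℝ] E ↦ T z) (h1.unique h2)
    simpa [add_comm] using h4
  let B : E → E := fun a ↦ fderiv ℝ I y z a + Γ y z (I y a) - I y (Γ y z a)
  have hBskew : ∀ a b, G y (B a) b = - G y a (B b) := by
    intro a b
    have h1 := dskew a b
    rw [h.compat, h.compat] at h1
    simp only [B, map_sub, map_add, sub_apply, add_apply]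
    have h2 := hr.skew (Γ y z a) b
    have h3 := hr.skew a (Γ y z b)
    linarith
  have hBI : ∀ a, B (I y a) = - I y (B a) := by
    intro a
    simp only [B, map_sub, map_add, hr.sq, map_neg, sub_neg_eq_add]
    rw [eq_neg_of_add_eq_zero_left (dsq a)]
    abel
  have hBu : B u = 0 := by
    by_contra hne
    have hu : u ≠ 0 := by
      rintro rfl
      exact hne (by simp [B])
    have h1 : G y u (B u) = 0 := by
      have := hBskew u u
      rw [h.symm (B u) u] at this
      linarith
    have h2 : G y (I y u) (B u) = 0 := by
      have e1 := hBskew u (I y u)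
      rw [hBI, map_neg, neg_neg] at e1
      have e2 := hr.skew u (B u)
      rw [h.symm (B u)] at e1
      linarith
    have h3 := hr.pythagoras u (B u) (B u)
    rw [h1, h2] at h3
    nlinarith [mul_pos (h.pos u hu) (h.pos _ hne)]
  have : B u = fderiv ℝ I y z u - (I y (Γ y z u) - Γ y z (I y u)) := by simp only [B]; abel
  rw [this] at hBu
  exact sub_eq_zero.1 hBu

/-- The curvature tensor `R(ξ, ζ) v` of the connection with Christoffel symbols `Γ`. -/
def localCurvature (Γ : E → E →L[ℝ] E →L[ℝ] E) (y ξ ζ v : E) : E :=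
  fderiv ℝ Γ y ξ ζ v - fderiv ℝ Γ y ζ ξ v + (Γ y ξ (Γ y ζ v) - Γ y ζ (Γ y ξ v))

/-- The curvature is skew: differentiate the metric compatibility once more and use the symmetry of
the second derivatives of the metric. -/
theorem metric_localCurvature_self {G : E → E →L[ℝ] E →L[ℝ] ℝ} {Γ : E → E →L[ℝ] E →L[ℝ] E}
    {y : E} (h : ∀ᶠ x in 𝓝 y, IsLeviCivitaAt G Γ x) (hG : ContDiffAt ℝ 2 G y)
    (hΓ : DifferentiableAt ℝ Γ y) (ξ ζ v : E) : G y (localCurvature Γ y ξ ζ v) v = 0 := by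
  have hy := h.self_of_nhds
  have hG2 : HasFDerivAt (fderiv ℝ G) (fderiv ℝ (fderiv ℝ G) y) y :=
    ((hG.fderiv_right (m := 1) (by norm_num)).differentiableAt (by simp)).hasFDerivAt
  have key : ∀ a b, fderiv ℝ (fderiv ℝ G) y a b v v =
      2 * (fderiv ℝ G y a (Γ y b v) v + G y (fderiv ℝ Γ y a b v) v) := by
    intro a b
    have h1 := ((hG2.clm_apply (hasFDerivAt_const b y)).clm_apply
      (hasFDerivAt_const v y)).clm_apply (hasFDerivAt_const v y)
    have h2 := ((hy.differentiableAt_metric.hasFDerivAt.clm_apply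
      ((hΓ.hasFDerivAt.clm_apply (hasFDerivAt_const b y)).clm_apply
        (hasFDerivAt_const v y))).clm_apply (hasFDerivAt_const v y)).const_mul 2
    have h3 := h2.congr_of_eventuallyEq (f₁ := fun x ↦ fderiv ℝ G x b v v)
      (h.mono fun x hx ↦ by
        simp only
        rw [hx.compat, hx.symm v (Γ x b v)]; ring)
    have h4 := congrArg (fun T : E →L[ℝ] ℝ ↦ T a) (h1.unique h3)
    simp at h4
    linarith
  have hsymm : fderiv ℝ (fderiv ℝ G) y ξ ζ v v = fderiv ℝ (fderiv ℝ G) y ζ ξ v v := by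
    rw [hG.isSymmSndFDerivAt (by simp) ξ ζ]
  rw [key, key, hy.compat, hy.compat] at hsymm
  simp only [localCurvature, map_add, map_sub, add_apply, sub_apply]
  rw [hy.symm (Γ y ζ v) (Γ y ξ v)] at hsymm
  linarith

/-! ### The canonical one-form and the connection form in a coordinate domain -/

variable (G : E → E →L[ℝ] E →L[ℝ] ℝ) (Γ : E → E →L[ℝ] E →L[ℝ] E) (I : E → E →L[ℝ] E)

/-- The canonical one-form of the tangent bundle, in coordinates. -/
def localCanonicalForm (z : E × E) : E × E →L[ℝ] ℝ :=
  (G z.1 z.2).comp (ContinuousLinearMap.fst ℝ E E)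

/-- The vertical part `u + Γ(w, v)` of the tangent vector `(w, u)` at `(y, v)`. -/
def localConnector (z : E × E) : E × E →L[ℝ] E :=
  ContinuousLinearMap.snd ℝ E E + ((Γ z.1).flip z.2).comp (ContinuousLinearMap.fst ℝ E E)

/-- The connection one-form: the rate of rotation of `v`, relative to parallel transport. It is
meaningful for `v ≠ 0`, and `0` for `v = 0`. -/
def localConnectionForm (z : E × E) : E × E →L[ℝ] ℝ :=
  (G z.1 z.2 z.2)⁻¹ • (G z.1 (I z.1 z.2)).comp (localConnector Γ z)

/-- The vector field `-H` in coordinates. -/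
def localNegHorizontal (z : E × E) : E × E :=
  (-I z.1 z.2, Γ z.1 (I z.1 z.2) z.2)

variable {G Γ I}

lemma localCanonicalForm_apply (z ζ : E × E) : localCanonicalForm G z ζ = G z.1 z.2 ζ.1 := rfl

lemma localConnector_apply (z ζ : E × E) :
    localConnector Γ z ζ = ζ.2 + Γ z.1 ζ.1 z.2 := rfl

lemma localConnectionForm_apply (z ζ : E × E) :
    localConnectionForm G Γ I z ζ =
      (G z.1 z.2 z.2)⁻¹ * G z.1 (I z.1 z.2) (localConnector Γ z ζ) := rfl

lemma localConnector_localNegHorizontal (z : E × E) :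
    localConnector Γ z (localNegHorizontal Γ I z) = 0 := by
  simp [localConnector_apply, localNegHorizontal]

lemma differentiableAt_localCanonicalForm {z : E × E} (hG : DifferentiableAt ℝ G z.1) :
    DifferentiableAt ℝ (localCanonicalForm G) z := by
  have h1 : DifferentiableAt ℝ (fun z : E × E ↦ G z.1) z := hG.comp z differentiableAt_fst
  exact (h1.clm_apply differentiableAt_snd).clm_comp (differentiableAt_const _)

/-- The exterior derivative of the canonical one-form, in terms of the connector. -/
theorem IsLeviCivitaAt.fderiv_localCanonicalForm_sub {z : E × E} (h : IsLeviCivitaAt G Γ z.1)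
    (ξ ζ : E × E) :
    fderiv ℝ (localCanonicalForm G) z ξ ζ - fderiv ℝ (localCanonicalForm G) z ζ ξ =
      G z.1 (localConnector Γ z ξ) ζ.1 - G z.1 (localConnector Γ z ζ) ξ.1 := by
  have hG1 := HasFDerivAt.comp z h.differentiableAt_metric.hasFDerivAt
    (hasFDerivAt_fst (𝕜 := ℝ) (p := z))
  have key : ∀ a b : E × E, fderiv ℝ (localCanonicalForm G) z a b =
      fderiv ℝ G z.1 a.1 z.2 b.1 + G z.1 a.2 b.1 := by
    intro a b
    have h1 := (differentiableAt_localCanonicalForm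
      h.differentiableAt_metric).hasFDerivAt.clm_apply (hasFDerivAt_const b z)
    have h2 : HasFDerivAt (fun z : E × E ↦ localCanonicalForm G z b) _ z :=
      (hG1.clm_apply (hasFDerivAt_snd (𝕜 := ℝ) (p := z))).clm_apply (hasFDerivAt_const b.1 z)
    have h4 := congrArg (fun T : E × E →L[ℝ] ℝ ↦ T a) (h1.unique h2)
    simp at h4
    linarith
  rw [key, key, h.compat, h.compat, h.torsion ζ.1 ξ.1]
  simp only [localConnector_apply, map_add, add_apply]
  ring

lemma differentiableAt_localConnectionForm {z : E × E} (h : IsLeviCivitaAt G Γ z.1)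
    (hI : DifferentiableAt ℝ I z.1) (hΓ : DifferentiableAt ℝ Γ z.1) (hz : z.2 ≠ 0) :
    DifferentiableAt ℝ (localConnectionForm G Γ I) z := by
  have h1 : DifferentiableAt ℝ (fun z : E × E ↦ G z.1) z :=
    h.differentiableAt_metric.comp z differentiableAt_fst
  have h2 : DifferentiableAt ℝ (fun z : E × E ↦ I z.1) z := hI.comp z differentiableAt_fst
  have h3 : DifferentiableAt ℝ (fun z : E × E ↦ (Γ z.1).flip) z :=
    (ContinuousLinearMap.flipₗᵢ ℝ E E E).differentiableAt.comp z
      (hΓ.comp z differentiableAt_fst)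
  have h4 : DifferentiableAt ℝ (fun z : E × E ↦ (G z.1 z.2 z.2)⁻¹) z :=
    ((h1.clm_apply differentiableAt_snd).clm_apply differentiableAt_snd).inv (h.pos _ hz).ne'
  have h5 : DifferentiableAt ℝ (fun z : E × E ↦
      (G z.1 (I z.1 z.2)).comp (localConnector Γ z)) z :=
    (h1.clm_apply (h2.clm_apply differentiableAt_snd)).clm_comp
      ((differentiableAt_const _).add
        ((h3.clm_apply differentiableAt_snd).clm_comp (differentiableAt_const _)))
  exact h4.smul h5

/-- The derivative of `|v|²` only depends on the vertical part of a tangent vector. -/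
lemma IsLeviCivitaAt.exists_hasFDerivAt_normSq {z : E × E} (h : IsLeviCivitaAt G Γ z.1) :
    ∃ T : E × E →L[ℝ] ℝ, HasFDerivAt (fun z : E × E ↦ G z.1 z.2 z.2) T z ∧
      ∀ a, T a = 2 * G z.1 (localConnector Γ z a) z.2 := by
  have hG1 : HasFDerivAt (fun z : E × E ↦ G z.1) _ z :=
    HasFDerivAt.comp z h.differentiableAt_metric.hasFDerivAt (hasFDerivAt_fst (𝕜 := ℝ) (p := z))
  have hs : HasFDerivAt (fun z : E × E ↦ z.2) _ z := hasFDerivAt_snd (𝕜 := ℝ) (p := z)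
  have h1 : HasFDerivAt (fun z : E × E ↦ G z.1 z.2 z.2) _ z := (hG1.clm_apply hs).clm_apply hs
  refine ⟨_, h1, fun a ↦ ?_⟩
  simp [h.compat, localConnector_apply]
  rw [h.symm z.2 (Γ z.1 a.1 z.2), h.symm z.2 a.2]
  ring

/-- On a surface of curvature `-1`, the exterior derivative of the connection form is the pullback
of the area form. -/
theorem IsLeviCivitaAt.fderiv_localConnectionForm_sub {z : E × E} (h : IsLeviCivitaAt G Γ z.1)
    (hI : DifferentiableAt ℝ I z.1) (hΓ : DifferentiableAt ℝ Γ z.1)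
    (hrot : ∀ᶠ x in 𝓝 z.1, IsRotation (G x) (I x)) (hz : z.2 ≠ 0)
    (hcurv : ∀ ξ ζ v, G z.1 (I z.1 v) (localCurvature Γ z.1 ξ ζ v) =
      G z.1 v v * G z.1 (I z.1 ξ) ζ) (ξ ζ : E × E) :
    fderiv ℝ (localConnectionForm G Γ I) z ξ ζ - fderiv ℝ (localConnectionForm G Γ I) z ζ ξ =
      G z.1 (I z.1 ξ.1) ζ.1 := by
  obtain ⟨y, v⟩ := z
  simp only at h hI hΓ hrot hz hcurv ⊢
  have hr := hrot.self_of_nhds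
  have hpos := h.pos v hz
  have hG1 : HasFDerivAt (fun z : E × E ↦ G z.1) _ (y, v) :=
    HasFDerivAt.comp (y, v) h.differentiableAt_metric.hasFDerivAt
      (hasFDerivAt_fst (𝕜 := ℝ) (p := (y, v)))
  have hI1 : HasFDerivAt (fun z : E × E ↦ I z.1) _ (y, v) :=
    HasFDerivAt.comp (y, v) hI.hasFDerivAt (hasFDerivAt_fst (𝕜 := ℝ) (p := (y, v)))
  have hΓ1 : HasFDerivAt (fun z : E × E ↦ Γ z.1) _ (y, v) :=
    HasFDerivAt.comp (y, v) hΓ.hasFDerivAt (hasFDerivAt_fst (𝕜 := ℝ) (p := (y, v)))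
  have hs : HasFDerivAt (fun z : E × E ↦ z.2) _ (y, v) := hasFDerivAt_snd (𝕜 := ℝ) (p := (y, v))
  -- derivative of the function `z ↦ |v|² θ(b)` for a constant vector `b`
  have hβ : ∀ b : E × E, ∃ T : E × E →L[ℝ] ℝ,
      HasFDerivAt (fun z : E × E ↦ G z.1 (I z.1 z.2) (localConnector Γ z b)) T (y, v) ∧
      ∀ a, T a = G y (I y (localConnector Γ (y, v) a)) (localConnector Γ (y, v) b) +
        G y (I y v) (Γ y a.1 (localConnector Γ (y, v) b) + fderiv ℝ Γ y a.1 b.1 v +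
          Γ y b.1 a.2) := by
    intro b
    have h1 : HasFDerivAt (fun z : E × E ↦ G z.1 (I z.1 z.2) (localConnector Γ z b)) _ (y, v) :=
      (hG1.clm_apply (hI1.clm_apply hs)).clm_apply
        ((hasFDerivAt_const b.2 (y, v)).add
          ((hΓ1.clm_apply (hasFDerivAt_const b.1 (y, v))).clm_apply hs))
    refine ⟨_, h1, fun a ↦ ?_⟩
    simp [h.compat, h.fderiv_rotation hI hrot, localConnector_apply]
    ring
  obtain ⟨TE, hTE, hTE'⟩ :=
    IsLeviCivitaAt.exists_hasFDerivAt_normSq (z := (y, v)) h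
  have key : ∀ a b : E × E, fderiv ℝ (localConnectionForm G Γ I) (y, v) a b =
      (G y v v)⁻¹ * (G y (I y (localConnector Γ (y, v) a)) (localConnector Γ (y, v) b) +
        G y (I y v) (Γ y a.1 (localConnector Γ (y, v) b) + fderiv ℝ Γ y a.1 b.1 v +
          Γ y b.1 a.2)) -
      (G y v v ^ 2)⁻¹ * (2 * G y (localConnector Γ (y, v) a) v) *
        G y (I y v) (localConnector Γ (y, v) b) := by
    intro a b
    obtain ⟨T, hT, hT'⟩ := hβ b
    have h1 := (differentiableAt_localConnectionForm (z := (y, v)) h hI hΓ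
      hz).hasFDerivAt.clm_apply (hasFDerivAt_const b (y, v))
    have h2 : HasFDerivAt (fun z : E × E ↦ localConnectionForm G Γ I z b) _ (y, v) :=
      ((hasDerivAt_inv hpos.ne').comp_hasFDerivAt (y, v) hTE).mul hT
    have h4 := congrArg (fun T : E × E →L[ℝ] ℝ ↦ T a) (h1.unique h2)
    simp [hTE', hT'] at h4
    rw [h4]
    simp
    ring
  rw [key, key]
  set k := localConnector Γ (y, v) ξ with hk
  set l := localConnector Γ (y, v) ζ with hl
  have hRv := hcurv ξ.1 ζ.1 v
  have hkl : localCurvature Γ y ξ.1 ζ.1 v =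
      (Γ y ξ.1 l + fderiv ℝ Γ y ξ.1 ζ.1 v + Γ y ζ.1 ξ.2) -
        (Γ y ζ.1 k + fderiv ℝ Γ y ζ.1 ξ.1 v + Γ y ξ.1 ζ.2) := by
    rw [hk, hl, localConnector_apply, localConnector_apply, localCurvature]
    simp only [map_add]
    abel
  rw [hkl, map_sub] at hRv
  have hskew : G y (I y l) k = - G y (I y k) l := by
    rw [hr.skew l k, h.symm l (I y k)]
  -- expand `k` in the orthogonal basis `v`, `I v`
  have hplane : G y v v * G y (I y k) l = G y k v * G y (I y v) l - G y l v * G y (I y v) k := by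
    have e := hr.pythagoras v k (I y l)
    have e1 := hr.skew k l
    have e2 := hr.skew v l
    have e3 := hr.skew (I y v) l
    rw [hr.sq, map_neg, neg_apply] at e3
    have e4 : G y (I y v) (I y l) = G y v l := by linarith
    have e5 : G y v (I y l) = - G y (I y v) l := by linarith
    rw [e4, e5] at e
    rw [h.symm k v, h.symm l v, e1]
    linarith
  have hinv : (G y v v ^ 2)⁻¹ * G y v v = (G y v v)⁻¹ := by field_simp
  rw [hskew]
  have hfin : (G y v v)⁻¹ * (G y v v * G y (I y ξ.1) ζ.1) = G y (I y ξ.1) ζ.1 := by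
    field_simp
  rw [← hfin, ← hRv]
  have e6 : (G y v v)⁻¹ * (2 * G y (I y k) l) =
      (G y v v ^ 2)⁻¹ * (2 * (G y k v * G y (I y v) l - G y l v * G y (I y v) k)) := by
    rw [← hplane, ← hinv]; ring
  linear_combination e6

end LocalGeometry

/-! ### The Levi-Civita connection in charts -/

section ChartMetric

lemma clm_ext_single {n : ℕ} {F : Type*} [NormedAddCommGroup F] [NormedSpace ℝ F]
    {f g : EuclideanSpace ℝ (Fin n) →L[ℝ] F}
    (h : ∀ i, f (EuclideanSpace.single i 1) = g (EuclideanSpace.single i 1)) : f = g := by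
  have : (f : EuclideanSpace ℝ (Fin n) →ₗ[ℝ] F) = g :=
    (EuclideanSpace.basisFun (Fin n) ℝ).toBasis.ext fun i ↦ by simpa using h i
  exact ContinuousLinearMap.ext fun v ↦
    congrArg (fun T : EuclideanSpace ℝ (Fin n) →ₗ[ℝ] F ↦ T v) this

variable {n : ℕ} {M : Type*} [TopologicalSpace M] [ChartedSpace (EuclideanSpace ℝ (Fin n)) M]

section CoordChange

variable [IsManifold (𝓡 n) 1 M]

lemma tangentCoordChange_injective {x₀ x₁ z : M} (h₀ : z ∈ (extChartAt (𝓡 n) x₀).source)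
    (h₁ : z ∈ (extChartAt (𝓡 n) x₁).source) :
    Function.Injective (tangentCoordChange (𝓡 n) x₀ x₁ z) := by
  refine Function.LeftInverse.injective (g := tangentCoordChange (𝓡 n) x₁ x₀ z) fun u ↦ ?_
  rw [tangentCoordChange_comp ⟨⟨h₀, h₁⟩, h₀⟩, tangentCoordChange_self h₀]

lemma tangentCoordChange_surjective {x₀ x₁ z : M} (h₀ : z ∈ (extChartAt (𝓡 n) x₀).source)
    (h₁ : z ∈ (extChartAt (𝓡 n) x₁).source) :
    Function.Surjective (tangentCoordChange (𝓡 n) x₀ x₁ z) := fun u ↦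
  ⟨tangentCoordChange (𝓡 n) x₁ x₀ z u, by
    rw [tangentCoordChange_comp ⟨⟨h₁, h₀⟩, h₁⟩, tangentCoordChange_self h₁]⟩

end CoordChange

variable [RiemannianBundle (fun x : M ↦ TangentSpace (𝓡 n) x)]

/-- The scalar product of the tangent space at `x`, as a bilinear form on the model space. -/
def tangentMetric (x : M) :
    EuclideanSpace ℝ (Fin n) →L[ℝ] EuclideanSpace ℝ (Fin n) →L[ℝ] ℝ :=
  innerSL ℝ (E := TangentSpace (𝓡 n) x)

variable [IsManifold (𝓡 n) ∞ M]

/-- The Riemannian metric in the chart at `x₀`. -/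
def chartMetric (x₀ : M) (y : EuclideanSpace ℝ (Fin n)) :
    EuclideanSpace ℝ (Fin n) →L[ℝ] EuclideanSpace ℝ (Fin n) →L[ℝ] ℝ :=
  (tangentMetric ((extChartAt (𝓡 n) x₀).symm y)).bilinearComp
    (tangentCoordChange (𝓡 n) x₀ ((extChartAt (𝓡 n) x₀).symm y) ((extChartAt (𝓡 n) x₀).symm y))
    (tangentCoordChange (𝓡 n) x₀ ((extChartAt (𝓡 n) x₀).symm y) ((extChartAt (𝓡 n) x₀).symm y))

lemma metricMatrix_eq (x₀ : M) {y : EuclideanSpace ℝ (Fin n)}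
    (hy : y ∈ (extChartAt (𝓡 n) x₀).target) (i j : Fin n) :
    metricMatrix x₀ y i j =
      chartMetric x₀ y (EuclideanSpace.single i 1) (EuclideanSpace.single j 1) := by
  simp only [metricMatrix, Matrix.of_apply, coordVector]
  rw [mfderiv_extChartAt_symm_eq hy]
  rfl

/-- Change of coordinates for the Riemannian metric. -/
lemma chartMetric_comp {x₀ x₁ z : M} (h₀ : z ∈ (extChartAt (𝓡 n) x₀).source)
    (h₁ : z ∈ (extChartAt (𝓡 n) x₁).source) (u w : EuclideanSpace ℝ (Fin n)) :
    chartMetric x₁ (extChartAt (𝓡 n) x₁ z) (tangentCoordChange (𝓡 n) x₀ x₁ z u)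
        (tangentCoordChange (𝓡 n) x₀ x₁ z w) =
      chartMetric x₀ (extChartAt (𝓡 n) x₀ z) u w := by
  simp only [chartMetric, ContinuousLinearMap.bilinearComp_apply]
  rw [(extChartAt (𝓡 n) x₁).left_inv h₁, (extChartAt (𝓡 n) x₀).left_inv h₀,
    tangentCoordChange_comp ⟨⟨h₀, h₁⟩, mem_extChartAt_source z⟩,
    tangentCoordChange_comp ⟨⟨h₀, h₁⟩, mem_extChartAt_source z⟩]

lemma chartMetric_self (x : M) (u w : EuclideanSpace ℝ (Fin n)) :
    chartMetric x (extChartAt (𝓡 n) x x) u w = tangentMetric x u w := by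
  simp only [chartMetric, ContinuousLinearMap.bilinearComp_apply]
  rw [(extChartAt (𝓡 n) x).left_inv (mem_extChartAt_source x),
    tangentCoordChange_self (mem_extChartAt_source x),
    tangentCoordChange_self (mem_extChartAt_source x)]

lemma chartMetric_symm (x₀ : M) (y u w : EuclideanSpace ℝ (Fin n)) :
    chartMetric x₀ y u w = chartMetric x₀ y w u := by
  simp only [chartMetric, ContinuousLinearMap.bilinearComp_apply]
  exact real_inner_comm (F := TangentSpace (𝓡 n) ((extChartAt (𝓡 n) x₀).symm y)) _ _

lemma chartMetric_pos (x₀ : M) {y : EuclideanSpace ℝ (Fin n)}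
    (hy : y ∈ (extChartAt (𝓡 n) x₀).target) {u : EuclideanSpace ℝ (Fin n)} (hu : u ≠ 0) :
    0 < chartMetric x₀ y u u := by
  simp only [chartMetric, ContinuousLinearMap.bilinearComp_apply]
  refine real_inner_self_pos (F := TangentSpace (𝓡 n) ((extChartAt (𝓡 n) x₀).symm y)).2 ?_
  intro h
  exact hu (tangentCoordChange_injective ((extChartAt (𝓡 n) x₀).map_target hy)
    (mem_extChartAt_source _) (h.trans (map_zero _).symm))

section Smooth

variable [IsContMDiffRiemannianBundle (𝓡 n) ∞ (EuclideanSpace ℝ (Fin n))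
      (fun x : M ↦ TangentSpace (𝓡 n) x)]

lemma contDiffOn_chartMetric (x₀ : M) :
    ContDiffOn ℝ ∞ (chartMetric x₀) (extChartAt (𝓡 n) x₀).target := by
  have hsm : ∀ u : EuclideanSpace ℝ (Fin n), ContMDiffOn (𝓡 n) (𝓡 n).tangent ∞
      (fun y ↦ (⟨(extChartAt (𝓡 n) x₀).symm y, tangentCoordChange (𝓡 n) x₀
        ((extChartAt (𝓡 n) x₀).symm y) ((extChartAt (𝓡 n) x₀).symm y) u⟩ :
          TangentBundle (𝓡 n) M)) (extChartAt (𝓡 n) x₀).target := by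
    intro u
    have h1 := (trivializationAt (EuclideanSpace ℝ (Fin n))
      (TangentSpace (𝓡 n) : M → Type) x₀).contMDiffOn_symm (IB := 𝓡 n) (n := ∞)
    have h2 : ContMDiffOn (𝓡 n) ((𝓡 n).prod 𝓘(ℝ, EuclideanSpace ℝ (Fin n))) ∞
        (fun y ↦ ((extChartAt (𝓡 n) x₀).symm y, u)) (extChartAt (𝓡 n) x₀).target :=
      (contMDiffOn_extChartAt_symm x₀).prodMk contMDiffOn_const
    have h3 : Set.MapsTo (fun y ↦ ((extChartAt (𝓡 n) x₀).symm y, u))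
        (extChartAt (𝓡 n) x₀).target (trivializationAt (EuclideanSpace ℝ (Fin n))
      (TangentSpace (𝓡 n) : M → Type) x₀).target := fun y hy ↦ by
      rw [TangentBundle.trivializationAt_target]
      exact ⟨by rw [← extChartAt_source (𝓡 n)]; exact (extChartAt (𝓡 n) x₀).map_target hy, trivial⟩
    refine (h1.comp h2 h3).congr fun y hy ↦ ?_
    rfl
  refine contDiffOn_clm_apply.2 fun u ↦ contDiffOn_clm_apply.2 fun w ↦ ?_
  rw [← contMDiffOn_iff_contDiffOn]
  exact (hsm u).inner_bundle (hsm w)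

end Smooth

end ChartMetric

section ChartChristoffel

lemma sum_smul_single {n : ℕ} (u : EuclideanSpace ℝ (Fin n)) :
    ∑ i, u i • EuclideanSpace.single i (1 : ℝ) = u := by
  simpa using (EuclideanSpace.basisFun (Fin n) ℝ).sum_repr u

variable {n : ℕ} {M : Type*} [TopologicalSpace M] [ChartedSpace (EuclideanSpace ℝ (Fin n)) M]
  [RiemannianBundle (fun x : M ↦ TangentSpace (𝓡 n) x)]

/-- The Christoffel symbols in the chart at `x₀`, as a bilinear map. -/
def chartChristoffel (x₀ : M) (y : EuclideanSpace ℝ (Fin n)) :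
    EuclideanSpace ℝ (Fin n) →L[ℝ] EuclideanSpace ℝ (Fin n) →L[ℝ] EuclideanSpace ℝ (Fin n) :=
  ∑ k, ∑ i, ∑ j, christoffel x₀ k i j y •
    (EuclideanSpace.proj i : EuclideanSpace ℝ (Fin n) →L[ℝ] ℝ).smulRight
      ((EuclideanSpace.proj j : EuclideanSpace ℝ (Fin n) →L[ℝ] ℝ).smulRight
        (EuclideanSpace.single k (1 : ℝ)))

lemma chartChristoffel_apply (x₀ : M) (y u w : EuclideanSpace ℝ (Fin n)) (k : Fin n) :
    chartChristoffel x₀ y u w k = ∑ i, ∑ j, christoffel x₀ k i j y * u i * w j := by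
  simp [chartChristoffel, Finset.sum_apply, mul_assoc]
  rw [Finset.sum_eq_single k]
  · simp
  · intro b _ hb
    simp [hb.symm]
  · simp

lemma chartChristoffel_single (x₀ : M) (y : EuclideanSpace ℝ (Fin n)) (i j k : Fin n) :
    chartChristoffel x₀ y (EuclideanSpace.single i 1) (EuclideanSpace.single j 1) k =
      christoffel x₀ k i j y := by
  rw [chartChristoffel_apply]
  simp

lemma chartChristoffel_self (x : M) (u w : EuclideanSpace ℝ (Fin n)) :
    chartChristoffel x (extChartAt (𝓡 n) x x) u w = christoffelVector x u w := by
  ext k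
  rw [chartChristoffel_apply]
  rfl

variable [IsManifold (𝓡 n) ∞ M]

lemma det_metricMatrix_ne_zero (x₀ : M) {y : EuclideanSpace ℝ (Fin n)}
    (hy : y ∈ (extChartAt (𝓡 n) x₀).target) : (metricMatrix x₀ y).det ≠ 0 := by
  intro h
  obtain ⟨v, hv, hv0⟩ := Matrix.exists_mulVec_eq_zero_iff.2 h
  let u : EuclideanSpace ℝ (Fin n) := WithLp.toLp 2 v
  have hu : u ≠ 0 := fun h0 ↦ hv (by ext i; exact congrArg (fun a ↦ a i) h0)
  refine (chartMetric_pos x₀ hy hu).ne' ?_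
  have h1 : ∀ i, chartMetric x₀ y (EuclideanSpace.single i 1) u = 0 := by
    intro i
    have h2 := congrFun hv0 i
    rw [Matrix.mulVec, dotProduct] at h2
    rw [← sum_smul_single u, map_sum]
    refine Eq.trans (Finset.sum_congr rfl fun j _ ↦ ?_) h2
    rw [map_smul, metricMatrix_eq x₀ hy, smul_eq_mul, mul_comm]
  have h2 := congrArg (fun a ↦ chartMetric x₀ y a u) (sum_smul_single u)
  simp only [map_sum, sum_apply, map_smul, smul_apply, h1, smul_zero, Finset.sum_const_zero] at h2
  exact h2.symm

variable [IsContMDiffRiemannianBundle (𝓡 n) ∞ (EuclideanSpace ℝ (Fin n))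
      (fun x : M ↦ TangentSpace (𝓡 n) x)]

lemma contDiffOn_metricMatrix (x₀ : M) (i j : Fin n) :
    ContDiffOn ℝ ∞ (fun y ↦ metricMatrix x₀ y i j) (extChartAt (𝓡 n) x₀).target :=
  (contDiffOn_clm_apply.1 (contDiffOn_clm_apply.1 (contDiffOn_chartMetric x₀) _) _).congr
    fun _ hy ↦ metricMatrix_eq x₀ hy i j

lemma partialDeriv_metricMatrix (x₀ : M) {y : EuclideanSpace ℝ (Fin n)}
    (hy : y ∈ (extChartAt (𝓡 n) x₀).target) (i j l : Fin n) :
    partialDeriv l (fun z ↦ metricMatrix x₀ z i j) y =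
      fderiv ℝ (chartMetric x₀) y (EuclideanSpace.single l 1) (EuclideanSpace.single i 1)
        (EuclideanSpace.single j 1) := by
  have hn := (isOpen_extChartAt_target (I := 𝓡 n) x₀).mem_nhds hy
  have hd : DifferentiableAt ℝ (chartMetric x₀) y :=
    ((contDiffOn_chartMetric x₀).contDiffAt hn).differentiableAt (by simp)
  have h1 := (hd.hasFDerivAt.clm_apply (hasFDerivAt_const (EuclideanSpace.single i 1) y)).clm_apply
    (hasFDerivAt_const (EuclideanSpace.single j 1) y)
  have h2 := h1.congr_of_eventuallyEq (f₁ := fun z ↦ metricMatrix x₀ z i j)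
    (Filter.mem_of_superset hn fun z hz ↦ metricMatrix_eq x₀ hz i j)
  rw [partialDeriv, h2.fderiv]
  simp

lemma fderiv_chartMetric_symm (x₀ : M) {y : EuclideanSpace ℝ (Fin n)}
    (hy : y ∈ (extChartAt (𝓡 n) x₀).target) (z u w : EuclideanSpace ℝ (Fin n)) :
    fderiv ℝ (chartMetric x₀) y z u w = fderiv ℝ (chartMetric x₀) y z w u := by
  have hn := (isOpen_extChartAt_target (I := 𝓡 n) x₀).mem_nhds hy
  have hd : DifferentiableAt ℝ (chartMetric x₀) y :=
    ((contDiffOn_chartMetric x₀).contDiffAt hn).differentiableAt (by simp)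
  have h1 := (hd.hasFDerivAt.clm_apply (hasFDerivAt_const u y)).clm_apply (hasFDerivAt_const w y)
  have h2 := (hd.hasFDerivAt.clm_apply (hasFDerivAt_const w y)).clm_apply (hasFDerivAt_const u y)
  have h3 := h2.congr_of_eventuallyEq (f₁ := fun z ↦ chartMetric x₀ z u w)
    (Filter.Eventually.of_forall fun z ↦ chartMetric_symm x₀ z u w)
  simpa using congrArg (fun T : EuclideanSpace ℝ (Fin n) →L[ℝ] ℝ ↦ T z) (h1.unique h3)

/-- The Koszul formula. -/
lemma chartMetric_chartChristoffel (x₀ : M) {y : EuclideanSpace ℝ (Fin n)}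
    (hy : y ∈ (extChartAt (𝓡 n) x₀).target) (z u w : EuclideanSpace ℝ (Fin n)) :
    chartMetric x₀ y (chartChristoffel x₀ y z u) w =
      (1 / 2) * (fderiv ℝ (chartMetric x₀) y z u w + fderiv ℝ (chartMetric x₀) y u z w -
        fderiv ℝ (chartMetric x₀) y w z u) := by
  set G := chartMetric x₀ y with hG
  set D := fderiv ℝ (chartMetric x₀) y with hD
  set Γ := chartChristoffel x₀ y with hΓ
  have h0 : ∀ i j l : Fin n, G (Γ (EuclideanSpace.single i 1) (EuclideanSpace.single j 1))
      (EuclideanSpace.single l 1) = (1 / 2) * (D (EuclideanSpace.single i 1)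
        (EuclideanSpace.single j 1) (EuclideanSpace.single l 1) + D (EuclideanSpace.single j 1)
        (EuclideanSpace.single i 1) (EuclideanSpace.single l 1) - D (EuclideanSpace.single l 1)
        (EuclideanSpace.single i 1) (EuclideanSpace.single j 1)) := by
    intro i j l
    set v : Fin n → ℝ := fun l ↦ D (EuclideanSpace.single i 1)
        (EuclideanSpace.single j 1) (EuclideanSpace.single l 1) + D (EuclideanSpace.single j 1)
        (EuclideanSpace.single i 1) (EuclideanSpace.single l 1) - D (EuclideanSpace.single l 1)
        (EuclideanSpace.single i 1) (EuclideanSpace.single j 1) with hv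
    have hc : ∀ k, Γ (EuclideanSpace.single i 1) (EuclideanSpace.single j 1) k =
        (1 / 2) * ((metricMatrix x₀ y)⁻¹.mulVec v) k := by
      intro k
      rw [hΓ, chartChristoffel_single, christoffel, Matrix.mulVec, dotProduct]
      refine congrArg _ (Finset.sum_congr rfl fun m _ ↦ ?_)
      simp only [partialDeriv_metricMatrix x₀ hy, hv, hD]
    rw [← sum_smul_single (Γ (EuclideanSpace.single i 1) (EuclideanSpace.single j 1)), map_sum,
      sum_apply]
    have hs : ∀ k, G (Γ (EuclideanSpace.single i 1) (EuclideanSpace.single j 1) k •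
        EuclideanSpace.single k (1 : ℝ)) (EuclideanSpace.single l 1) =
        (1 / 2) * (metricMatrix x₀ y l k * ((metricMatrix x₀ y)⁻¹.mulVec v) k) := by
      intro k
      rw [map_smul, smul_apply, hc, hG, chartMetric_symm, ← metricMatrix_eq x₀ hy, smul_eq_mul]
      ring
    rw [Finset.sum_congr rfl fun k _ ↦ hs k, ← Finset.mul_sum]
    have h2 : (metricMatrix x₀ y).mulVec ((metricMatrix x₀ y)⁻¹.mulVec v) l = v l := by
      rw [Matrix.mulVec_mulVec, Matrix.mul_nonsing_inv _
        (isUnit_iff_ne_zero.2 (det_metricMatrix_ne_zero x₀ hy)), Matrix.one_mulVec]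
    rw [Matrix.mulVec, dotProduct] at h2
    rw [h2]
  have h1 : ∀ (i j : Fin n) (w : EuclideanSpace ℝ (Fin n)),
      G (Γ (EuclideanSpace.single i 1) (EuclideanSpace.single j 1)) w =
      (1 / 2) * (D (EuclideanSpace.single i 1) (EuclideanSpace.single j 1) w +
        D (EuclideanSpace.single j 1) (EuclideanSpace.single i 1) w -
        D w (EuclideanSpace.single i 1) (EuclideanSpace.single j 1)) := by
    intro i j w
    have : G (Γ (EuclideanSpace.single i 1) (EuclideanSpace.single j 1)) =
      (1 / 2 : ℝ) • (D (EuclideanSpace.single i 1) (EuclideanSpace.single j 1) +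
        D (EuclideanSpace.single j 1) (EuclideanSpace.single i 1) -
        (D.flip (EuclideanSpace.single i 1)).flip (EuclideanSpace.single j 1)) :=
      clm_ext_single fun l ↦ by simpa using h0 i j l
    simpa using congrArg (fun T : EuclideanSpace ℝ (Fin n) →L[ℝ] ℝ ↦ T w) this
  have h2 : ∀ (i : Fin n) (u w : EuclideanSpace ℝ (Fin n)),
      G (Γ (EuclideanSpace.single i 1) u) w =
      (1 / 2) * (D (EuclideanSpace.single i 1) u w + D u (EuclideanSpace.single i 1) w -
        D w (EuclideanSpace.single i 1) u) := by
    intro i u w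
    have : (G.flip w).comp (Γ (EuclideanSpace.single i 1)) =
      (1 / 2 : ℝ) • ((D (EuclideanSpace.single i 1)).flip w +
        (D.flip (EuclideanSpace.single i 1)).flip w - D w (EuclideanSpace.single i 1)) :=
      clm_ext_single fun j ↦ by simpa using h1 i j w
    simpa using congrArg (fun T : EuclideanSpace ℝ (Fin n) →L[ℝ] ℝ ↦ T u) this
  have : (G.flip w).comp (Γ.flip u) =
      (1 / 2 : ℝ) • ((D.flip u).flip w + (D u).flip w - (D w).flip u) :=
    clm_ext_single fun i ↦ by simpa using h2 i u w
  simpa using congrArg (fun T : EuclideanSpace ℝ (Fin n) →L[ℝ] ℝ ↦ T z) this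

/-- The connection given by the Christoffel symbols is torsion free and metric. -/
theorem isLeviCivitaAt_chart (x₀ : M) {y : EuclideanSpace ℝ (Fin n)}
    (hy : y ∈ (extChartAt (𝓡 n) x₀).target) :
    IsLeviCivitaAt (chartMetric x₀) (chartChristoffel x₀) y where
  differentiableAt_metric := ((contDiffOn_chartMetric x₀).contDiffAt
    ((isOpen_extChartAt_target (I := 𝓡 n) x₀).mem_nhds hy)).differentiableAt (by simp)
  symm := chartMetric_symm x₀ y
  pos _ hu := chartMetric_pos x₀ hy hu
  torsion u w := by
    by_contra h
    refine (chartMetric_pos x₀ hy (sub_ne_zero.2 h)).ne' ?_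
    rw [map_sub (chartMetric x₀ y), sub_apply, chartMetric_chartChristoffel x₀ hy,
      chartMetric_chartChristoffel x₀ hy]
    rw [fderiv_chartMetric_symm x₀ hy _ u w]
    ring
  compat z u w := by
    rw [chartMetric_symm x₀ y u, chartMetric_chartChristoffel x₀ hy,
      chartMetric_chartChristoffel x₀ hy, fderiv_chartMetric_symm x₀ hy z w u]
    ring

lemma contDiffOn_chartChristoffel (x₀ : M) :
    ContDiffOn ℝ ∞ (chartChristoffel x₀) (extChartAt (𝓡 n) x₀).target := by
  have hopen := isOpen_extChartAt_target (I := 𝓡 n) x₀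
  have hpd : ∀ i j l : Fin n, ContDiffOn ℝ ∞
      (partialDeriv i (fun z ↦ metricMatrix x₀ z j l)) (extChartAt (𝓡 n) x₀).target :=
    fun i j l ↦ ((contDiffOn_metricMatrix x₀ j l).fderiv_of_isOpen hopen (by simp)).clm_apply
      contDiffOn_const
  have hdet : ∀ A : EuclideanSpace ℝ (Fin n) → Matrix (Fin n) (Fin n) ℝ,
      (∀ i j, ContDiffOn ℝ ∞ (fun y ↦ A y i j) (extChartAt (𝓡 n) x₀).target) →
      ContDiffOn ℝ ∞ (fun y ↦ (A y).det) (extChartAt (𝓡 n) x₀).target := by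
    intro A hA
    simp only [Matrix.det_apply']
    exact ContDiffOn.sum fun σ _ ↦ contDiffOn_const.mul (contDiffOn_prod fun i _ ↦ hA _ _)
  have hinv : ∀ k l : Fin n, ContDiffOn ℝ ∞ (fun y ↦ (metricMatrix x₀ y)⁻¹ k l)
      (extChartAt (𝓡 n) x₀).target := by
    intro k l
    simp only [Matrix.inv_def, Matrix.smul_apply, Ring.inverse_eq_inv', smul_eq_mul,
      Matrix.adjugate_apply]
    refine ((hdet _ (contDiffOn_metricMatrix x₀)).inv fun y hy ↦
      det_metricMatrix_ne_zero x₀ hy).mul (hdet _ fun i j ↦ ?_)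
    simp only [Matrix.updateRow_apply]
    split_ifs
    · exact contDiffOn_const
    · exact contDiffOn_metricMatrix x₀ i j
  have hchr : ∀ k i j : Fin n, ContDiffOn ℝ ∞ (christoffel x₀ k i j)
      (extChartAt (𝓡 n) x₀).target := fun k i j ↦
    contDiffOn_const.mul (ContDiffOn.sum fun l _ ↦
      (hinv k l).mul (((hpd i j l).add (hpd j i l)).sub (hpd l i j)))
  exact ContDiffOn.sum fun k _ ↦ ContDiffOn.sum fun i _ ↦ ContDiffOn.sum fun j _ ↦
    (hchr k i j).smul contDiffOn_const

end ChartChristoffel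

/-! ### Area form and complex structure in charts -/

/-- A right angle rotation, expanded in an arbitrary basis `a`, `b`. -/
lemma IsRotation.smul_apply {E : Type*} [NormedAddCommGroup E] [NormedSpace ℝ E]
    {G : E →L[ℝ] E →L[ℝ] ℝ} {I : E →L[ℝ] E} (h : IsRotation G I)
    (hsymm : ∀ u w, G u w = G w u) (hpos : ∀ u, u ≠ 0 → 0 < G u u) (a b u : E) :
    G (I a) b • I u = -(G u b • a) + G u a • b := by
  -- the Cauchy-Binet identity for the area form `G (I ·) ·`
  have key : ∀ w, G (I a) b * G (I u) w = G a u * G b w - G a w * G b u := by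
    intro w
    by_cases ha : a = 0
    · simp [ha]
    have hisom : ∀ c, G (I a) (I c) = G a c := fun c ↦ by
      rw [h.skew, h.sq, map_neg, neg_neg]
    have h1 := h.pythagoras a (I u) w
    have h2 := h.pythagoras a b w
    have h3 := h.pythagoras a b u
    have h4 := h.skew a u
    rw [hisom] at h1
    refine mul_left_cancel₀ (hpos a ha).ne' ?_
    linear_combination (-G (I a) b) * h1 + G a u * h2 - G a w * h3 +
      G (I a) b * G a w * h4
  have hzero : ∀ w, G (G (I a) b • I u - (-(G u b • a) + G u a • b)) w = 0 := by
    intro w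
    have h1 := key w
    simp only [map_sub, map_add, map_neg, map_smul, sub_apply, add_apply, neg_apply,
      FunLike.coe_smul, Pi.smul_apply, smul_eq_mul]
    rw [hsymm u a, hsymm u b]
    linarith
  by_contra hne
  exact (hpos _ (sub_ne_zero.2 hne)).ne' (hzero _)

section Plane

variable {V : Type*} [NormedAddCommGroup V] [InnerProductSpace ℝ V]
  [Fact (Module.finrank ℝ V = 2)] (o : Orientation ℝ V (Fin 2))

lemma areaForm_basis_pos_iff (b : Module.Basis (Fin 2) ℝ V) :
    0 < o.areaForm (b 0) (b 1) ↔ b.orientation = o := by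
  let e := o.finOrthonormalBasis (n := 2) (by norm_num) Fact.out
  have he : e.toBasis.orientation = o :=
    o.finOrthonormalBasis_orientation (by norm_num) Fact.out
  have h1 : o.areaForm (b 0) (b 1) = e.toBasis.det b := by
    rw [o.areaForm_to_volumeForm, o.volumeForm_robust e he]
    congr 1
    ext i
    fin_cases i <;> rfl
  rw [h1, ← Module.Basis.orientation_eq_iff_det_pos, he, eq_comm]

end Plane

section ChartRotation

variable {M : Type*} [TopologicalSpace M] [ChartedSpace (EuclideanSpace ℝ (Fin 2)) M]
  [RiemannianBundle (fun x : M ↦ TangentSpace (𝓡 2) x)]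
  (o : ∀ x : M, Orientation ℝ (TangentSpace (𝓡 2) x) (Fin 2))

/-- The complex structure of the tangent space at `x`, as a linear map of the model space. -/
def tangentRotation (x : M) : EuclideanSpace ℝ (Fin 2) →L[ℝ] EuclideanSpace ℝ (Fin 2) :=
  ((o x).rightAngleRotation.toContinuousLinearEquiv :
    TangentSpace (𝓡 2) x →L[ℝ] TangentSpace (𝓡 2) x)

lemma isRotation_tangentRotation (x : M) :
    IsRotation (tangentMetric x) (tangentRotation o x) where
  skew u w := (o x).inner_rightAngleRotation_swap' u w
  sq u := (o x).rightAngleRotation_rightAngleRotation u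
  pythagoras a u w := by
    have h : ∀ a u w : TangentSpace (𝓡 2) x,
        inner ℝ a u * inner ℝ a w + inner ℝ ((o x).rightAngleRotation a) u *
          inner ℝ ((o x).rightAngleRotation a) w = inner ℝ a a * inner ℝ u w := fun a u w ↦ by
      rw [(o x).inner_rightAngleRotation_left, (o x).inner_rightAngleRotation_left,
        real_inner_self_eq_norm_sq]
      exact (o x).inner_mul_inner_add_areaForm_mul_areaForm a u w
    exact h a u w

variable [IsManifold (𝓡 2) ∞ M]

/-- The complex structure in the chart at `x₀`. -/
def chartRotation (x₀ : M) (y : EuclideanSpace ℝ (Fin 2)) :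
    EuclideanSpace ℝ (Fin 2) →L[ℝ] EuclideanSpace ℝ (Fin 2) :=
  ((tangentCoordChange (𝓡 2) ((extChartAt (𝓡 2) x₀).symm y) x₀
    ((extChartAt (𝓡 2) x₀).symm y)).comp (tangentRotation o ((extChartAt (𝓡 2) x₀).symm y))).comp
    (tangentCoordChange (𝓡 2) x₀ ((extChartAt (𝓡 2) x₀).symm y) ((extChartAt (𝓡 2) x₀).symm y))

variable {o}

lemma tangentCoordChange_chartRotation (x₀ : M) {y : EuclideanSpace ℝ (Fin 2)}
    (hy : y ∈ (extChartAt (𝓡 2) x₀).target) (u : EuclideanSpace ℝ (Fin 2)) :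
    tangentCoordChange (𝓡 2) x₀ ((extChartAt (𝓡 2) x₀).symm y) ((extChartAt (𝓡 2) x₀).symm y)
      (chartRotation o x₀ y u) = tangentRotation o ((extChartAt (𝓡 2) x₀).symm y)
        (tangentCoordChange (𝓡 2) x₀ ((extChartAt (𝓡 2) x₀).symm y)
          ((extChartAt (𝓡 2) x₀).symm y) u) := by
  have h1 : (extChartAt (𝓡 2) x₀).symm y ∈ (extChartAt (𝓡 2) x₀).source :=
    (extChartAt (𝓡 2) x₀).map_target hy
  have h2 := mem_extChartAt_source (I := 𝓡 2) ((extChartAt (𝓡 2) x₀).symm y)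
  refine (tangentCoordChange_comp ⟨⟨h2, h1⟩, h2⟩).trans ?_
  exact tangentCoordChange_self h2

lemma isRotation_chartRotation (x₀ : M) {y : EuclideanSpace ℝ (Fin 2)}
    (hy : y ∈ (extChartAt (𝓡 2) x₀).target) :
    IsRotation (chartMetric x₀ y) (chartRotation o x₀ y) := by
  have hr := isRotation_tangentRotation o ((extChartAt (𝓡 2) x₀).symm y)
  refine ⟨fun u w ↦ ?_, fun u ↦ ?_, fun a u w ↦ ?_⟩
  · simp only [chartMetric, ContinuousLinearMap.bilinearComp_apply,
      tangentCoordChange_chartRotation x₀ hy]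
    exact hr.skew _ _
  · refine tangentCoordChange_injective ((extChartAt (𝓡 2) x₀).map_target hy)
      (mem_extChartAt_source _) ?_
    rw [tangentCoordChange_chartRotation x₀ hy, tangentCoordChange_chartRotation x₀ hy, hr.sq,
      map_neg]
  · simp only [chartMetric, ContinuousLinearMap.bilinearComp_apply,
      tangentCoordChange_chartRotation x₀ hy]
    exact hr.pythagoras _ _ _

/-- Change of coordinates for the complex structure. -/
lemma chartRotation_comp {x₀ x₁ z : M} (h₀ : z ∈ (extChartAt (𝓡 2) x₀).source)
    (h₁ : z ∈ (extChartAt (𝓡 2) x₁).source) (u : EuclideanSpace ℝ (Fin 2)) :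
    chartRotation o x₁ (extChartAt (𝓡 2) x₁ z) (tangentCoordChange (𝓡 2) x₀ x₁ z u) =
      tangentCoordChange (𝓡 2) x₀ x₁ z (chartRotation o x₀ (extChartAt (𝓡 2) x₀ z) u) := by
  have hz := mem_extChartAt_source (I := 𝓡 2) z
  simp only [chartRotation, ContinuousLinearMap.comp_apply]
  rw [(extChartAt (𝓡 2) x₁).left_inv h₁, (extChartAt (𝓡 2) x₀).left_inv h₀,
    tangentCoordChange_comp ⟨⟨h₀, h₁⟩, hz⟩, tangentCoordChange_comp ⟨⟨hz, h₀⟩, h₁⟩]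

lemma chartRotation_self (x : M) (u : EuclideanSpace ℝ (Fin 2)) :
    chartRotation o x (extChartAt (𝓡 2) x x) u = tangentRotation o x u := by
  simp only [chartRotation, ContinuousLinearMap.comp_apply]
  rw [(extChartAt (𝓡 2) x).left_inv (mem_extChartAt_source x),
    tangentCoordChange_self (mem_extChartAt_source x),
    tangentCoordChange_self (mem_extChartAt_source x)]

/-- The square root of the determinant of the metric. -/
def chartVolume (x₀ : M) (y : EuclideanSpace ℝ (Fin 2)) : ℝ :=
  √((metricMatrix x₀ y).det)

lemma chartMetric_chartRotation_sq (x₀ : M) {y : EuclideanSpace ℝ (Fin 2)}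
    (hy : y ∈ (extChartAt (𝓡 2) x₀).target) :
    chartMetric x₀ y (chartRotation o x₀ y (EuclideanSpace.single 0 1))
      (EuclideanSpace.single 1 1) ^ 2 = (metricMatrix x₀ y).det := by
  have h := (isRotation_chartRotation (o := o) x₀ hy).pythagoras (EuclideanSpace.single 0 1)
    (EuclideanSpace.single 1 1) (EuclideanSpace.single 1 1)
  rw [Matrix.det_fin_two]
  simp only [metricMatrix_eq x₀ hy]
  rw [chartMetric_symm x₀ y (EuclideanSpace.single 1 1) (EuclideanSpace.single 0 1)]
  linarith

/-- In a chart, the area form has locally constant sign on the coordinate vector fields. -/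
lemma exists_sign_chartMetric_chartRotation (ho : IsOrientationOfSurface o) (x₀ : M) :
    ∃ ε : ℝ, ∀ᶠ y in 𝓝 (extChartAt (𝓡 2) x₀ x₀),
      chartMetric x₀ y (chartRotation o x₀ y (EuclideanSpace.single 0 1))
        (EuclideanSpace.single 1 1) = ε * chartVolume x₀ y := by
  classical
  obtain ⟨o₀, ho₀⟩ := ho x₀
  set std := (EuclideanSpace.basisFun (Fin 2) ℝ).toBasis with hstd
  -- the sign tells whether the coordinate basis is positively oriented
  refine ⟨if std.orientation = o₀ then 1 else -1, ?_⟩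
  have h1 : ∀ᶠ y in 𝓝 (extChartAt (𝓡 2) x₀ x₀), y ∈ (extChartAt (𝓡 2) x₀).target :=
    (isOpen_extChartAt_target x₀).mem_nhds (mem_extChartAt_target (I := 𝓡 2) x₀)
  have h2 := (continuousAt_extChartAt_symm (I := 𝓡 2) x₀).eventually
    (by rw [(extChartAt (𝓡 2) x₀).left_inv (mem_extChartAt_source x₀)]; exact ho₀)
  filter_upwards [h1, h2] with y hy h2
  set z := (extChartAt (𝓡 2) x₀).symm y with hz
  have hzs : z ∈ (chartAt (EuclideanSpace ℝ (Fin 2)) x₀).source := by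
    rw [← extChartAt_source (𝓡 2)]
    exact (extChartAt (𝓡 2) x₀).map_target hy
  have hzo := h2 hzs
  set f := ((trivializationAt (EuclideanSpace ℝ (Fin 2))
          (TangentSpace (𝓡 2) : M → Type) x₀).continuousLinearEquivAt ℝ z hzs).toLinearEquiv
    with hf
  let b : Module.Basis (Fin 2) ℝ (TangentSpace (𝓡 2) z) := std.map f.symm
  have hb : ∀ i, b i = tangentCoordChange (𝓡 2) x₀ z z (EuclideanSpace.single i 1) := by
    intro i
    have e1 : b i = f.symm (EuclideanSpace.single i 1) := by
      simp [b, hstd]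
    rw [e1]
    have hz' := mem_extChartAt_source (I := 𝓡 2) z
    have hz₀ : z ∈ (extChartAt (𝓡 2) x₀).source := by rwa [extChartAt_source]
    have e2 : tangentCoordChange (𝓡 2) z x₀ z (tangentCoordChange (𝓡 2) x₀ z z
        (EuclideanSpace.single i 1)) = EuclideanSpace.single i 1 := by
      rw [tangentCoordChange_comp ⟨⟨hz₀, hz'⟩, hz₀⟩, tangentCoordChange_self hz₀]
    exact (LinearEquiv.symm_apply_eq f (y := (tangentCoordChange (𝓡 2) x₀ z z
      (EuclideanSpace.single i 1) : TangentSpace (𝓡 2) z))).2 e2.symm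
  have hω : chartMetric x₀ y (chartRotation o x₀ y (EuclideanSpace.single 0 1))
        (EuclideanSpace.single 1 1) = (o z).areaForm (b 0) (b 1) := by
    rw [← (o z).inner_rightAngleRotation_left, hb, hb]
    simp only [chartMetric, ContinuousLinearMap.bilinearComp_apply,
      tangentCoordChange_chartRotation x₀ hy]
    rfl
  have hbo : b.orientation = o z ↔ std.orientation = o₀ := by
    have e1 : Orientation.map (Fin 2) f b.orientation = std.orientation := by
      rw [← Module.Basis.orientation_map]
      congr 1
      ext i : 1
      simp [b]
    rw [← e1, ← hzo]
    exact (Orientation.map (Fin 2) f).injective.eq_iff.symm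
  have hsq := chartMetric_chartRotation_sq (o := o) x₀ hy
  have hpos := areaForm_basis_pos_iff (o z) b
  rw [← hω, hbo] at hpos
  rw [chartVolume, ← hsq, Real.sqrt_sq_eq_abs]
  split_ifs with h
  · rw [abs_of_pos (hpos.2 h), one_mul]
  · rw [abs_of_nonpos (not_lt.1 fun h' ↦ h (hpos.1 h'))]
    ring

variable [IsContMDiffRiemannianBundle (𝓡 2) ∞ (EuclideanSpace ℝ (Fin 2))
      (fun x : M ↦ TangentSpace (𝓡 2) x)]

lemma contDiffAt_chartRotation (ho : IsOrientationOfSurface o) (x₀ : M) :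
    ContDiffAt ℝ ∞ (chartRotation o x₀) (extChartAt (𝓡 2) x₀ x₀) := by
  obtain ⟨ε, hε⟩ := exists_sign_chartMetric_chartRotation ho x₀
  have htarget : (extChartAt (𝓡 2) x₀).target ∈ 𝓝 (extChartAt (𝓡 2) x₀ x₀) :=
    (isOpen_extChartAt_target x₀).mem_nhds (mem_extChartAt_target (I := 𝓡 2) x₀)
  have hm : ∀ i j, ContDiffAt ℝ ∞ (fun y ↦ metricMatrix x₀ y i j) (extChartAt (𝓡 2) x₀ x₀) :=
    fun i j ↦ (contDiffOn_metricMatrix x₀ i j).contDiffAt htarget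
  have hG : ContDiffAt ℝ ∞ (chartMetric x₀) (extChartAt (𝓡 2) x₀ x₀) :=
    (contDiffOn_chartMetric x₀).contDiffAt htarget
  have hvol : ContDiffAt ℝ ∞ (chartVolume x₀) (extChartAt (𝓡 2) x₀ x₀) := by
    refine ContDiffAt.sqrt ?_ (det_metricMatrix_ne_zero x₀ (mem_of_mem_nhds htarget))
    simp only [Matrix.det_fin_two]
    exact ((hm 0 0).mul (hm 1 1)).sub ((hm 0 1).mul (hm 1 0))
  have hω0 : ∀ {y}, y ∈ (extChartAt (𝓡 2) x₀).target →
      chartMetric x₀ y (chartRotation o x₀ y (EuclideanSpace.single 0 1))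
        (EuclideanSpace.single 1 1) ≠ 0 := fun {y} hy h ↦ by
    have := chartMetric_chartRotation_sq (o := o) x₀ hy
    rw [h] at this
    exact det_metricMatrix_ne_zero x₀ hy (by rw [← this]; norm_num)
  -- the rotation in terms of the metric and its volume, by `IsRotation.smul_apply`
  let R : EuclideanSpace ℝ (Fin 2) → EuclideanSpace ℝ (Fin 2) →L[ℝ] EuclideanSpace ℝ (Fin 2) :=
    fun y ↦ (ε * chartVolume x₀ y)⁻¹ •
      (-((chartMetric x₀ y (EuclideanSpace.single 1 1)).smulRight (EuclideanSpace.single 0 1)) +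
        (chartMetric x₀ y (EuclideanSpace.single 0 1)).smulRight (EuclideanSpace.single 1 1))
  have hR : ContDiffAt ℝ ∞ R (extChartAt (𝓡 2) x₀ x₀) := by
    have h0 : ε * chartVolume x₀ (extChartAt (𝓡 2) x₀ x₀) ≠ 0 := by
      rw [← hε.self_of_nhds]
      exact hω0 (mem_of_mem_nhds htarget)
    have h1 : ∀ i : Fin 2, ContDiffAt ℝ ∞ (fun y ↦ chartMetric x₀ y (EuclideanSpace.single i 1))
        (extChartAt (𝓡 2) x₀ x₀) := fun i ↦ hG.clm_apply contDiffAt_const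
    exact ((contDiffAt_const.mul hvol).inv h0).smul
      (((h1 1).smulRight contDiffAt_const).neg.add ((h1 0).smulRight contDiffAt_const))
  refine hR.congr_of_eventuallyEq ?_
  filter_upwards [htarget, hε] with y hy hεy
  refine ContinuousLinearMap.ext fun u ↦ ?_
  have h1 := (isRotation_chartRotation (o := o) x₀ hy).smul_apply (chartMetric_symm x₀ y)
    (fun _ ↦ chartMetric_pos x₀ hy) (EuclideanSpace.single 0 1) (EuclideanSpace.single 1 1) u
  rw [← inv_smul_smul₀ (hω0 hy) (chartRotation o x₀ y u), h1, hεy]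
  simp [R, chartMetric_symm x₀ y u]

/-- In dimension two a curvature operator that is skew and has curvature `-1` is a multiple of the
rotation. -/
lemma chartMetric_localCurvature (hκ : ∀ x : M, gaussCurvature x = -1) (x : M)
    (ξ ζ v : EuclideanSpace ℝ (Fin 2)) :
    chartMetric x (extChartAt (𝓡 2) x x) (chartRotation o x (extChartAt (𝓡 2) x x) v)
        (localCurvature (chartChristoffel x) (extChartAt (𝓡 2) x x) ξ ζ v) =
      chartMetric x (extChartAt (𝓡 2) x x) v v *
        chartMetric x (extChartAt (𝓡 2) x x) (chartRotation o x (extChartAt (𝓡 2) x x) ξ) ζ := by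
  set y := extChartAt (𝓡 2) x x with hy_def
  have hy : y ∈ (extChartAt (𝓡 2) x).target := mem_extChartAt_target x
  have htarget := (isOpen_extChartAt_target (I := 𝓡 2) x).mem_nhds hy
  have hΓd : DifferentiableAt ℝ (chartChristoffel x) y :=
    ((contDiffOn_chartChristoffel x).contDiffAt htarget).differentiableAt (by simp)
  have hskew : ∀ ξ ζ v, chartMetric x y (localCurvature (chartChristoffel x) y ξ ζ v) v = 0 :=
    metric_localCurvature_self (Filter.mem_of_superset htarget fun z hz ↦ isLeviCivitaAt_chart x hz)
      (((contDiffOn_chartMetric x).contDiffAt htarget).of_le ENat.LEInfty.out) hΓd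
  have hrot := isRotation_chartRotation (o := o) x hy
  set e₀ : EuclideanSpace ℝ (Fin 2) := EuclideanSpace.single 0 1 with he₀
  set e₁ : EuclideanSpace ℝ (Fin 2) := EuclideanSpace.single 1 1 with he₁
  set G := chartMetric x y with hG
  set I := chartRotation o x y with hI
  have hexp : ∀ u : EuclideanSpace ℝ (Fin 2), u = u 0 • e₀ + u 1 • e₁ := fun u ↦ by
    conv_lhs => rw [← sum_smul_single u, Fin.sum_univ_two]
  let R : EuclideanSpace ℝ (Fin 2) → EuclideanSpace ℝ (Fin 2) :=
    localCurvature (chartChristoffel x) y e₀ e₁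
  have hRadd : ∀ (a b : ℝ) (u w : EuclideanSpace ℝ (Fin 2)),
      R (a • u + b • w) = a • R u + b • R w := fun a b u w ↦ by
    simp only [R, localCurvature, map_add, map_smul, smul_add, smul_sub]
    abel
  have hcurv : localCurvature (chartChristoffel x) y ξ ζ v =
      (ξ 0 * ζ 1 - ξ 1 * ζ 0) • R v := by
    conv_lhs => rw [hexp ξ, hexp ζ]
    simp only [R, localCurvature, map_add, map_smul, add_apply, smul_apply, smul_add, smul_sub]
    module
  have hω : ∀ u w : EuclideanSpace ℝ (Fin 2), G (I u) w =
      (u 0 * w 1 - u 1 * w 0) * G (I e₀) e₁ := by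
    intro u w
    have hself : ∀ a, G (I a) a = 0 := fun a ↦ by
      have := hrot.skew a a
      rw [chartMetric_symm x y a] at this
      linarith
    have h10 : G (I e₁) e₀ = - G (I e₀) e₁ := by
      rw [hrot.skew, hG, chartMetric_symm]
    conv_lhs => rw [hexp u, hexp w]
    simp only [map_add, map_smul, add_apply, smul_apply, smul_eq_mul, hself, h10]
    ring
  have hB : ∀ u w : EuclideanSpace ℝ (Fin 2), G (R u) w =
      -(u 0 * w 1 - u 1 * w 0) * G (R e₁) e₀ := by
    intro u w
    have h10 : G (R e₀) e₁ = - G (R e₁) e₀ := by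
      have h1 := hskew e₀ e₁ ((1 : ℝ) • e₀ + (1 : ℝ) • e₁)
      have h2 := hskew e₀ e₁ e₀
      have h3 := hskew e₀ e₁ e₁
      change G (R _) _ = 0 at h1 h2 h3
      rw [hRadd] at h1
      simp only [map_add, map_smul, add_apply, smul_apply, smul_eq_mul, h2, h3] at h1
      linarith
    have h2 : G (R e₀) e₀ = 0 := hskew e₀ e₁ e₀
    have h3 : G (R e₁) e₁ = 0 := hskew e₀ e₁ e₁
    conv_lhs => rw [hexp u, hexp w, hRadd]
    simp only [map_add, map_smul, add_apply, smul_apply, smul_eq_mul, h2, h3, h10]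
    ring
  have hgauss : G (R e₁) e₀ = -(G (I e₀) e₁) ^ 2 := by
    have hcomp : ∀ l, R e₁ l = curvatureTensor x l 0 1 1 y := by
      intro l
      have hpd : ∀ a b c : Fin 2, partialDeriv a (christoffel x l b c) y =
          fderiv ℝ (chartChristoffel x) y (EuclideanSpace.single a 1) (EuclideanSpace.single b 1)
            (EuclideanSpace.single c 1) l := by
        intro a b c
        have h1 := (hΓd.hasFDerivAt.clm_apply
          (hasFDerivAt_const (EuclideanSpace.single b 1) y)).clm_apply
          (hasFDerivAt_const (EuclideanSpace.single c 1) y)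
        have h2 := ((EuclideanSpace.proj l : EuclideanSpace ℝ (Fin 2) →L[ℝ] ℝ).hasFDerivAt).comp
          y h1
        have h3 : HasFDerivAt (christoffel x l b c) _ y :=
          h2.congr_of_eventuallyEq (Filter.Eventually.of_forall fun z ↦
            (chartChristoffel_single x z b c l).symm)
        rw [partialDeriv, h3.fderiv]
        simp
      rw [curvatureTensor, hpd, hpd]
      simp only [R, localCurvature, he₀, he₁, PiLp.add_apply, PiLp.sub_apply]
      congr 1
      rw [chartChristoffel_apply, chartChristoffel_apply]
      simp [chartChristoffel_apply]
    have hk := hκ x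
    rw [gaussCurvature, ← hy_def, div_eq_iff (det_metricMatrix_ne_zero x hy)] at hk
    rw [chartMetric_chartRotation_sq x hy, hG, chartMetric_symm]
    conv_lhs => rw [← sum_smul_single (R e₁), map_sum]
    rw [neg_one_mul] at hk
    rw [← hk]
    refine Finset.sum_congr rfl fun l _ ↦ ?_
    rw [map_smul, hcomp, metricMatrix_eq x hy, smul_eq_mul, mul_comm]
  rw [hcurv, map_smul, smul_eq_mul, hω ξ ζ, hG, chartMetric_symm, ← hG, hB, hgauss]
  have h1 : G v v = G (I v) (I v) := by rw [hrot.skew, hrot.sq, map_neg, neg_neg]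
  rw [h1, hω v (I v)]
  ring

end ChartRotation

/-! ### Charts of the tangent bundle -/

section TangentCharts

variable {n : ℕ} {M : Type*} [TopologicalSpace M] [ChartedSpace (EuclideanSpace ℝ (Fin n)) M]
  [IsManifold (𝓡 n) ∞ M]

lemma contDiffAt_coordChange {x₀ x₁ z : M} (h₀ : z ∈ (extChartAt (𝓡 n) x₀).source)
    (h₁ : z ∈ (extChartAt (𝓡 n) x₁).source) :
    ContDiffAt ℝ ∞ (extChartAt (𝓡 n) x₁ ∘ (extChartAt (𝓡 n) x₀).symm)
      (extChartAt (𝓡 n) x₀ z) := by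
  have h : extChartAt (𝓡 n) x₀ z ∈
      ((extChartAt (𝓡 n) x₀).symm ≫ (extChartAt (𝓡 n) x₁)).source := by
    rw [PartialEquiv.trans_source'', PartialEquiv.symm_symm, PartialEquiv.symm_target]
    exact Set.mem_image_of_mem _ ⟨h₀, h₁⟩
  have h2 := contDiffWithinAt_ext_coord_change (n := ∞) (I := 𝓡 n) x₁ x₀ h
  rwa [ModelWithCorners.range_eq_univ, contDiffWithinAt_univ] at h2

lemma mem_extChartAt_tangent_source {p q : TangentBundle (𝓡 n) M} :
    q ∈ (extChartAt (𝓡 n).tangent p).source ↔ q.proj ∈ (extChartAt (𝓡 n) p.proj).source := by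
  rw [extChartAt_source, extChartAt_source, TangentBundle.mem_chart_source_iff]

/-- The vector `v` of a point `(x, v)` of the tangent bundle, as an element of the model space, with
which the tangent space at `x` is identified by the chart at `x`. -/
def modelVector (p : TangentBundle (𝓡 n) M) : EuclideanSpace ℝ (Fin n) := p.snd

lemma extChartAt_tangent_apply (p q : TangentBundle (𝓡 n) M) :
    extChartAt (𝓡 n).tangent p q = (extChartAt (𝓡 n) p.proj q.proj,
      tangentCoordChange (𝓡 n) q.proj p.proj q.proj (modelVector q)) := rfl

lemma extChartAt_tangent_self (p : TangentBundle (𝓡 n) M) :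
    extChartAt (𝓡 n).tangent p p = (extChartAt (𝓡 n) p.proj p.proj, modelVector p) := by
  rw [extChartAt_tangent_apply, tangentCoordChange_self (mem_extChartAt_source _)]

lemma extChartAt_tangent_symm_apply (p : TangentBundle (𝓡 n) M)
    {z : EuclideanSpace ℝ (Fin n) × EuclideanSpace ℝ (Fin n)}
    (hz : z.1 ∈ (extChartAt (𝓡 n) p.proj).target) :
    (extChartAt (𝓡 n).tangent p).symm z = ⟨(extChartAt (𝓡 n) p.proj).symm z.1,
      tangentCoordChange (𝓡 n) p.proj ((extChartAt (𝓡 n) p.proj).symm z.1)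
        ((extChartAt (𝓡 n) p.proj).symm z.1) z.2⟩ := by
  set q : TangentBundle (𝓡 n) M := ⟨(extChartAt (𝓡 n) p.proj).symm z.1,
      tangentCoordChange (𝓡 n) p.proj ((extChartAt (𝓡 n) p.proj).symm z.1)
        ((extChartAt (𝓡 n) p.proj).symm z.1) z.2⟩ with hq
  have hs : q.proj ∈ (extChartAt (𝓡 n) p.proj).source := (extChartAt (𝓡 n) p.proj).map_target hz
  have h1 : extChartAt (𝓡 n).tangent p q = z := by
    rw [extChartAt_tangent_apply]
    refine Prod.ext ((extChartAt (𝓡 n) p.proj).right_inv hz) ?_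
    refine (tangentCoordChange_comp ⟨⟨hs, mem_extChartAt_source _⟩, hs⟩).trans ?_
    exact tangentCoordChange_self hs
  rw [← h1, (extChartAt (𝓡 n).tangent p).left_inv (mem_extChartAt_tangent_source.2 hs)]

/-- The derivative of a change of coordinates of the tangent bundle. -/
lemma tangentCoordChange_tangent {p q : TangentBundle (𝓡 n) M}
    (h : q.proj ∈ (extChartAt (𝓡 n) p.proj).source)
    (ξ : EuclideanSpace ℝ (Fin n) × EuclideanSpace ℝ (Fin n)) :
    tangentCoordChange (𝓡 n).tangent q p q ξ =
      (tangentCoordChange (𝓡 n) q.proj p.proj q.proj ξ.1,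
        fderiv ℝ (fderiv ℝ (extChartAt (𝓡 n) p.proj ∘ (extChartAt (𝓡 n) q.proj).symm))
          (extChartAt (𝓡 n) q.proj q.proj) ξ.1 (modelVector q) +
          tangentCoordChange (𝓡 n) q.proj p.proj q.proj ξ.2) := by
  set y := extChartAt (𝓡 n) q.proj q.proj with hy
  set τ := extChartAt (𝓡 n) p.proj ∘ (extChartAt (𝓡 n) q.proj).symm with hτ
  have hq := mem_extChartAt_source (I := 𝓡 n) q.proj
  have hsymm : (extChartAt (𝓡 n) q.proj).symm y = q.proj := (extChartAt (𝓡 n) q.proj).left_inv hq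
  have htarget : ∀ᶠ y' in 𝓝 y, y' ∈ (extChartAt (𝓡 n) q.proj).target :=
    (isOpen_extChartAt_target q.proj).mem_nhds (mem_extChartAt_target (I := 𝓡 n) q.proj)
  have hsource : ∀ᶠ y' in 𝓝 y, (extChartAt (𝓡 n) q.proj).symm y' ∈
      (extChartAt (𝓡 n) p.proj).source :=
    (continuousAt_extChartAt_symm (I := 𝓡 n) q.proj).eventually
      (by rw [← hy, hsymm]; exact (isOpen_extChartAt_source p.proj).mem_nhds h)
  have hA : HasFDerivAt τ (tangentCoordChange (𝓡 n) q.proj p.proj q.proj) y :=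
    hasFDerivAt_tangentCoordChange ⟨hq, h⟩
  have hτ2 : HasFDerivAt (fderiv ℝ τ) (fderiv ℝ (fderiv ℝ τ) y) y :=
    ((((contDiffAt_coordChange hq h).of_le (ENat.LEInfty.out : 2 ≤ ∞)).fderiv_right (m := 1)
      (by norm_num)).differentiableAt (by simp)).hasFDerivAt
  have h1 : HasFDerivAt (extChartAt (𝓡 n).tangent p ∘ (extChartAt (𝓡 n).tangent q).symm)
      (tangentCoordChange (𝓡 n).tangent q p q) (extChartAt (𝓡 n).tangent q q) :=
    hasFDerivAt_tangentCoordChange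
      ⟨mem_extChartAt_source q, mem_extChartAt_tangent_source.2 h⟩
  rw [extChartAt_tangent_self, ← hy] at h1
  have h2 : HasFDerivAt (fun z : EuclideanSpace ℝ (Fin n) × EuclideanSpace ℝ (Fin n) ↦
      (τ z.1, fderiv ℝ τ z.1 z.2)) _ (y, modelVector q) :=
    (HasFDerivAt.comp (g := τ) (f := Prod.fst) (y, modelVector q) hA hasFDerivAt_fst).prodMk
      ((HasFDerivAt.comp (g := fderiv ℝ τ) (f := Prod.fst) (y, modelVector q) hτ2
        hasFDerivAt_fst).clm_apply hasFDerivAt_snd)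
  have h3 := h2.congr_of_eventuallyEq
    (f₁ := extChartAt (𝓡 n).tangent p ∘ (extChartAt (𝓡 n).tangent q).symm) (by
      filter_upwards [continuousAt_fst.eventually htarget, continuousAt_fst.eventually hsource]
        with z hz hz'
      have hzs := (extChartAt (𝓡 n) q.proj).map_target hz
      have h4 := (hasFDerivAt_tangentCoordChange (J := 𝓡 n) ⟨hzs, hz'⟩).fderiv
      rw [(extChartAt (𝓡 n) q.proj).right_inv hz] at h4
      rw [Function.comp_apply, extChartAt_tangent_symm_apply q hz, extChartAt_tangent_apply, hτ, h4]
      refine Prod.ext rfl ?_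
      exact tangentCoordChange_comp ⟨⟨hzs, mem_extChartAt_source _⟩, hz'⟩)
  rw [h1.unique h3]
  simp [hA.fderiv, add_comm]

lemma dproj_apply [RiemannianBundle (fun x : M ↦ TangentSpace (𝓡 n) x)]
    (p : TangentBundle (𝓡 n) M) (ξ : EuclideanSpace ℝ (Fin n) × EuclideanSpace ℝ (Fin n)) :
    (dproj p ξ : EuclideanSpace ℝ (Fin n)) = ξ.1 := by
  let T : EuclideanSpace ℝ (Fin n) × EuclideanSpace ℝ (Fin n) →L[ℝ] EuclideanSpace ℝ (Fin n) :=
    dproj p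
  have h1 : HasMFDerivAt (𝓡 n).tangent (𝓡 n) (fun q : TangentBundle (𝓡 n) M ↦ q.proj) p T :=
    ((contMDiff_proj (n := 1) (TangentSpace (𝓡 n) : M → Type)).mdifferentiable (by simp)
      p).hasMFDerivAt
  have h2 : HasMFDerivAt (𝓡 n) 𝓘(ℝ, EuclideanSpace ℝ (Fin n)) (extChartAt (𝓡 n) p.proj) p.proj
      (ContinuousLinearMap.id ℝ (EuclideanSpace ℝ (Fin n))) := by
    have h := (mdifferentiableAt_extChartAt (I := 𝓡 n) (mem_chart_source _ p.proj)).hasMFDerivAt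
    rwa [mfderiv_extChartAt_self] at h
  have h3 : HasMFDerivAt (𝓡 n).tangent 𝓘(ℝ, EuclideanSpace ℝ (Fin n) × EuclideanSpace ℝ (Fin n))
      (extChartAt (𝓡 n).tangent p) p (ContinuousLinearMap.id ℝ
        (EuclideanSpace ℝ (Fin n) × EuclideanSpace ℝ (Fin n))) := by
    have h := (mdifferentiableAt_extChartAt (I := (𝓡 n).tangent)
      (mem_chart_source _ p)).hasMFDerivAt
    rwa [mfderiv_extChartAt_self] at h
  have h4 : HasMFDerivAt 𝓘(ℝ, EuclideanSpace ℝ (Fin n) × EuclideanSpace ℝ (Fin n))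
      𝓘(ℝ, EuclideanSpace ℝ (Fin n)) Prod.fst (extChartAt (𝓡 n).tangent p p)
      (ContinuousLinearMap.fst ℝ (EuclideanSpace ℝ (Fin n)) (EuclideanSpace ℝ (Fin n))) :=
    hasFDerivAt_fst.hasMFDerivAt
  have h5 := HasMFDerivAt.comp p h2 h1
  have h6 := HasMFDerivAt.comp (g := Prod.fst) (f := extChartAt (𝓡 n).tangent p) p h4 h3
  have h7 := hasMFDerivAt_unique h5 h6
  exact congrArg (fun T : EuclideanSpace ℝ (Fin n) × EuclideanSpace ℝ (Fin n) →L[ℝ]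
    EuclideanSpace ℝ (Fin n) ↦ T ξ) h7

end TangentCharts

/-! ### Canonical form, connection form and horizontal field on the tangent bundle -/

section TangentForms

variable {n : ℕ} {M : Type*} [TopologicalSpace M] [ChartedSpace (EuclideanSpace ℝ (Fin n)) M]

lemma eventually_mem_target (p : TangentBundle (𝓡 n) M) :
    ∀ᶠ z in 𝓝 ((extChartAt (𝓡 n) p.proj p.proj, modelVector p) :
      EuclideanSpace ℝ (Fin n) × EuclideanSpace ℝ (Fin n)),
      z.1 ∈ (extChartAt (𝓡 n) p.proj).target :=
  continuousAt_fst.eventually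
    ((isOpen_extChartAt_target p.proj).mem_nhds (mem_extChartAt_target (I := 𝓡 n) p.proj))

variable [IsManifold (𝓡 n) ∞ M]

lemma exists_extChartAt_tangent_eq (p : TangentBundle (𝓡 n) M)
    {z : EuclideanSpace ℝ (Fin n) × EuclideanSpace ℝ (Fin n)}
    (hz : z.1 ∈ (extChartAt (𝓡 n) p.proj).target) :
    ∃ q : TangentBundle (𝓡 n) M, q.proj ∈ (extChartAt (𝓡 n) p.proj).source ∧
      extChartAt (𝓡 n).tangent p q = z := by
  have hs := (extChartAt (𝓡 n) p.proj).map_target hz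
  refine ⟨⟨(extChartAt (𝓡 n) p.proj).symm z.1,
      tangentCoordChange (𝓡 n) p.proj ((extChartAt (𝓡 n) p.proj).symm z.1)
        ((extChartAt (𝓡 n) p.proj).symm z.1) z.2⟩, hs, ?_⟩
  rw [extChartAt_tangent_apply]
  refine Prod.ext ((extChartAt (𝓡 n) p.proj).right_inv hz) ?_
  refine (tangentCoordChange_comp ⟨⟨hs, mem_extChartAt_source _⟩, hs⟩).trans ?_
  exact tangentCoordChange_self hs

/-- A one-form on the tangent bundle is determined in the chart at `p` by its values at the nearby
points `q`, read in their own charts. -/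
lemma chartForm_tangent_eq {p : TangentBundle (𝓡 n) M}
    {η : ∀ q : TangentBundle (𝓡 n) M, TangentSpace (𝓡 n).tangent q →L[ℝ] ℝ}
    {A : EuclideanSpace ℝ (Fin n) × EuclideanSpace ℝ (Fin n) →
      EuclideanSpace ℝ (Fin n) × EuclideanSpace ℝ (Fin n) →L[ℝ] ℝ}
    (h : ∀ q : TangentBundle (𝓡 n) M, q.proj ∈ (extChartAt (𝓡 n) p.proj).source →
      ∀ ξ : EuclideanSpace ℝ (Fin n) × EuclideanSpace ℝ (Fin n),
      A (extChartAt (𝓡 n).tangent p q) (tangentCoordChange (𝓡 n).tangent q p q ξ) = η q ξ)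
    {z : EuclideanSpace ℝ (Fin n) × EuclideanSpace ℝ (Fin n)}
    (hz : z.1 ∈ (extChartAt (𝓡 n) p.proj).target) : chartForm η p z = A z := by
  obtain ⟨q, hq, rfl⟩ := exists_extChartAt_tangent_eq p hz
  have hq' := mem_extChartAt_tangent_source.2 hq
  refine ContinuousLinearMap.ext fun ζ ↦ ?_
  have hqq := mem_extChartAt_source (I := (𝓡 n).tangent) q
  set ξ := tangentCoordChange (𝓡 n).tangent p q q ζ with hξ
  have hζ : tangentCoordChange (𝓡 n).tangent q p q ξ = ζ := by
    rw [hξ, tangentCoordChange_comp ⟨⟨hq', hqq⟩, hq'⟩, tangentCoordChange_self hq']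
  have h1 := chartForm_mfderiv_extChartAt η hq' ξ
  rw [mfderiv_extChartAt_eq hq'] at h1
  rw [← hζ, h q hq]
  exact h1

variable [RiemannianBundle (fun x : M ↦ TangentSpace (𝓡 n) x)]

/-- The canonical one-form, as a family of continuous linear forms. -/
def canonicalOneForm (p : TangentBundle (𝓡 n) M) : TangentSpace (𝓡 n).tangent p →L[ℝ] ℝ :=
  (innerSL ℝ p.snd).comp (dproj p)

lemma canonicalOneForm_apply (p : TangentBundle (𝓡 n) M)
    (ξ : EuclideanSpace ℝ (Fin n) × EuclideanSpace ℝ (Fin n)) :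
    canonicalOneForm p ξ = tangentMetric p.proj (modelVector p) ξ.1 := by
  rw [← dproj_apply p ξ]
  rfl

lemma chartForm_canonicalOneForm (p : TangentBundle (𝓡 n) M)
    {z : EuclideanSpace ℝ (Fin n) × EuclideanSpace ℝ (Fin n)}
    (hz : z.1 ∈ (extChartAt (𝓡 n) p.proj).target) :
    chartForm canonicalOneForm p z = localCanonicalForm (chartMetric p.proj) z := by
  refine chartForm_tangent_eq (fun q hq ξ ↦ ?_) hz
  rw [tangentCoordChange_tangent hq, localCanonicalForm_apply, extChartAt_tangent_apply,
    canonicalOneForm_apply, chartMetric_comp (mem_extChartAt_source _) hq, chartMetric_self]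

variable [IsContMDiffRiemannianBundle (𝓡 n) ∞ (EuclideanSpace ℝ (Fin n))
      (fun x : M ↦ TangentSpace (𝓡 n) x)]

/-- Change of coordinates for the Christoffel symbols. -/
lemma chartChristoffel_comp {x₀ x₁ z : M} (h₀ : z ∈ (extChartAt (𝓡 n) x₀).source)
    (h₁ : z ∈ (extChartAt (𝓡 n) x₁).source) (u w : EuclideanSpace ℝ (Fin n)) :
    tangentCoordChange (𝓡 n) x₀ x₁ z (chartChristoffel x₀ (extChartAt (𝓡 n) x₀ z) u w) =
      chartChristoffel x₁ (extChartAt (𝓡 n) x₁ z) (tangentCoordChange (𝓡 n) x₀ x₁ z u)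
        (tangentCoordChange (𝓡 n) x₀ x₁ z w) +
      fderiv ℝ (fderiv ℝ (extChartAt (𝓡 n) x₁ ∘ (extChartAt (𝓡 n) x₀).symm))
          (extChartAt (𝓡 n) x₀ z) u w := by
  set y := extChartAt (𝓡 n) x₀ z with hy
  set τ := extChartAt (𝓡 n) x₁ ∘ (extChartAt (𝓡 n) x₀).symm with hτ
  have hsymm : (extChartAt (𝓡 n) x₀).symm y = z := (extChartAt (𝓡 n) x₀).left_inv h₀
  have hyt : y ∈ (extChartAt (𝓡 n) x₀).target := (extChartAt (𝓡 n) x₀).map_source h₀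
  have htarget : ∀ᶠ y' in 𝓝 y, y' ∈ (extChartAt (𝓡 n) x₀).target :=
    (isOpen_extChartAt_target x₀).mem_nhds hyt
  have hsource : ∀ᶠ y' in 𝓝 y, (extChartAt (𝓡 n) x₀).symm y' ∈ (extChartAt (𝓡 n) x₁).source :=
    (continuousAt_extChartAt_symm'' hyt).eventually
      (by rw [hsymm]; exact (isOpen_extChartAt_source x₁).mem_nhds h₁)
  have hA : fderiv ℝ τ y = tangentCoordChange (𝓡 n) x₀ x₁ z :=
    (hasFDerivAt_tangentCoordChange (J := 𝓡 n) ⟨h₀, h₁⟩).fderiv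
  have hτy : τ y = extChartAt (𝓡 n) x₁ z := by rw [hτ, Function.comp_apply, hsymm]
  have hlc₁ : IsLeviCivitaAt (chartMetric x₁) (chartChristoffel x₁) (τ y) :=
    isLeviCivitaAt_chart x₁ (by rw [hτy]; exact (extChartAt (𝓡 n) x₁).map_source h₁)
  have key := hlc₁.christoffel_transform (isLeviCivitaAt_chart x₀ hyt)
    ((contDiffAt_coordChange h₀ h₁).of_le (ENat.LEInfty.out : 2 ≤ ∞)) (by
      filter_upwards [htarget, hsource] with y' hy' hs' u w
      have h2 := (extChartAt (𝓡 n) x₀).map_target hy'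
      have h4 := (hasFDerivAt_tangentCoordChange (J := 𝓡 n) ⟨h2, hs'⟩).fderiv
      rw [(extChartAt (𝓡 n) x₀).right_inv hy'] at h4
      change fderiv ℝ τ y' = _ at h4
      rw [h4]
      have h5 := chartMetric_comp h2 hs' u w
      rw [(extChartAt (𝓡 n) x₀).right_inv hy'] at h5
      exact h5.symm)
    (by rw [hA]; exact tangentCoordChange_surjective h₀ h₁) u w
  rw [hA, hτy] at key
  exact key

/-- The vertical part of a tangent vector of the tangent bundle transforms like a vector. -/
lemma localConnector_tangentCoordChange {p q : TangentBundle (𝓡 n) M}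
    (h : q.proj ∈ (extChartAt (𝓡 n) p.proj).source)
    (ξ : EuclideanSpace ℝ (Fin n) × EuclideanSpace ℝ (Fin n)) :
    localConnector (chartChristoffel p.proj) (extChartAt (𝓡 n).tangent p q)
        (tangentCoordChange (𝓡 n).tangent q p q ξ) =
      tangentCoordChange (𝓡 n) q.proj p.proj q.proj
        (localConnector (chartChristoffel q.proj)
          (extChartAt (𝓡 n) q.proj q.proj, modelVector q) ξ) := by
  rw [tangentCoordChange_tangent h, localConnector_apply, localConnector_apply, map_add,
    chartChristoffel_comp (mem_extChartAt_source q.proj) h, extChartAt_tangent_apply]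
  exact (fun a b c ↦ by abel : ∀ a b c : EuclideanSpace ℝ (Fin n), a + b + c = b + (c + a)) _ _ _

lemma differentiableAt_chartForm_canonicalOneForm (p : TangentBundle (𝓡 n) M) :
    DifferentiableAt ℝ (chartForm canonicalOneForm p) (extChartAt (𝓡 n).tangent p p) := by
  rw [extChartAt_tangent_self]
  have h := isLeviCivitaAt_chart p.proj (mem_extChartAt_target (I := 𝓡 n) p.proj)
  exact (differentiableAt_localCanonicalForm h.differentiableAt_metric).congr_of_eventuallyEq
    ((eventually_mem_target p).mono fun z hz ↦ chartForm_canonicalOneForm p hz)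

/-- The vertical part of a tangent vector of the tangent bundle. -/
def connector (p : TangentBundle (𝓡 n) M) :
    EuclideanSpace ℝ (Fin n) × EuclideanSpace ℝ (Fin n) →L[ℝ] EuclideanSpace ℝ (Fin n) :=
  localConnector (chartChristoffel p.proj) (extChartAt (𝓡 n) p.proj p.proj, modelVector p)

lemma mextDeriv_canonicalForm (p : TangentBundle (𝓡 n) M)
    (ξ ζ : EuclideanSpace ℝ (Fin n) × EuclideanSpace ℝ (Fin n)) :
    mextDeriv (𝓡 n).tangent (canonicalForm (n := n) (M := M)) p ![ξ, ζ] =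
      tangentMetric p.proj (connector p ξ) ζ.1 - tangentMetric p.proj (connector p ζ) ξ.1 := by
  have h := isLeviCivitaAt_chart p.proj (mem_extChartAt_target (I := 𝓡 n) p.proj)
  have h1 := mextDeriv_toOneForm (differentiableAt_chartForm_canonicalOneForm p) ξ ζ
  have h2 : chartForm canonicalOneForm p =ᶠ[𝓝 (extChartAt (𝓡 n).tangent p p)]
      localCanonicalForm (chartMetric p.proj) := by
    rw [extChartAt_tangent_self]
    exact (eventually_mem_target p).mono fun z hz ↦ chartForm_canonicalOneForm p hz
  rw [h2.fderiv_eq, extChartAt_tangent_self] at h1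
  have h3 := h.fderiv_localCanonicalForm_sub
    (z := (extChartAt (𝓡 n) p.proj p.proj, modelVector p)) ξ ζ
  simp only [chartMetric_self] at h3
  exact h1.trans h3

end TangentForms

section SurfaceForms

variable {M : Type*} [TopologicalSpace M] [ChartedSpace (EuclideanSpace ℝ (Fin 2)) M]
  [RiemannianBundle (fun x : M ↦ TangentSpace (𝓡 2) x)]

lemma tangentMetric_modelVector (p : TangentBundle (𝓡 2) M) :
    tangentMetric p.proj (modelVector p) (modelVector p) = ‖p.snd‖ ^ 2 :=
  real_inner_self_eq_norm_sq p.snd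

variable [IsManifold (𝓡 2) ∞ M]
  (o : ∀ x : M, Orientation ℝ (TangentSpace (𝓡 2) x) (Fin 2))

/-- The connection form on the tangent bundle of an oriented surface; it measures the rotation of a
moving vector relative to parallel transport. On the zero section it takes the junk value `0`. -/
def connectionForm (p : TangentBundle (𝓡 2) M) : TangentSpace (𝓡 2).tangent p →L[ℝ] ℝ :=
  localConnectionForm (chartMetric p.proj) (chartChristoffel p.proj) (chartRotation o p.proj)
    (extChartAt (𝓡 2) p.proj p.proj, modelVector p)

/-- The vector field `-H`, with values in the model space. -/
def negHorizontal (p : TangentBundle (𝓡 2) M) :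
    EuclideanSpace ℝ (Fin 2) × EuclideanSpace ℝ (Fin 2) :=
  localNegHorizontal (chartChristoffel p.proj) (chartRotation o p.proj)
    (extChartAt (𝓡 2) p.proj p.proj, modelVector p)

lemma neg_horizontalField_eq :
    (fun p ↦ -horizontalField o p) =
      fun p ↦ (negHorizontal o p : TangentSpace (𝓡 2).tangent p) := by
  funext p
  simp only [negHorizontal, localNegHorizontal, chartRotation_self, chartChristoffel_self]
  refine Prod.ext rfl ?_
  exact neg_neg (G := EuclideanSpace ℝ (Fin 2)) _

lemma fst_negHorizontal (p : TangentBundle (𝓡 2) M) :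
    (negHorizontal o p).1 = -tangentRotation o p.proj (modelVector p) := by
  simp only [negHorizontal, localNegHorizontal, chartRotation_self]

variable {o}

lemma connector_negHorizontal (p : TangentBundle (𝓡 2) M) :
    connector p (negHorizontal o p) = 0 :=
  localConnector_localNegHorizontal _

lemma connectionForm_negHorizontal (p : TangentBundle (𝓡 2) M) :
    connectionForm o p (negHorizontal o p) = 0 := by
  have h := localConnectionForm_apply (G := chartMetric p.proj) (Γ := chartChristoffel p.proj)
    (I := chartRotation o p.proj) (extChartAt (𝓡 2) p.proj p.proj, modelVector p)
    (negHorizontal o p)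
  refine h.trans ?_
  have h2 : localConnector (chartChristoffel p.proj)
      (extChartAt (𝓡 2) p.proj p.proj, modelVector p) (negHorizontal o p) = 0 :=
    connector_negHorizontal p
  rw [h2, map_zero, mul_zero]

lemma canonicalOneForm_negHorizontal (p : TangentBundle (𝓡 2) M) :
    canonicalOneForm p (negHorizontal o p) = 0 := by
  have h := canonicalOneForm_apply p (negHorizontal o p)
  rw [fst_negHorizontal, map_neg] at h
  refine h.trans ?_
  have h1 := (isRotation_tangentRotation o p.proj).skew (modelVector p) (modelVector p)
  have h2 : tangentMetric p.proj (tangentRotation o p.proj (modelVector p)) (modelVector p) =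
    tangentMetric p.proj (modelVector p) (tangentRotation o p.proj (modelVector p)) :=
    real_inner_comm (F := TangentSpace (𝓡 2) p.proj) _ _
  linarith

/-- The function `|v|²` on the tangent bundle. -/
def normSq (p : TangentBundle (𝓡 2) M) : ℝ := ‖p.snd‖ ^ 2

lemma normSq_eq {p q : TangentBundle (𝓡 2) M} (h : q.proj ∈ (extChartAt (𝓡 2) p.proj).source) :
    normSq q = chartMetric p.proj (extChartAt (𝓡 2).tangent p q).1
      (extChartAt (𝓡 2).tangent p q).2 (extChartAt (𝓡 2).tangent p q).2 := by
  rw [extChartAt_tangent_apply, chartMetric_comp (mem_extChartAt_source q.proj) h,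
    chartMetric_self, tangentMetric_modelVector, normSq]

variable [IsContMDiffRiemannianBundle (𝓡 2) ∞ (EuclideanSpace ℝ (Fin 2))
      (fun x : M ↦ TangentSpace (𝓡 2) x)]

lemma chartForm_connectionForm (p : TangentBundle (𝓡 2) M)
    {z : EuclideanSpace ℝ (Fin 2) × EuclideanSpace ℝ (Fin 2)}
    (hz : z.1 ∈ (extChartAt (𝓡 2) p.proj).target) :
    chartForm (connectionForm o) p z = localConnectionForm (chartMetric p.proj)
      (chartChristoffel p.proj) (chartRotation o p.proj) z := by
  refine chartForm_tangent_eq (fun q hq ξ ↦ ?_) hz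
  have hqq := mem_extChartAt_source (I := 𝓡 2) q.proj
  rw [localConnectionForm_apply, localConnector_tangentCoordChange hq, extChartAt_tangent_apply,
    chartRotation_comp hqq hq, chartMetric_comp hqq hq, chartMetric_comp hqq hq]
  rfl

lemma eventuallyEq_chartForm_connectionForm (p : TangentBundle (𝓡 2) M) :
    chartForm (connectionForm o) p =ᶠ[𝓝 (extChartAt (𝓡 2).tangent p p)]
      localConnectionForm (chartMetric p.proj) (chartChristoffel p.proj)
        (chartRotation o p.proj) := by
  rw [extChartAt_tangent_self]
  exact (eventually_mem_target p).mono fun z hz ↦ chartForm_connectionForm p hz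

lemma differentiableAt_chartForm_connectionForm (ho : IsOrientationOfSurface o)
    {p : TangentBundle (𝓡 2) M} (hp : modelVector p ≠ 0) :
    DifferentiableAt ℝ (chartForm (connectionForm o) p) (extChartAt (𝓡 2).tangent p p) := by
  refine DifferentiableAt.congr_of_eventuallyEq ?_ (eventuallyEq_chartForm_connectionForm p)
  rw [extChartAt_tangent_self]
  have ht := mem_extChartAt_target (I := 𝓡 2) p.proj
  exact differentiableAt_localConnectionForm (isLeviCivitaAt_chart p.proj ht)
    ((contDiffAt_chartRotation ho p.proj).differentiableAt (by simp))
    (((contDiffOn_chartChristoffel p.proj).contDiffAt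
      ((isOpen_extChartAt_target p.proj).mem_nhds ht)).differentiableAt (by simp)) hp

/-- On a hyperbolic surface the exterior derivative of the connection form is the pullback of the
area form. -/
lemma mextDeriv_connectionForm (ho : IsOrientationOfSurface o)
    (hκ : ∀ x : M, gaussCurvature x = -1) {p : TangentBundle (𝓡 2) M} (hp : modelVector p ≠ 0)
    (ξ ζ : EuclideanSpace ℝ (Fin 2) × EuclideanSpace ℝ (Fin 2)) :
    mextDeriv (𝓡 2).tangent (toOneForm (connectionForm o)) p ![ξ, ζ] =
      tangentMetric p.proj (tangentRotation o p.proj ξ.1) ζ.1 := by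
  have ht := mem_extChartAt_target (I := 𝓡 2) p.proj
  have hn := (isOpen_extChartAt_target p.proj).mem_nhds ht
  have h1 := mextDeriv_toOneForm (differentiableAt_chartForm_connectionForm ho hp) ξ ζ
  rw [(eventuallyEq_chartForm_connectionForm p).fderiv_eq, extChartAt_tangent_self] at h1
  have h3 := (isLeviCivitaAt_chart p.proj ht).fderiv_localConnectionForm_sub
    (z := (extChartAt (𝓡 2) p.proj p.proj, modelVector p))
    ((contDiffAt_chartRotation ho p.proj).differentiableAt (by simp))
    (((contDiffOn_chartChristoffel p.proj).contDiffAt hn).differentiableAt (by simp))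
    (Filter.mem_of_superset hn fun y hy ↦ isRotation_chartRotation p.proj hy) hp
    (chartMetric_localCurvature hκ p.proj) ξ ζ
  simp only [chartMetric_self, chartRotation_self] at h3
  exact h1.trans h3

lemma tangentCoordChange_negHorizontal {p q : TangentBundle (𝓡 2) M}
    (h : q.proj ∈ (extChartAt (𝓡 2) p.proj).source) :
    tangentCoordChange (𝓡 2).tangent q p q (negHorizontal o q) =
      localNegHorizontal (chartChristoffel p.proj) (chartRotation o p.proj)
        (extChartAt (𝓡 2).tangent p q) := by
  have hqq := mem_extChartAt_source (I := 𝓡 2) q.proj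
  have h1 := localConnector_tangentCoordChange h (negHorizontal o q)
  have h2 : localConnector (chartChristoffel q.proj)
      (extChartAt (𝓡 2) q.proj q.proj, modelVector q) (negHorizontal o q) = 0 :=
    connector_negHorizontal q
  rw [h2, map_zero] at h1
  set ζ := tangentCoordChange (𝓡 2).tangent q p q (negHorizontal o q) with hζ
  have h3 : ζ.1 = -chartRotation o p.proj (extChartAt (𝓡 2).tangent p q).1
      (extChartAt (𝓡 2).tangent p q).2 := by
    rw [hζ, tangentCoordChange_tangent h, fst_negHorizontal, map_neg,
      extChartAt_tangent_apply, chartRotation_comp hqq h, chartRotation_self]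
  refine Prod.ext h3 ?_
  rw [localConnector_apply, h3, map_neg, neg_apply, ← sub_eq_add_neg, sub_eq_zero] at h1
  exact h1

/-- The horizontal vector field is smooth. -/
lemma contMDiff_negHorizontal (ho : IsOrientationOfSurface o) :
    ContMDiff (𝓡 2).tangent (𝓡 2).tangent.tangent ∞
      (fun p ↦ (⟨p, negHorizontal o p⟩ :
        TangentBundle (𝓡 2).tangent (TangentBundle (𝓡 2) M))) := by
  intro p
  have ht := mem_extChartAt_target (I := 𝓡 2) p.proj
  have hn := (isOpen_extChartAt_target p.proj).mem_nhds ht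
  refine (contMDiffAt_section p).2 ?_
  have hI := (contDiffAt_chartRotation ho p.proj)
  have hΓ := (contDiffOn_chartChristoffel p.proj).contDiffAt hn
  have hlocal : ContDiffAt ℝ ∞ (localNegHorizontal (chartChristoffel p.proj)
      (chartRotation o p.proj)) (extChartAt (𝓡 2).tangent p p) := by
    rw [extChartAt_tangent_self]
    have h1 : ContDiffAt ℝ ∞ (fun z : EuclideanSpace ℝ (Fin 2) × EuclideanSpace ℝ (Fin 2) ↦
        chartRotation o p.proj z.1 z.2) (extChartAt (𝓡 2) p.proj p.proj, modelVector p) :=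
      (ContDiffAt.comp (g := chartRotation o p.proj) (f := Prod.fst)
        (extChartAt (𝓡 2) p.proj p.proj, modelVector p) hI contDiffAt_fst).clm_apply contDiffAt_snd
    have h2 : ContDiffAt ℝ ∞ (fun z : EuclideanSpace ℝ (Fin 2) × EuclideanSpace ℝ (Fin 2) ↦
        chartChristoffel p.proj z.1) (extChartAt (𝓡 2) p.proj p.proj, modelVector p) :=
      ContDiffAt.comp (g := chartChristoffel p.proj) (f := Prod.fst)
        (extChartAt (𝓡 2) p.proj p.proj, modelVector p) hΓ contDiffAt_fst
    exact h1.neg.prodMk ((h2.clm_apply h1).clm_apply contDiffAt_snd)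
  have h1 : ContMDiffAt (𝓡 2).tangent 𝓘(ℝ, EuclideanSpace ℝ (Fin 2) × EuclideanSpace ℝ (Fin 2)) ∞
      (fun q ↦ localNegHorizontal (chartChristoffel p.proj) (chartRotation o p.proj)
        (extChartAt (𝓡 2).tangent p q)) p :=
    ContMDiffAt.comp (g := localNegHorizontal (chartChristoffel p.proj) (chartRotation o p.proj)) p
      hlocal.contMDiffAt contMDiffAt_extChartAt
  refine h1.congr_of_eventuallyEq ?_
  filter_upwards [(isOpen_extChartAt_source (I := (𝓡 2).tangent) p).mem_nhds
    (mem_extChartAt_source p)] with q hq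
  exact tangentCoordChange_negHorizontal (mem_extChartAt_tangent_source.1 hq)

/-- The contraction of the differential of the canonical one-form with `-H`. -/
lemma mextDeriv_canonicalForm_negHorizontal {p : TangentBundle (𝓡 2) M}
    (hp : modelVector p ≠ 0) (ζ : TangentSpace (𝓡 2).tangent p) :
    mextDeriv (𝓡 2).tangent (canonicalForm (n := 2) (M := M)) p
        ![(negHorizontal o p : TangentSpace (𝓡 2).tangent p), ζ] =
      ‖p.snd‖ ^ 2 * connectionForm o p ζ := by
  have h1 := mextDeriv_canonicalForm p (negHorizontal o p) ζ
  have hpos : 0 < tangentMetric p.proj (modelVector p) (modelVector p) :=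
    real_inner_self_pos (F := TangentSpace (𝓡 2) p.proj).2 hp
  have h2 : connectionForm o p ζ = (tangentMetric p.proj (modelVector p) (modelVector p))⁻¹ *
      tangentMetric p.proj (tangentRotation o p.proj (modelVector p)) (connector p ζ) := by
    have h := localConnectionForm_apply (G := chartMetric p.proj) (Γ := chartChristoffel p.proj)
      (I := chartRotation o p.proj) (extChartAt (𝓡 2) p.proj p.proj, modelVector p) ζ
    simp only [chartMetric_self, chartRotation_self] at h
    exact h
  rw [h2, ← tangentMetric_modelVector, mul_inv_cancel_left₀ hpos.ne']
  refine h1.trans ?_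
  rw [connector_negHorizontal, fst_negHorizontal, map_zero, zero_apply, map_neg, zero_sub,
    neg_neg]
  exact real_inner_comm (F := TangentSpace (𝓡 2) p.proj) _ _

/-- The contraction of the differential of the connection form with `-H`. -/
lemma mextDeriv_connectionForm_negHorizontal (ho : IsOrientationOfSurface o)
    (hκ : ∀ x : M, gaussCurvature x = -1) {p : TangentBundle (𝓡 2) M} (hp : modelVector p ≠ 0)
    (ζ : TangentSpace (𝓡 2).tangent p) :
    mextDeriv (𝓡 2).tangent (toOneForm (connectionForm o)) p
        ![(negHorizontal o p : TangentSpace (𝓡 2).tangent p), ζ] =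
      canonicalOneForm p ζ := by
  have h1 := mextDeriv_connectionForm ho hκ hp (negHorizontal o p) ζ
  refine h1.trans ?_
  rw [fst_negHorizontal, map_neg, (isRotation_tangentRotation o p.proj).sq, neg_neg]
  exact (canonicalOneForm_apply p ζ).symm

lemma contMDiff_normSq : ContMDiff (𝓡 2).tangent 𝓘(ℝ, ℝ) ∞ (normSq (M := M)) := by
  intro p
  have hn := (isOpen_extChartAt_target p.proj).mem_nhds (mem_extChartAt_target (I := 𝓡 2) p.proj)
  have hlocal : ContDiffAt ℝ ∞ (fun z : EuclideanSpace ℝ (Fin 2) × EuclideanSpace ℝ (Fin 2) ↦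
      chartMetric p.proj z.1 z.2 z.2) (extChartAt (𝓡 2).tangent p p) := by
    rw [extChartAt_tangent_self]
    have h1 := ContDiffAt.comp (g := chartMetric p.proj) (f := Prod.fst)
      (extChartAt (𝓡 2) p.proj p.proj, modelVector p)
      ((contDiffOn_chartMetric p.proj).contDiffAt hn) contDiffAt_fst
    exact (h1.clm_apply contDiffAt_snd).clm_apply contDiffAt_snd
  have h1 := ContMDiffAt.comp (g := fun z : EuclideanSpace ℝ (Fin 2) × EuclideanSpace ℝ (Fin 2) ↦
      chartMetric p.proj z.1 z.2 z.2) p hlocal.contMDiffAt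
      (contMDiffAt_extChartAt (I := (𝓡 2).tangent))
  refine h1.congr_of_eventuallyEq ?_
  filter_upwards [(isOpen_extChartAt_source (I := (𝓡 2).tangent) p).mem_nhds
    (mem_extChartAt_source p)] with q hq
  exact normSq_eq (mem_extChartAt_tangent_source.1 hq)

/-- Parallel transport preserves lengths: `|v|²` is constant along the horizontal field. -/
lemma mfderiv_normSq_negHorizontal (p : TangentBundle (𝓡 2) M) :
    mfderiv (𝓡 2).tangent 𝓘(ℝ, ℝ) normSq p (negHorizontal o p) = 0 := by
  have ht := mem_extChartAt_target (I := 𝓡 2) p.proj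
  have hlc := isLeviCivitaAt_chart p.proj ht
  obtain ⟨T, hT, hT'⟩ := hlc.exists_hasFDerivAt_normSq
    (z := (extChartAt (𝓡 2) p.proj p.proj, modelVector p))
  have hid : HasMFDerivAt (𝓡 2).tangent
      𝓘(ℝ, EuclideanSpace ℝ (Fin 2) × EuclideanSpace ℝ (Fin 2))
      (extChartAt (𝓡 2).tangent p) p (ContinuousLinearMap.id ℝ
        (EuclideanSpace ℝ (Fin 2) × EuclideanSpace ℝ (Fin 2))) := by
    have h := (mdifferentiableAt_extChartAt (I := (𝓡 2).tangent)
      (mem_chart_source _ p)).hasMFDerivAt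
    rwa [mfderiv_extChartAt_self] at h
  rw [← extChartAt_tangent_self] at hT
  have h1 := HasMFDerivAt.comp (g := fun z : EuclideanSpace ℝ (Fin 2) × EuclideanSpace ℝ (Fin 2) ↦
      chartMetric p.proj z.1 z.2 z.2) (f := extChartAt (𝓡 2).tangent p) p hT.hasMFDerivAt hid
  have h2 := h1.congr_of_eventuallyEq (f₁ := normSq) (by
    filter_upwards [(isOpen_extChartAt_source (I := (𝓡 2).tangent) p).mem_nhds
      (mem_extChartAt_source p)] with q hq
    exact normSq_eq (mem_extChartAt_tangent_source.1 hq))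
  rw [h2.mfderiv]
  refine (hT' (negHorizontal o p)).trans ?_
  have h3 : localConnector (chartChristoffel p.proj)
      (extChartAt (𝓡 2) p.proj p.proj, modelVector p) (negHorizontal o p) = 0 :=
    connector_negHorizontal p
  rw [h3, map_zero, zero_apply, mul_zero]
  rfl

end SurfaceForms

/-! ### The flow of the horizontal field -/

section HorizontalFlow

lemma t2Space_totalSpace {B F : Type*} {E : B → Type*} [TopologicalSpace B] [TopologicalSpace F]
    [TopologicalSpace (TotalSpace F E)] [∀ b, TopologicalSpace (E b)] [FiberBundle F E]
    [T2Space B] [T2Space F] : T2Space (TotalSpace F E) := by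
  refine ⟨fun p q hpq ↦ ?_⟩
  by_cases h : p.proj = q.proj
  · let e := trivializationAt F E p.proj
    have hp : p ∈ e.source := FiberBundle.mem_trivializationAt_proj_source
    have hq : q ∈ e.source := by
      rw [e.mem_source, ← h]
      exact FiberBundle.mem_baseSet_trivializationAt' p.proj
    obtain ⟨U, V, hU, hV, hpU, hqV, hUV⟩ := t2_separation (e.injOn.ne hp hq hpq)
    exact ⟨_, _, e.continuousOn.isOpen_inter_preimage e.open_source hU,
      e.continuousOn.isOpen_inter_preimage e.open_source hV, ⟨hp, hpU⟩, ⟨hq, hqV⟩,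
      (hUV.preimage e).mono Set.inter_subset_right Set.inter_subset_right⟩
  · obtain ⟨U, V, hU, hV, hpU, hqV, hUV⟩ := t2_separation h
    have hc := FiberBundle.continuous_proj F E
    exact ⟨_, _, hU.preimage hc, hV.preimage hc, hpU, hqV, hUV.preimage _⟩

variable {M : Type*} [TopologicalSpace M] [ChartedSpace (EuclideanSpace ℝ (Fin 2)) M]
  [RiemannianBundle (fun x : M ↦ TangentSpace (𝓡 2) x)] [IsManifold (𝓡 2) ∞ M]
  {o : ∀ x : M, Orientation ℝ (TangentSpace (𝓡 2) x) (Fin 2)}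
  [IsContMDiffRiemannianBundle (𝓡 2) ∞ (EuclideanSpace ℝ (Fin 2))
      (fun x : M ↦ TangentSpace (𝓡 2) x)]

/-- Over a compact surface, the sets of tangent vectors of bounded length are relatively compact. -/
lemma exists_isCompact_normSq_le [T2Space M] [CompactSpace M] (R : ℝ) :
    ∃ K : Set (TangentBundle (𝓡 2) M), IsCompact K ∧ {p | normSq p ≤ R} ⊆ K := by
  have hloc : ∀ x : M, ∃ N ∈ 𝓝 x, ∃ K : Set (TangentBundle (𝓡 2) M), IsCompact K ∧
      ∀ p : TangentBundle (𝓡 2) M, p.proj ∈ N → normSq p ≤ R → p ∈ K := by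
    intro x
    let e := trivializationAt (EuclideanSpace ℝ (Fin 2)) (TangentSpace (𝓡 2) : M → Type) x
    have : IsContinuousRiemannianBundle (EuclideanSpace ℝ (Fin 2))
        (fun x : M ↦ TangentSpace (𝓡 2) x) :=
      let ⟨g, hg, hg'⟩ := IsContMDiffRiemannianBundle.exists_contMDiff (IB := 𝓡 2) (n := ∞)
        (F := EuclideanSpace ℝ (Fin 2)) (E := fun x : M ↦ TangentSpace (𝓡 2) x)
      ⟨g, hg.continuous, hg'⟩
    obtain ⟨C, hC, hCx⟩ := eventually_norm_trivializationAt_lt (EuclideanSpace ℝ (Fin 2))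
      (TangentSpace (𝓡 2) : M → Type) x
    have hb : e.baseSet ∈ 𝓝 x :=
      e.open_baseSet.mem_nhds (FiberBundle.mem_baseSet_trivializationAt' x)
    obtain ⟨N, hN, hNs, hNc⟩ := local_compact_nhds (Filter.inter_mem hb hCx)
    refine ⟨N, hN, e.toOpenPartialHomeomorph.symm '' (N ×ˢ Metric.closedBall 0 (C * √R)),
      (hNc.prod (isCompact_closedBall _ _)).image_of_continuousOn
        (e.toOpenPartialHomeomorph.continuousOn_symm.mono ?_), ?_⟩
    · rintro z ⟨hz, -⟩
      exact e.mem_target.2 (hNs hz).1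
    · intro p hp hpR
      have hps : p ∈ e.source := e.mem_source.2 (hNs hp).1
      refine ⟨e p, ⟨?_, ?_⟩, e.toOpenPartialHomeomorph.left_inv hps⟩
      · rw [e.coe_fst hps]; exact hp
      · rw [mem_closedBall_zero_iff]
        have h1 : ‖p.snd‖ ≤ √R := Real.le_sqrt_of_sq_le hpR
        have h2 : (e p).2 = e.continuousLinearMapAt ℝ p.proj p.snd := by
          rw [e.continuousLinearMapAt_apply ℝ, e.coe_linearMapAt_of_mem (hNs hp).1]
        rw [h2]
        refine ((e.continuousLinearMapAt ℝ p.proj).le_opNorm _).trans ?_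
        have h3 : ‖e.continuousLinearMapAt ℝ p.proj‖ < C := (hNs hp).2
        gcongr
  choose N hN K hK hNK using hloc
  obtain ⟨t, ht⟩ := finite_cover_nhds hN
  refine ⟨⋃ x ∈ t, K x, t.isCompact_biUnion fun x _ ↦ hK x, fun p hp ↦ ?_⟩
  have h1 : p.proj ∈ ⋃ x ∈ t, N x := by rw [ht]; trivial
  obtain ⟨x, hx, hpx⟩ := Set.mem_iUnion₂.1 h1
  exact Set.mem_iUnion₂.2 ⟨x, hx, hNK x p hpx hp⟩

/-- The field `-H` is complete: its flow preserves `|v|`, hence stays in a compact set. -/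
lemma exists_isGlobalFlow_negHorizontal [T2Space M] [CompactSpace M]
    (ho : IsOrientationOfSurface o) :
    ∃ φ : ℝ → TangentBundle (𝓡 2) M → TangentBundle (𝓡 2) M,
      IsGlobalFlow (𝓡 2).tangent (fun p ↦ negHorizontal o p) φ := by
  have : T2Space (TangentBundle (𝓡 2) M) := t2Space_totalSpace
  exact exists_isGlobalFlow (contMDiff_negHorizontal ho) contMDiff_normSq
    mfderiv_normSq_negHorizontal exists_isCompact_normSq_le

end HorizontalFlow

/-! ### Naturality of the exterior derivative of one-forms -/

section Naturality

variable {E : Type*} [NormedAddCommGroup E] [NormedSpace ℝ E]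
  {H : Type*} [TopologicalSpace H] {J : ModelWithCorners ℝ E H} [J.Boundaryless]
  {N : Type*} [TopologicalSpace N] [ChartedSpace H N] [IsManifold J 2 N]

/-- The exterior derivative of one-forms commutes with pullbacks. -/
lemma mextDeriv_toOneForm_pullback {F : N → N} {p : N} (hF : ContMDiffAt J J 2 F p)
    {η η' : ∀ p : N, TangentSpace J p →L[ℝ] ℝ}
    (hη : DifferentiableAt ℝ (chartForm η (F p)) (extChartAt J (F p) (F p)))
    (hη' : DifferentiableAt ℝ (chartForm η' p) (extChartAt J p p))
    (h : ∀ᶠ q in 𝓝 p, ∀ ζ, η (F q) (mfderiv J J F q ζ) = η' q ζ) (ξ ζ : TangentSpace J p) :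
    mextDeriv J (toOneForm η) (F p) ![mfderiv J J F p ξ, mfderiv J J F p ζ] =
      mextDeriv J (toOneForm η') p ![ξ, ζ] := by
  have hman : IsManifold J 1 N := .of_le (n := 2) (by norm_num)
  set c := extChartAt J p with hc
  set c' := extChartAt J (F p) with hc'
  set y₀ := c p with hy₀
  have hsymm : c.symm y₀ = p := c.left_inv (mem_extChartAt_source p)
  let f : E → E := fun y ↦ c' (F (c.symm y))
  have hfy₀ : f y₀ = c' (F p) := by simp only [f, hsymm]
  have hf : ContDiffAt ℝ 2 f y₀ := by
    have h1 := (contMDiffAt_iff.1 hF).2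
    rw [J.range_eq_univ, contDiffWithinAt_univ] at h1
    exact h1
  have hcs : ContinuousAt c.symm y₀ := continuousAt_extChartAt_symm p
  have htarget : ∀ᶠ y in 𝓝 y₀, y ∈ c.target :=
    (isOpen_extChartAt_target p).mem_nhds (mem_extChartAt_target (I := J) p)
  have hFsmooth : ∀ᶠ q in 𝓝 p, ContMDiffAt J J 2 F q :=
    (contMDiffAt_iff_contMDiffAt_nhds (by simp)).1 hF
  have hFsource : ∀ᶠ q in 𝓝 p, F q ∈ c'.source :=
    hF.continuousAt.eventually ((isOpen_extChartAt_source (F p)).mem_nhds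
      (mem_extChartAt_source (F p)))
  have hderiv : ∀ y ∈ c.target, ContMDiffAt J J 2 F (c.symm y) → F (c.symm y) ∈ c'.source →
      fderiv ℝ f y = (mfderiv J 𝓘(ℝ, E) c' (F (c.symm y))).comp
        ((mfderiv J J F (c.symm y)).comp (mfderiv 𝓘(ℝ, E) J c.symm y)) := by
    intro y hy h1 h2
    have h3 := HasMFDerivAt.comp y (h1.mdifferentiableAt (by simp)).hasMFDerivAt
      (mdifferentiableAt_extChartAt_symm (J := J) hy).hasMFDerivAt
    rw [hc', extChartAt_source] at h2
    have h4 := HasMFDerivAt.comp y (mdifferentiableAt_extChartAt (I := J) h2).hasMFDerivAt h3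
    let T : E →L[ℝ] E := (mfderiv J 𝓘(ℝ, E) c' (F (c.symm y))).comp
      ((mfderiv J J F (c.symm y)).comp (mfderiv 𝓘(ℝ, E) J c.symm y))
    have h5 : HasFDerivAt f T y := HasMFDerivAt.hasFDerivAt h4
    exact h5.fderiv
  have hpull : chartForm η' p =ᶠ[𝓝 y₀] fun y ↦ (chartForm η (F p) (f y)).comp (fderiv ℝ f y) := by
    have hall := hcs.eventually (p := fun q ↦ ContMDiffAt J J 2 F q ∧ F q ∈ c'.source ∧
      ∀ ζ, η (F q) (mfderiv J J F q ζ) = η' q ζ)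
      (by rw [hsymm]; exact hFsmooth.and (hFsource.and h))
    filter_upwards [htarget, hall] with y hy ⟨h1, h2, h3⟩
    refine ContinuousLinearMap.ext fun ζ ↦ ?_
    rw [hderiv y hy h1 h2]
    have h4 := chartForm_mfderiv_extChartAt η h2
      (mfderiv J J F (c.symm y) (mfderiv 𝓘(ℝ, E) J c.symm y ζ))
    exact (h3 _).symm.trans h4.symm
  have hself : ∀ ξ : E, fderiv ℝ f y₀ ξ = (mfderiv J J F p ξ : E) := by
    intro ξ
    rw [hderiv y₀ (mem_extChartAt_target p) (by rwa [hsymm])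
      (by rw [hsymm]; exact hFsource.self_of_nhds)]
    have key : ∀ q, q = p → ∀ ξ' : E, ξ' = ξ →
        (mfderiv J 𝓘(ℝ, E) c' (F q) (mfderiv J J F q ξ') : E) = mfderiv J J F p ξ := by
      rintro q rfl ξ' rfl
      exact congrArg (fun T : E →L[ℝ] E ↦ T (mfderiv J J F q ξ'))
        (mfderiv_extChartAt_self (I := J) (x := F q))
    exact key _ hsymm _ (congrArg (fun T : E →L[ℝ] E ↦ T ξ) (mfderiv_extChartAt_symm_self p))
  have hf1 : HasFDerivAt f (fderiv ℝ f y₀) y₀ := (hf.differentiableAt (by simp)).hasFDerivAt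
  have hf2 : HasFDerivAt (fderiv ℝ f) (fderiv ℝ (fderiv ℝ f) y₀) y₀ :=
    ((hf.fderiv_right (m := 1) (by norm_num)).differentiableAt (by simp)).hasFDerivAt
  have hη₁ : DifferentiableAt ℝ (chartForm η (F p)) (f y₀) := by rw [hfy₀]; exact hη
  have key : ∀ a b : E, fderiv ℝ (chartForm η' p) y₀ a b =
      fderiv ℝ (chartForm η (F p)) (f y₀) (fderiv ℝ f y₀ a) (fderiv ℝ f y₀ b) +
        chartForm η (F p) (f y₀) (fderiv ℝ (fderiv ℝ f) y₀ a b) := by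
    intro a b
    have h1 := (HasFDerivAt.comp y₀ hη₁.hasFDerivAt hf1).clm_apply
      (hf2.clm_apply (hasFDerivAt_const b y₀))
    have h2 := hη'.hasFDerivAt.clm_apply (hasFDerivAt_const b y₀)
    have h3 := h1.congr_of_eventuallyEq (f₁ := fun y ↦ chartForm η' p y b)
      (hpull.mono fun y hy ↦ congrArg (fun T : E →L[ℝ] ℝ ↦ T b) hy)
    have h4 := congrArg (fun T : E →L[ℝ] ℝ ↦ T a) (h2.unique h3)
    simp at h4
    rw [h4]; ring
  have hsym2 : ∀ a b : E, fderiv ℝ (fderiv ℝ f) y₀ a b = fderiv ℝ (fderiv ℝ f) y₀ b a :=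
    fun a b ↦ hf.isSymmSndFDerivAt (by simp) a b
  have hfin : ∀ a b : E, fderiv ℝ (chartForm η' p) y₀ a b - fderiv ℝ (chartForm η' p) y₀ b a =
      fderiv ℝ (chartForm η (F p)) (c' (F p)) (mfderiv J J F p a) (mfderiv J J F p b) -
        fderiv ℝ (chartForm η (F p)) (c' (F p)) (mfderiv J J F p b) (mfderiv J J F p a) := by
    intro a b
    rw [key, key, hsym2 b a, hself, hself, hfy₀]
    ring
  exact (mextDeriv_toOneForm hη _ _).trans
    ((hfin ξ ζ).symm.trans (mextDeriv_toOneForm hη' ξ ζ).symm)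

end Naturality

/-! ### Pulling back the canonical one-form -/

section Pullback

section VariableTime

variable {E : Type*} [NormedAddCommGroup E] [NormedSpace ℝ E]
  {H : Type*} [TopologicalSpace H] {J : ModelWithCorners ℝ E H}
  {N : Type*} [TopologicalSpace N] [ChartedSpace H N]
  {X : ∀ p : N, TangentSpace J p} {φ : ℝ → N → N}

/-- The derivative of the flow for a time that depends on the point. -/
lemma IsGlobalFlow.mfderiv_variable_time (hφ : IsGlobalFlow J X φ) {p : N} {b : N → ℝ}
    {b' : TangentSpace J p →L[ℝ] ℝ} (hb : HasMFDerivAt J 𝓘(ℝ, ℝ) b p b')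
    (hΦ : MDifferentiableAt (𝓘(ℝ, ℝ).prod J) J (fun z : ℝ × N ↦ φ z.1 z.2) (b p, p))
    (ζ : TangentSpace J p) :
    mfderiv J J (fun q ↦ φ (b q) q) p ζ =
      b' ζ • X (φ (b p) p) + mfderiv J J (φ (b p)) p ζ := by
  have h1 := (HasMFDerivAt.comp p (f := fun q ↦ (b q, q)) hΦ.hasMFDerivAt
    (hb.prodMk (hasMFDerivAt_id p))).mfderiv
  have h3 := mfderiv_prod_eq_add_apply (p := (b p, p)) hΦ (v := ((b' ζ, ζ) : ℝ × E))
  have h4 := ((hφ.integralCurve p) (b p)).mfderiv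
  refine (congrArg (fun T : E →L[ℝ] E ↦ T ζ) h1).trans (h3.trans ?_)
  rw [h4]
  rfl

end VariableTime

/-- The solution of the linear system `f' = r² g`, `g' = f`. -/
lemma eq_cosh_sinh_of_hasDerivAt {f g : ℝ → ℝ} {r : ℝ} (hf : ∀ t, HasDerivAt f (r ^ 2 * g t) t)
    (hg : ∀ t, HasDerivAt g (f t) t) (t : ℝ) :
    f t = Real.cosh (r * t) * f 0 + r * Real.sinh (r * t) * g 0 := by
  have hc : ∀ t, HasDerivAt (fun t ↦ Real.cosh (r * t)) (Real.sinh (r * t) * r) t := fun t ↦ by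
    simpa using ((hasDerivAt_id t).const_mul r).cosh
  have hs : ∀ t, HasDerivAt (fun t ↦ Real.sinh (r * t)) (Real.cosh (r * t) * r) t := fun t ↦ by
    simpa using ((hasDerivAt_id t).const_mul r).sinh
  -- the hyperbolic rotation of the solution is constant
  have h1 : ∀ t, HasDerivAt (fun t ↦ Real.cosh (r * t) * f t - r * (Real.sinh (r * t) * g t))
      0 t := fun t ↦ by
    have := ((hc t).mul (hf t)).sub (((hs t).mul (hg t)).const_mul r)
    convert! this using 1
    ring
  have h2 : ∀ t, HasDerivAt (fun t ↦ r * (Real.cosh (r * t) * g t) - Real.sinh (r * t) * f t)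
      0 t := fun t ↦ by
    have := (((hc t).mul (hg t)).const_mul r).sub ((hs t).mul (hf t))
    convert! this using 1
    ring
  have e1 := is_const_of_deriv_eq_zero (fun t ↦ (h1 t).differentiableAt)
    (fun t ↦ (h1 t).deriv) t 0
  have e2 := is_const_of_deriv_eq_zero (fun t ↦ (h2 t).differentiableAt)
    (fun t ↦ (h2 t).deriv) t 0
  simp only [mul_zero, Real.cosh_zero, Real.sinh_zero, zero_mul, one_mul, sub_zero] at e1 e2
  have e3 := Real.cosh_sq (r * t)
  linear_combination Real.cosh (r * t) * e1 + Real.sinh (r * t) * e2 - f t * e3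

section FiberScale

variable {n : ℕ} {M : Type*} [TopologicalSpace M] [ChartedSpace (EuclideanSpace ℝ (Fin n)) M]

lemma fiberScale_fiberScale (a b : ℝ) (p : TangentBundle (𝓡 n) M) :
    fiberScale a (fiberScale b p) = fiberScale (a * b) p := by
  simp only [fiberScale, mul_smul]
  rfl

lemma fiberScale_one (p : TangentBundle (𝓡 n) M) : fiberScale 1 p = p := by
  simp only [fiberScale, one_smul]

lemma norm_fiberScale [RiemannianBundle (fun x : M ↦ TangentSpace (𝓡 n) x)] (c : ℝ)
    (q : TangentBundle (𝓡 n) M) : ‖(fiberScale c q).snd‖ = |c| * ‖q.snd‖ := by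
  rw [← Real.norm_eq_abs]
  exact norm_smul c q.snd

variable [IsManifold (𝓡 n) ∞ M]

lemma contMDiffAt_fiberScale {A : TangentBundle (𝓡 n) M → ℝ}
    {f : TangentBundle (𝓡 n) M → TangentBundle (𝓡 n) M} {p : TangentBundle (𝓡 n) M}
    (hA : ContMDiffAt (𝓡 n).tangent 𝓘(ℝ, ℝ) ∞ A p)
    (hf : ContMDiffAt (𝓡 n).tangent (𝓡 n).tangent ∞ f p) :
    ContMDiffAt (𝓡 n).tangent (𝓡 n).tangent ∞ (fun q ↦ fiberScale (A q) (f q)) p := by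
  obtain ⟨h1, h2⟩ := (contMDiffAt_totalSpace (f := f)).1 hf
  refine contMDiffAt_totalSpace.2 ⟨h1, ?_⟩
  refine (hA.smul h2).congr_of_eventuallyEq (Filter.Eventually.of_forall fun q ↦ ?_)
  exact (tangentCoordChange (𝓡 n) (f q).proj (f p).proj (f q).proj).map_smul (A q)
    (modelVector (f q))

/-- Maps of the tangent bundle that agree up to the fibre have the same horizontal derivative. -/
lemma fst_mfderiv_congr {F ψ : TangentBundle (𝓡 n) M → TangentBundle (𝓡 n) M}
    {p : TangentBundle (𝓡 n) M} [RiemannianBundle (fun x : M ↦ TangentSpace (𝓡 n) x)]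
    (hF : MDifferentiableAt (𝓡 n).tangent (𝓡 n).tangent F p)
    (hψ : MDifferentiableAt (𝓡 n).tangent (𝓡 n).tangent ψ p) (h : ∀ q, (F q).proj = (ψ q).proj)
    (ζ : TangentSpace (𝓡 n).tangent p) :
    (mfderiv (𝓡 n).tangent (𝓡 n).tangent F p ζ :
      EuclideanSpace ℝ (Fin n) × EuclideanSpace ℝ (Fin n)).1 =
    (mfderiv (𝓡 n).tangent (𝓡 n).tangent ψ p ζ :
      EuclideanSpace ℝ (Fin n) × EuclideanSpace ℝ (Fin n)).1 := by
  have hproj : ∀ q : TangentBundle (𝓡 n) M, HasMFDerivAt (𝓡 n).tangent (𝓡 n)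
      (fun q : TangentBundle (𝓡 n) M ↦ q.proj) q (dproj q) := fun q ↦
    ((contMDiff_proj (n := 1) (TangentSpace (𝓡 n) : M → Type)).mdifferentiable (by simp)
      q).hasMFDerivAt
  have h1 := (hproj (F p)).comp p hF.hasMFDerivAt
  have h2 := (hproj (ψ p)).comp p hψ.hasMFDerivAt
  have h3 : (fun q : TangentBundle (𝓡 n) M ↦ q.proj) ∘ F =
    (fun q : TangentBundle (𝓡 n) M ↦ q.proj) ∘ ψ := funext h
  rw [h3] at h1
  have h4 := congrArg (fun T : EuclideanSpace ℝ (Fin n) × EuclideanSpace ℝ (Fin n) →L[ℝ]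
    EuclideanSpace ℝ (Fin n) ↦ T ζ) (hasMFDerivAt_unique h1 h2)
  exact (dproj_apply (F p) _).symm.trans (h4.trans (dproj_apply (ψ p) _))

end FiberScale

variable {M : Type*} [TopologicalSpace M] [ChartedSpace (EuclideanSpace ℝ (Fin 2)) M]
  [RiemannianBundle (fun x : M ↦ TangentSpace (𝓡 2) x)] [IsManifold (𝓡 2) ∞ M]
  {o : ∀ x : M, Orientation ℝ (TangentSpace (𝓡 2) x) (Fin 2)}

/-- The scaling by `c` multiplies the canonical form by `c`; the form only depends on the horizontal
part of its argument, which the scaling does not change. -/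
lemma canonicalOneForm_fiberScale (c : ℝ) (q : TangentBundle (𝓡 2) M)
    (ξ ζ : EuclideanSpace ℝ (Fin 2) × EuclideanSpace ℝ (Fin 2)) (h : ξ.1 = ζ.1) :
    canonicalOneForm (fiberScale c q) ξ = c * canonicalOneForm q ζ := by
  rw [canonicalOneForm_apply, canonicalOneForm_apply, h]
  exact real_inner_smul_left (F := TangentSpace (𝓡 2) q.proj) _ _ _

variable [IsContMDiffRiemannianBundle (𝓡 2) ∞ (EuclideanSpace ℝ (Fin 2))
      (fun x : M ↦ TangentSpace (𝓡 2) x)]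
  {φ : ℝ → TangentBundle (𝓡 2) M → TangentBundle (𝓡 2) M}

/-- The flow of `-H` preserves the length of vectors. -/
lemma IsGlobalFlow.norm_eq (hφ : IsGlobalFlow (𝓡 2).tangent (fun p ↦ negHorizontal o p) φ)
    (t : ℝ) (p : TangentBundle (𝓡 2) M) : ‖(φ t p).snd‖ = ‖p.snd‖ := by
  have h := IsMIntegralCurve.const_of_mfderiv_eq_zero (hφ.integralCurve p)
    (contMDiff_normSq.mdifferentiable (by simp)) mfderiv_normSq_negHorizontal t
  rw [hφ.zero] at h
  exact (sq_eq_sq₀ (norm_nonneg _) (norm_nonneg _)).1 h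

variable [T2Space M]

/-- The pullback of the canonical one-form by the flow of `-H`: the canonical form and the
connection form are rotated hyperbolically into each other. -/
theorem IsGlobalFlow.pullback_canonicalOneForm (ho : IsOrientationOfSurface o)
    (hκ : ∀ x : M, gaussCurvature x = -1)
    (hφ : IsGlobalFlow (𝓡 2).tangent (fun p ↦ negHorizontal o p) φ) {p : TangentBundle (𝓡 2) M}
    (hp : p.snd ≠ 0) (t : ℝ) (ζ : TangentSpace (𝓡 2).tangent p) :
    canonicalOneForm (φ t p) (mfderiv (𝓡 2).tangent (𝓡 2).tangent (φ t) p ζ) =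
      Real.cosh (‖p.snd‖ * t) * canonicalOneForm p ζ +
        ‖p.snd‖ * Real.sinh (‖p.snd‖ * t) * connectionForm o p ζ := by
  have : T2Space (TangentBundle (𝓡 2) M) := t2Space_totalSpace
  have hX := contMDiff_negHorizontal ho
  have hne : ∀ t, modelVector (φ t p) ≠ 0 := fun t ↦ by
    have h1 : ‖(φ t p).snd‖ ≠ 0 := by rw [hφ.norm_eq]; exact norm_ne_zero_iff.2 hp
    have h2 : (φ t p).snd ≠ 0 := norm_ne_zero_iff.1 h1
    exact h2
  let f : ℝ → ℝ := fun t ↦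
    canonicalOneForm (φ t p) (mfderiv (𝓡 2).tangent (𝓡 2).tangent (φ t) p ζ)
  let g : ℝ → ℝ := fun t ↦
    connectionForm o (φ t p) (mfderiv (𝓡 2).tangent (𝓡 2).tangent (φ t) p ζ)
  have hf : ∀ t, HasDerivAt f (‖p.snd‖ ^ 2 * g t) t := fun t ↦ by
    have h1 := hφ.hasDerivAt_pullback hX (t := t) (p := p)
      (differentiableAt_chartForm_canonicalOneForm _)
      (Filter.Eventually.of_forall canonicalOneForm_negHorizontal) ζ
    have h2 := mextDeriv_canonicalForm_negHorizontal (o := o) (hne t)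
      (mfderiv (𝓡 2).tangent (𝓡 2).tangent (φ t) p ζ)
    rw [hφ.norm_eq] at h2
    exact h1.congr_deriv h2
  have hg : ∀ t, HasDerivAt g (f t) t := fun t ↦ by
    have h1 := hφ.hasDerivAt_pullback hX (t := t) (p := p)
      (differentiableAt_chartForm_connectionForm ho (hne t))
      (Filter.Eventually.of_forall connectionForm_negHorizontal) ζ
    have h2 := mextDeriv_connectionForm_negHorizontal ho hκ (hne t)
      (mfderiv (𝓡 2).tangent (𝓡 2).tangent (φ t) p ζ)
    exact h1.congr_deriv h2
  have h0 : φ 0 = id := funext hφ.zero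
  have hzero : ∀ η : ∀ p : TangentBundle (𝓡 2) M, TangentSpace (𝓡 2).tangent p →L[ℝ] ℝ,
      η (φ 0 p) (mfderiv (𝓡 2).tangent (𝓡 2).tangent (φ 0) p ζ) = η p ζ := by
    intro η
    rw [h0, mfderiv_id]
    rfl
  have key := eq_cosh_sinh_of_hasDerivAt hf hg t
  rw [show f 0 = canonicalOneForm p ζ from hzero _, show g 0 = connectionForm o p ζ from hzero _]
    at key
  exact key

/-- The value of the canonical one-form does not notice the dependence of the time on the point,
since the form annihilates the vector field. -/
lemma IsGlobalFlow.canonicalOneForm_mfderiv_variable_time (ho : IsOrientationOfSurface o)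
    (hφ : IsGlobalFlow (𝓡 2).tangent (fun p ↦ negHorizontal o p) φ) {p : TangentBundle (𝓡 2) M}
    {b : TangentBundle (𝓡 2) M → ℝ} (hb : MDifferentiableAt (𝓡 2).tangent 𝓘(ℝ, ℝ) b p)
    (ζ : TangentSpace (𝓡 2).tangent p) :
    canonicalOneForm (φ (b p) p) (mfderiv (𝓡 2).tangent (𝓡 2).tangent (fun q ↦ φ (b q) q) p ζ) =
      canonicalOneForm (φ (b p) p) (mfderiv (𝓡 2).tangent (𝓡 2).tangent (φ (b p)) p ζ) := by
  have : T2Space (TangentBundle (𝓡 2) M) := t2Space_totalSpace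
  have hX := contMDiff_negHorizontal ho
  have hΦ : MDifferentiableAt (𝓘(ℝ, ℝ).prod (𝓡 2).tangent) (𝓡 2).tangent
      (fun z : ℝ × TangentBundle (𝓡 2) M ↦ φ z.1 z.2) (b p, p) :=
    (hφ.contMDiff hX).mdifferentiable (by simp) _
  rw [hφ.mfderiv_variable_time hb.hasMFDerivAt hΦ, map_add]
  refine add_eq_right.2 (((canonicalOneForm (φ (b p) p)).map_smul _ _).trans ?_)
  rw [canonicalOneForm_negHorizontal]
  exact smul_zero _

end Pullback

/-! ### The symplectomorphism -/

section Symplectomorphism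

section General

variable {E : Type*} [NormedAddCommGroup E] [NormedSpace ℝ E]
  {H : Type*} [TopologicalSpace H] {J : ModelWithCorners ℝ E H}
  {N : Type*} [TopologicalSpace N] [ChartedSpace H N]

lemma chartForm_sub_smul (η θ : ∀ p : N, TangentSpace J p →L[ℝ] ℝ) (c : ℝ) (p : N) :
    chartForm (fun q ↦ η q - c • θ q) p = chartForm η p - c • chartForm θ p := rfl

variable [J.Boundaryless]

lemma mextDeriv_toOneForm_sub_smul {η θ : ∀ p : N, TangentSpace J p →L[ℝ] ℝ} {p : N}
    (hη : DifferentiableAt ℝ (chartForm η p) (extChartAt J p p))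
    (hθ : DifferentiableAt ℝ (chartForm θ p) (extChartAt J p p)) (c : ℝ)
    (ξ ζ : TangentSpace J p) :
    mextDeriv J (toOneForm fun q ↦ η q - c • θ q) p ![ξ, ζ] =
      mextDeriv J (toOneForm η) p ![ξ, ζ] - c * mextDeriv J (toOneForm θ) p ![ξ, ζ] := by
  have h := hη.sub (hθ.const_smul c)
  rw [← chartForm_sub_smul] at h
  rw [mextDeriv_toOneForm hη, mextDeriv_toOneForm hθ, mextDeriv_toOneForm h, chartForm_sub_smul,
    fderiv_sub hη (hθ.const_smul c), fderiv_const_smul hθ, mul_sub]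
  exact sub_sub_sub_comm _ _ _ _

end General

section Radial

variable {s r : ℝ}

/-- The factor `√(r² - s²) / r` by which vectors of length `r` are rescaled. -/
def radialScale (s r : ℝ) : ℝ := √(r ^ 2 - s ^ 2) / r

/-- The time `(1 / 2r) ln ((r - s) / (r + s))` for which vectors of length `r` flow. -/
def radialTime (s r : ℝ) : ℝ := 1 / (2 * r) * Real.log ((r - s) / (r + s))

lemma radius_sq_sub_pos (hs : 0 ≤ s) (hr : s < r) : 0 < r ^ 2 - s ^ 2 := by nlinarith

lemma exp_radialTime (hs : 0 ≤ s) (hr : s < r) :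
    Real.exp (r * radialTime s r) = √(r ^ 2 - s ^ 2) / (r + s) := by
  have h1 : 0 < r - s := sub_pos.2 hr
  have h2 : 0 < r + s := by linarith
  have h3 : r ≠ 0 := by linarith
  have h4 : r * radialTime s r = Real.log √((r - s) / (r + s)) := by
    rw [Real.log_sqrt (div_pos h1 h2).le, radialTime]
    field_simp
  rw [h4, Real.exp_log (Real.sqrt_pos.2 (div_pos h1 h2)),
    show r ^ 2 - s ^ 2 = (r - s) / (r + s) * (r + s) ^ 2 by field_simp; ring,
    Real.sqrt_mul (div_pos h1 h2).le, Real.sqrt_sq h2.le, mul_div_cancel_right₀ _ h2.ne']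

/-- The first of the two equations that determine the factor and the time. -/
lemma radialScale_mul_cosh (hs : 0 ≤ s) (hr : s < r) :
    radialScale s r * Real.cosh (r * radialTime s r) = 1 := by
  have h0 := Real.sqrt_pos.2 (radius_sq_sub_pos hs hr)
  have h1 := Real.sq_sqrt (radius_sq_sub_pos hs hr).le
  have h2 : 0 < r + s := by linarith
  have h3 : r ≠ 0 := by linarith
  rw [Real.cosh_eq, Real.exp_neg, exp_radialTime hs hr, radialScale]
  field_simp
  rw [h1]
  ring

/-- The second of the two equations that determine the factor and the time. -/
lemma radialScale_mul_sinh (hs : 0 ≤ s) (hr : s < r) :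
    radialScale s r * (r * Real.sinh (r * radialTime s r)) = -s := by
  have h0 := Real.sqrt_pos.2 (radius_sq_sub_pos hs hr)
  have h1 := Real.sq_sqrt (radius_sq_sub_pos hs hr).le
  have h2 : 0 < r + s := by linarith
  have h3 : r ≠ 0 := by linarith
  rw [Real.sinh_eq, Real.exp_neg, exp_radialTime hs hr, radialScale]
  field_simp
  rw [h1]
  ring

lemma radialScale_pos (hs : 0 ≤ s) (hr : s < r) : 0 < radialScale s r :=
  div_pos (Real.sqrt_pos.2 (radius_sq_sub_pos hs hr)) (hs.trans_lt hr)

lemma radialScale_mul_radius (hs : 0 ≤ s) (hr : s < r) :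
    radialScale s r * r = √(r ^ 2 - s ^ 2) :=
  div_mul_cancel₀ _ (hs.trans_lt hr).ne'

lemma contDiffAt_radialScale (hs : 0 ≤ s) (hr : s < r) : ContDiffAt ℝ ∞ (radialScale s) r :=
  (((contDiffAt_id.pow 2).sub contDiffAt_const).sqrt (radius_sq_sub_pos hs hr).ne').div
    contDiffAt_id (hs.trans_lt hr).ne'

lemma contDiffAt_radialTime (hs : 0 ≤ s) (hr : s < r) : ContDiffAt ℝ ∞ (radialTime s) r := by
  have h1 : 0 < r - s := sub_pos.2 hr
  have h2 : 0 < r + s := by linarith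
  have h3 : 2 * r ≠ 0 := by linarith
  exact (contDiffAt_const.div (contDiffAt_const.mul contDiffAt_id) h3).mul
    (((contDiffAt_id.sub contDiffAt_const).div (contDiffAt_id.add contDiffAt_const) h2.ne').log
      (div_pos h1 h2).ne')

end Radial

variable {M : Type*} [TopologicalSpace M] [ChartedSpace (EuclideanSpace ℝ (Fin 2)) M]
  [RiemannianBundle (fun x : M ↦ TangentSpace (𝓡 2) x)]
  {φ : ℝ → TangentBundle (𝓡 2) M → TangentBundle (𝓡 2) M}

/-- Flow for the time `radialTime s |v|`, then rescale by `radialScale s |v|`. -/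
def untwist (φ : ℝ → TangentBundle (𝓡 2) M → TangentBundle (𝓡 2) M) (s : ℝ)
    (p : TangentBundle (𝓡 2) M) : TangentBundle (𝓡 2) M :=
  fiberScale (radialScale s ‖p.snd‖) (φ (radialTime s ‖p.snd‖) p)

/-- The inverse of `untwist`. A vector of length `c` comes from one of length `√(c² + s²)`. -/
def twist (φ : ℝ → TangentBundle (𝓡 2) M → TangentBundle (𝓡 2) M) (s : ℝ)
    (q : TangentBundle (𝓡 2) M) : TangentBundle (𝓡 2) M :=
  φ (-radialTime s √(‖q.snd‖ ^ 2 + s ^ 2))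
    (fiberScale (radialScale s √(‖q.snd‖ ^ 2 + s ^ 2))⁻¹ q)

lemma snd_ne_zero {s : ℝ} {p : TangentBundle (𝓡 2) M} (hs : 0 ≤ s) (hp : s < ‖p.snd‖) :
    p.snd ≠ 0 :=
  norm_pos_iff.1 (hs.trans_lt hp)

lemma lt_sqrt_norm_sq_add {s : ℝ} {q : TangentBundle (𝓡 2) M} (hq : q.snd ≠ 0) :
    s < √(‖q.snd‖ ^ 2 + s ^ 2) := by
  have := norm_pos_iff.2 hq
  exact Real.lt_sqrt_of_sq_lt (by nlinarith)

variable [IsManifold (𝓡 2) ∞ M]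
  {o : ∀ x : M, Orientation ℝ (TangentSpace (𝓡 2) x) (Fin 2)}

variable [IsContMDiffRiemannianBundle (𝓡 2) ∞ (EuclideanSpace ℝ (Fin 2))
      (fun x : M ↦ TangentSpace (𝓡 2) x)] {s : ℝ} {p q : TangentBundle (𝓡 2) M}

lemma continuous_norm_snd : Continuous fun p : TangentBundle (𝓡 2) M ↦ ‖p.snd‖ := by
  refine (contMDiff_normSq (M := M)).continuous.sqrt.congr fun p ↦ ?_
  exact Real.sqrt_sq (norm_nonneg (E := TangentSpace (𝓡 2) p.proj) p.snd)

lemma isOpen_annulusBundle (a b : ℝ) : IsOpen (annulusBundle (n := 2) M a b) :=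
  (isOpen_lt continuous_const continuous_norm_snd).inter
    (isOpen_lt continuous_norm_snd continuous_const)

lemma contMDiffAt_norm_snd (hp : p.snd ≠ 0) : ContMDiffAt (𝓡 2).tangent 𝓘(ℝ, ℝ) ∞
    (fun p : TangentBundle (𝓡 2) M ↦ ‖p.snd‖) p := by
  have h1 : normSq p ≠ 0 := pow_ne_zero 2 (norm_ne_zero_iff.2 hp)
  refine ((Real.contDiffAt_sqrt (n := ∞) h1).contMDiffAt.comp p
    (contMDiff_normSq.contMDiffAt)).congr_of_eventuallyEq (Filter.Eventually.of_forall fun p ↦ ?_)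
  exact (Real.sqrt_sq (norm_nonneg p.snd)).symm

lemma IsGlobalFlow.norm_untwist
    (hφ : IsGlobalFlow (𝓡 2).tangent (fun p ↦ negHorizontal o p) φ) (hs : 0 ≤ s)
    (hp : s < ‖p.snd‖) : ‖(untwist φ s p).snd‖ = √(‖p.snd‖ ^ 2 - s ^ 2) := by
  rw [untwist, norm_fiberScale, hφ.norm_eq, abs_of_pos (radialScale_pos hs hp),
    radialScale_mul_radius hs hp]

lemma IsGlobalFlow.norm_twist
    (hφ : IsGlobalFlow (𝓡 2).tangent (fun p ↦ negHorizontal o p) φ) (hs : 0 ≤ s)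
    (hq : q.snd ≠ 0) : ‖(twist φ s q).snd‖ = √(‖q.snd‖ ^ 2 + s ^ 2) := by
  have h1 := lt_sqrt_norm_sq_add (s := s) hq
  rw [twist, hφ.norm_eq, norm_fiberScale, abs_of_pos (inv_pos.2 (radialScale_pos hs h1)),
    inv_mul_eq_iff_eq_mul₀ (radialScale_pos hs h1).ne', radialScale_mul_radius hs h1,
    Real.sq_sqrt (by positivity), add_sub_cancel_right, Real.sqrt_sq (norm_nonneg _)]

/-- The twisted form `ω_s` is the exterior derivative of `α - s θ` off the zero section. -/
lemma twistedForm_eq (hp : p.snd ≠ 0) (ho : IsOrientationOfSurface o)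
    (hκ : ∀ x : M, gaussCurvature x = -1) (ξ ζ : TangentSpace (𝓡 2).tangent p) :
    mextDeriv (𝓡 2).tangent (toOneForm fun q : TangentBundle (𝓡 2) M ↦
      canonicalOneForm q - s • connectionForm o q) p ![ξ, ζ] = twistedForm o s p ξ ζ := by
  have hα := differentiableAt_chartForm_canonicalOneForm p
  have hθ := differentiableAt_chartForm_connectionForm ho hp
  have h1 := mextDeriv_connectionForm ho hκ hp ξ ζ
  have h2 : (o p.proj).areaForm (dproj p ξ) (dproj p ζ) =
      tangentMetric p.proj (tangentRotation o p.proj ξ.1) ζ.1 := by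
    rw [dproj_apply p ξ, dproj_apply p ζ]
    exact ((o p.proj).inner_rightAngleRotation_left _ _).symm
  rw [twistedForm, h2, ← h1]
  exact mextDeriv_toOneForm_sub_smul hα hθ s ξ ζ

variable [T2Space M]

lemma IsGlobalFlow.flow_neg (ho : IsOrientationOfSurface o)
    (hφ : IsGlobalFlow (𝓡 2).tangent (fun p ↦ negHorizontal o p) φ) (t : ℝ)
    (p : TangentBundle (𝓡 2) M) : φ (-t) (φ t p) = p := by
  have : T2Space (TangentBundle (𝓡 2) M) := t2Space_totalSpace
  rw [← hφ.add (contMDiff_negHorizontal ho), neg_add_cancel, hφ.zero]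

lemma IsGlobalFlow.twist_untwist (ho : IsOrientationOfSurface o)
    (hφ : IsGlobalFlow (𝓡 2).tangent (fun p ↦ negHorizontal o p) φ) (hs : 0 ≤ s)
    (hp : s < ‖p.snd‖) : twist φ s (untwist φ s p) = p := by
  have hr : √(‖(untwist φ s p).snd‖ ^ 2 + s ^ 2) = ‖p.snd‖ := by
    rw [hφ.norm_untwist hs hp, Real.sq_sqrt (radius_sq_sub_pos hs hp).le, sub_add_cancel,
      Real.sqrt_sq (norm_nonneg _)]
  rw [twist, hr, untwist, fiberScale_fiberScale,
    inv_mul_cancel₀ (radialScale_pos hs hp).ne', fiberScale_one, hφ.flow_neg ho]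

lemma IsGlobalFlow.untwist_twist (ho : IsOrientationOfSurface o)
    (hφ : IsGlobalFlow (𝓡 2).tangent (fun p ↦ negHorizontal o p) φ) (hs : 0 ≤ s)
    (hq : q.snd ≠ 0) : untwist φ s (twist φ s q) = q := by
  have h := hφ.flow_neg ho (-radialTime s √(‖q.snd‖ ^ 2 + s ^ 2))
    (fiberScale (radialScale s √(‖q.snd‖ ^ 2 + s ^ 2))⁻¹ q)
  rw [neg_neg] at h
  rw [untwist, hφ.norm_twist hs hq, twist, h, fiberScale_fiberScale,
    mul_inv_cancel₀ (radialScale_pos hs (lt_sqrt_norm_sq_add hq)).ne', fiberScale_one]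

lemma IsGlobalFlow.contMDiffAt_variable_time (ho : IsOrientationOfSurface o)
    (hφ : IsGlobalFlow (𝓡 2).tangent (fun p ↦ negHorizontal o p) φ)
    {b : TangentBundle (𝓡 2) M → ℝ} {f : TangentBundle (𝓡 2) M → TangentBundle (𝓡 2) M}
    (hb : ContMDiffAt (𝓡 2).tangent 𝓘(ℝ, ℝ) ∞ b p)
    (hf : ContMDiffAt (𝓡 2).tangent (𝓡 2).tangent ∞ f p) :
    ContMDiffAt (𝓡 2).tangent (𝓡 2).tangent ∞ (fun q ↦ φ (b q) (f q)) p := by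
  have : T2Space (TangentBundle (𝓡 2) M) := t2Space_totalSpace
  exact ((hφ.contMDiff (contMDiff_negHorizontal ho)).contMDiffAt (x := (b p, f p))).comp p
    (hb.prodMk hf)

lemma IsGlobalFlow.contMDiffAt_untwist (ho : IsOrientationOfSurface o)
    (hφ : IsGlobalFlow (𝓡 2).tangent (fun p ↦ negHorizontal o p) φ) (hs : 0 ≤ s)
    (hp : s < ‖p.snd‖) : ContMDiffAt (𝓡 2).tangent (𝓡 2).tangent ∞ (untwist φ s) p := by
  have hn := contMDiffAt_norm_snd (snd_ne_zero hs hp)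
  exact contMDiffAt_fiberScale ((contDiffAt_radialScale hs hp).contMDiffAt.comp p hn)
    (hφ.contMDiffAt_variable_time ho ((contDiffAt_radialTime hs hp).contMDiffAt.comp p hn)
      contMDiffAt_id)

lemma IsGlobalFlow.contMDiffAt_twist (ho : IsOrientationOfSurface o)
    (hφ : IsGlobalFlow (𝓡 2).tangent (fun p ↦ negHorizontal o p) φ) (hs : 0 ≤ s)
    (hq : q.snd ≠ 0) : ContMDiffAt (𝓡 2).tangent (𝓡 2).tangent ∞ (twist φ s) q := by
  have hr := lt_sqrt_norm_sq_add (s := s) hq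
  have hn : ContMDiffAt (𝓡 2).tangent 𝓘(ℝ, ℝ) ∞
      (fun q : TangentBundle (𝓡 2) M ↦ √(‖q.snd‖ ^ 2 + s ^ 2)) q := by
    have h1 : ContDiffAt ℝ ∞ (fun r : ℝ ↦ √(r + s ^ 2)) (normSq q) := by
      refine (contDiffAt_id.add contDiffAt_const).sqrt ?_
      have : 0 < normSq q := pow_pos (norm_pos_iff.2 hq) 2
      positivity
    exact h1.contMDiffAt.comp q contMDiff_normSq.contMDiffAt
  refine hφ.contMDiffAt_variable_time ho
    (b := fun q ↦ -radialTime s √(‖q.snd‖ ^ 2 + s ^ 2)) ?_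
    (contMDiffAt_fiberScale ?_ contMDiffAt_id)
  · exact ContMDiffAt.comp (g := fun r ↦ -radialTime s r) q
      (contDiffAt_radialTime hs hr).neg.contMDiffAt hn
  · exact ContMDiffAt.comp (g := fun r ↦ (radialScale s r)⁻¹) q
      ((contDiffAt_radialScale hs hr).inv (radialScale_pos hs hr).ne').contMDiffAt hn

/-- The map `untwist` pulls the canonical form `α` back to `α - s θ`, where `θ` is the connection
form: the coefficients of the hyperbolic rotation, multiplied by the scaling factor, are `1` and
`-s`. -/
theorem IsGlobalFlow.pullback_untwist (ho : IsOrientationOfSurface o)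
    (hκ : ∀ x : M, gaussCurvature x = -1)
    (hφ : IsGlobalFlow (𝓡 2).tangent (fun p ↦ negHorizontal o p) φ) (hs : 0 ≤ s)
    (hp : s < ‖p.snd‖) (ζ : TangentSpace (𝓡 2).tangent p) :
    canonicalOneForm (untwist φ s p)
        (mfderiv (𝓡 2).tangent (𝓡 2).tangent (untwist φ s) p ζ) =
      canonicalOneForm p ζ - s * connectionForm o p ζ := by
  have hne := snd_ne_zero hs hp
  have hb : ContMDiffAt (𝓡 2).tangent 𝓘(ℝ, ℝ) ∞
      (fun p : TangentBundle (𝓡 2) M ↦ radialTime s ‖p.snd‖) p :=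
    (contDiffAt_radialTime hs hp).contMDiffAt.comp p (contMDiffAt_norm_snd hne)
  have h1 := fst_mfderiv_congr ((hφ.contMDiffAt_untwist ho hs hp).mdifferentiableAt (by simp))
    ((hφ.contMDiffAt_variable_time ho hb contMDiffAt_id).mdifferentiableAt (by simp))
    (fun _ ↦ rfl) ζ
  have h2 := canonicalOneForm_fiberScale (radialScale s ‖p.snd‖) (φ (radialTime s ‖p.snd‖) p)
    _ _ h1
  have h3 := hφ.canonicalOneForm_mfderiv_variable_time ho (hb.mdifferentiableAt (by simp)) ζ
  have h4 := hφ.pullback_canonicalOneForm ho hκ hne (radialTime s ‖p.snd‖) ζ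
  refine h2.trans ((congrArg (radialScale s ‖p.snd‖ * ·) (h3.trans h4)).trans ?_)
  linear_combination canonicalOneForm p ζ * radialScale_mul_cosh hs hp +
    connectionForm o p ζ * radialScale_mul_sinh hs hp

/-- The map `untwist` pulls `ω₀ = dα` back to `ω_s = d(α - s θ)`. -/
lemma IsGlobalFlow.twistedForm_untwist (ho : IsOrientationOfSurface o)
    (hκ : ∀ x : M, gaussCurvature x = -1)
    (hφ : IsGlobalFlow (𝓡 2).tangent (fun p ↦ negHorizontal o p) φ) (hs : 0 ≤ s)
    (hp : s < ‖p.snd‖) (ξ ζ : TangentSpace (𝓡 2).tangent p) :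
    twistedForm o 0 (untwist φ s p)
        (mfderiv (𝓡 2).tangent (𝓡 2).tangent (untwist φ s) p ξ)
        (mfderiv (𝓡 2).tangent (𝓡 2).tangent (untwist φ s) p ζ) =
      twistedForm o s p ξ ζ := by
  have : IsManifold (𝓡 2).tangent 2 (TangentBundle (𝓡 2) M) := .of_le (n := ∞) ENat.LEInfty.out
  have hα := differentiableAt_chartForm_canonicalOneForm p
  have hθ := differentiableAt_chartForm_connectionForm ho (snd_ne_zero hs hp)
  have hopen : ∀ᶠ q : TangentBundle (𝓡 2) M in 𝓝 p, s < ‖q.snd‖ :=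
    (isOpen_lt continuous_const continuous_norm_snd).mem_nhds hp
  rw [← twistedForm_eq (snd_ne_zero hs hp) ho hκ, twistedForm, zero_mul, sub_zero]
  exact mextDeriv_toOneForm_pullback
    ((hφ.contMDiffAt_untwist ho hs hp).of_le ENat.LEInfty.out)
    (differentiableAt_chartForm_canonicalOneForm _)
    (η' := fun q ↦ canonicalOneForm q - s • connectionForm o q)
    (hα.sub (hθ.const_smul s))
    (hopen.mono fun q hq ↦ hφ.pullback_untwist ho hκ hs hq) ξ ζ

/-- The diffeomorphism `untwist` between annulus bundles. -/
def IsGlobalFlow.untwistDiffeomorph (ho : IsOrientationOfSurface o)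
    (hφ : IsGlobalFlow (𝓡 2).tangent (fun p ↦ negHorizontal o p) φ) (hs : 0 ≤ s)
    {l : ℝ} (hl : 0 ≤ l) :
    PartialDiffeomorph (𝓡 2).tangent (𝓡 2).tangent (TangentBundle (𝓡 2) M)
      (TangentBundle (𝓡 2) M) ∞ where
  toFun := untwist φ s
  invFun := twist φ s
  source := annulusBundle M s l
  target := annulusBundle M 0 √(l ^ 2 - s ^ 2)
  map_source' p hp := by
    have h := radius_sq_sub_pos hs hp.1
    refine ⟨?_, ?_⟩ <;> rw [hφ.norm_untwist hs hp.1]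
    · exact Real.sqrt_pos.2 h
    · exact Real.sqrt_lt_sqrt h.le (by nlinarith [hp.1, hp.2])
  map_target' q hq := by
    have h := norm_pos_iff.1 hq.1
    refine ⟨?_, ?_⟩ <;> rw [hφ.norm_twist hs h]
    · exact lt_sqrt_norm_sq_add h
    · have h1 := (Real.lt_sqrt hq.1.le).1 hq.2
      have h2 : ‖q.snd‖ ^ 2 + s ^ 2 < l ^ 2 := by linarith
      exact (Real.sqrt_lt_sqrt (by positivity) h2).trans_eq (Real.sqrt_sq hl)
  left_inv' p hp := hφ.twist_untwist ho hs hp.1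
  right_inv' q hq := hφ.untwist_twist ho hs (norm_pos_iff.1 hq.1)
  open_source := isOpen_annulusBundle s l
  open_target := isOpen_annulusBundle 0 _
  contMDiffOn_toFun p hp := (hφ.contMDiffAt_untwist ho hs hp.1).contMDiffWithinAt
  contMDiffOn_invFun q hq :=
    (hφ.contMDiffAt_twist ho hs (norm_pos_iff.1 hq.1)).contMDiffWithinAt

end Symplectomorphism

end TwistedBundle

end

theorem mainTheorem4 {M : Type*} [TopologicalSpace M] [T2Space M] [CompactSpace M]
    [ConnectedSpace M] [ChartedSpace (EuclideanSpace ℝ (Fin 2)) M] [IsManifold (𝓡 2) ∞ M]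
    [RiemannianBundle (fun x : M ↦ TangentSpace (𝓡 2) x)]
    [IsContMDiffRiemannianBundle (𝓡 2) ∞ (EuclideanSpace ℝ (Fin 2))
      (fun x : M ↦ TangentSpace (𝓡 2) x)]
    (o : ∀ x : M, Orientation ℝ (TangentSpace (𝓡 2) x) (Fin 2))
    (ho : TwistedBundle.IsOrientationOfSurface o)
    (hκ : ∀ x : M, TwistedBundle.gaussCurvature x = -1)
    (s lam : ℝ) (hs : 0 ≤ s) (hslam : s < lam) :
    ∃ φ : ℝ → TangentBundle (𝓡 2) M → TangentBundle (𝓡 2) M,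
      TwistedBundle.IsGlobalFlow (𝓡 2).tangent
        (fun p ↦ -TwistedBundle.horizontalField o p) φ ∧
      ∃ F : PartialDiffeomorph (𝓡 2).tangent (𝓡 2).tangent
          (TangentBundle (𝓡 2) M) (TangentBundle (𝓡 2) M) ∞,
        F.source = TwistedBundle.annulusBundle M s lam ∧
        F.target = TwistedBundle.annulusBundle M 0 (√(lam ^ 2 - s ^ 2)) ∧
        (∀ p ∈ TwistedBundle.annulusBundle M s lam, ∀ ξ ζ : TangentSpace (𝓡 2).tangent p,
          TwistedBundle.twistedForm o 0 (F p)
              (mfderiv (𝓡 2).tangent (𝓡 2).tangent F p ξ)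
              (mfderiv (𝓡 2).tangent (𝓡 2).tangent F p ζ)
            = TwistedBundle.twistedForm o s p ξ ζ) ∧
        ∀ p ∈ TwistedBundle.annulusBundle M s lam,
          F p = TwistedBundle.fiberScale (√(‖p.snd‖ ^ 2 - s ^ 2) / ‖p.snd‖)
            (φ (1 / (2 * ‖p.snd‖) * Real.log ((‖p.snd‖ - s) / (‖p.snd‖ + s))) p) := by
  obtain ⟨φ, hφ⟩ := TwistedBundle.exists_isGlobalFlow_negHorizontal ho
  refine ⟨φ, ?_, hφ.untwistDiffeomorph ho hs (hs.trans hslam.le), rfl, rfl,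
    fun p hp ξ ζ ↦ hφ.twistedForm_untwist ho hκ hs hp.1 ξ ζ, fun p _ ↦ rfl⟩
  rwa [TwistedBundle.neg_horizontalField_eq]
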